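/- \textbf{Notation.} Let $m$ be Lebesgue measure on $(0,\infty)$, and let functions be real-valued, measurable and finite a.e., identified when equal a.e. Let $S_0$ be the set of $x$ with $m(\{|x|>s\})<\infty$ for some $s$. For such $x$ let $$x^*(t)=\inf\{s\ge 0:\ m(\{|x|\ge s\})\le t\}\quad(t>0),\qquad x^*(\infty)=\lim_{t\to\infty}x^*(t),$$ and write $y\prec\prec x$ if $\int_0^t y^*(s)\,ds\le\int_0^t x^*(s)\,ds$ for all $t\ge 0$. A symmetric space on $(0,\infty)$ is a Banach space $E\subseteq S_0$ of such functions such that (i) $x\in E$, $|y|\le|x|$ imply $y\in E$ and $\|y\|_E\le\|x\|_E$, and (ii) $x\in E$, $y^*=x^*$ imply $y\in E$ and $\|y\|_E=\|x\|_E$. It is fully symmetric if, moreover, $x\in E$, $y\in L_1+L_\infty$, $y\prec\prec x$ imply $y\in E$ and $\|y\|_E\le\|x\|_E$. (Then $E\subseteq L_1+L_\infty$.) Let $(\sigma_s f)(t)=f(t/s)$ for $s>0$, and for $x\in E$ put $$\varphi(x)=\lim_{s\to\infty}\frac1s\,\|\sigma_s(x^*)\|_E .$$ Let $\Sigma_+$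 be the set of all positive linear operators $T:L_1+L_\infty\to L_1+L_\infty$ which map $L_1$ into $L_1$ and $L_\infty$ into $L_\infty$ with $\|T\|_{L_1\to L_1}\le1$ and $\|T\|_{L_\infty\to L_\infty}\le 1$. For $0\le x\in E$ let $\Omega_+(x)=\{Tx:\ T\in\Sigma_+\}$ be the orbit of $x$, and let $$Q'(x)=\overline{\mathrm{Conv}}\{y:\ y^*=x^*,\ y\,\chi_{\{y<y^*(\infty)\}}=0\},$$ where $\overline{\mathrm{Conv}}$ is the convex hull closed in the norm of $E$. \textbf{Theorem.} Let $E=E(0,\infty)$ be a fully symmetric space on the semi-axis and let $0\le x\in E$. If $\varphi(x)=0$, then $\Omega_+(x)=Q'(x)$. -/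

import Mathlib

open MeasureTheory Set Filter Topology
open scoped ENNReal

namespace SymmOrbit

noncomputable section

/-- Lebesgue measure on the semi-axis `(0, ∞)`. -/
abbrev leb : Measure ℝ := volume.restrict (Ioi (0 : ℝ))

/-- The space of (classes modulo equality almost everywhere of) real-valued, almost everywhere
finite, measurable functions on `(0, ∞)`. -/
abbrev L0 : Type := ℝ →ₘ[leb] ℝ

/-- `S₀`: the functions `x` such that `m {|x| > s}` is finite for some `s`. -/
def S0 : Set L0 := {x | ∃ s : ℝ, leb {t | s < |x t|} < ∞}

/-- `L₁(0, ∞)` as a subspace of `L0`. -/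
abbrev L1 : Submodule ℝ L0 := Lp.LpSubmodule ℝ ℝ 1 leb

/-- `L_∞(0, ∞)` as a subspace of `L0`. -/
abbrev Linf : Submodule ℝ L0 := Lp.LpSubmodule ℝ ℝ ∞ leb

/-- `L₁ + L_∞`. -/
abbrev L1Linf : Submodule ℝ L0 := L1 ⊔ Linf

/-- The non-increasing rearrangement
`x* (t) = inf {s ≥ 0 : m {|x| ≥ s} ≤ t}`, `t > 0`, with values in `[0, ∞]`
(it is finite for all `t > 0` when `x ∈ S₀`, and identically `∞` otherwise). -/
def rearr (x : L0) (t : ℝ) : ℝ≥0∞ :=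
  sInf {s : ℝ≥0∞ | leb {u | s ≤ ENNReal.ofReal |x u|} ≤ ENNReal.ofReal t}

/-- `x` and `y` are equimeasurable: `y* = x*` on `(0, ∞)`. -/
def Equimeasurable (y x : L0) : Prop := ∀ t : ℝ, 0 < t → rearr y t = rearr x t

/-- Hardy–Littlewood–Pólya submajorization `y ≺≺ x`. -/
def Submajorized (y x : L0) : Prop :=
  ∀ t : ℝ, 0 ≤ t → ∫⁻ s in Ioc 0 t, rearr y s ≤ ∫⁻ s in Ioc 0 t, rearr x s

/-- `x* (∞) = lim_{t → ∞} x* (t)`; since `x*` is non-increasing, the limit is the infimum. -/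
def rearrTop (x : L0) : ℝ≥0∞ := ⨅ t : ℝ, rearr x t

theorem rearr_antitone (x : L0) : Antitone (rearr x) := fun _ _ h =>
  sInf_le_sInf fun _ hs => le_trans hs (ENNReal.ofReal_le_ofReal h)

/-- The dilation `(σ_τ f) (t) = f (t / τ)`. -/
def dilate {β : Type*} (τ : ℝ) (f : ℝ → β) : ℝ → β := fun t => f (t / τ)

theorem measurable_dilate_rearr (τ : ℝ) (x : L0) :
    Measurable (dilate τ fun t => (rearr x t).toReal) :=
  (rearr_antitone x).measurable.ennreal_toReal.comp (measurable_id.div_const τ)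

/-- `σ_τ (x*)` as an element of `L0`. -/
def dilatedRearr (τ : ℝ) (x : L0) : L0 :=
  AEEqFun.mk (dilate τ fun t => (rearr x t).toReal)
    (measurable_dilate_rearr τ x).aestronglyMeasurable

/-- A Banach space of measurable functions on `(0, ∞)`: a linear subspace of `L0` with a
complete norm. Only the values of `norm` on `carrier` are meaningful. -/
structure BanachFunctionSpace where
  carrier : Submodule ℝ L0
  norm : L0 → ℝ
  norm_add_le : ∀ x ∈ carrier, ∀ y ∈ carrier, norm (x + y) ≤ norm x + norm y
  norm_smul : ∀ (c : ℝ), ∀ x ∈ carrier, norm (c • x) = |c| * norm x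
  eq_zero_of_norm : ∀ x ∈ carrier, norm x = 0 → x = 0
  complete : ∀ u : ℕ → L0, (∀ n, u n ∈ carrier) →
    (∀ ε > 0, ∃ N, ∀ m ≥ N, ∀ n ≥ N, norm (u m - u n) < ε) →
    ∃ l ∈ carrier, Tendsto (fun n => norm (u n - l)) atTop (𝓝 0)

namespace BanachFunctionSpace

/-- `E` is an ideal lattice. -/
def IsIdealLattice (E : BanachFunctionSpace) : Prop :=
  ∀ x ∈ E.carrier, ∀ y : L0, |y| ≤ |x| → y ∈ E.carrier ∧ E.norm y ≤ E.norm x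

/-- `E` is a symmetric space. -/
structure IsSymmetric (E : BanachFunctionSpace) : Prop where
  ideal : E.IsIdealLattice
  subset_S0 : ∀ x ∈ E.carrier, x ∈ S0
  symm : ∀ x ∈ E.carrier, ∀ y : L0, Equimeasurable y x → y ∈ E.carrier ∧ E.norm y = E.norm x

/-- `E` is a fully symmetric space. -/
structure IsFullySymmetric (E : BanachFunctionSpace) : Prop extends E.IsSymmetric where
  full : ∀ x ∈ E.carrier, ∀ y ∈ L1Linf, Submajorized y x → y ∈ E.carrier ∧ E.norm y ≤ E.norm x

/-- The limit `φ (x) = lim_{s → ∞} (1 / s) ‖σ_s (x*)‖_E` exists and equals `l`. -/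
def HasDilationLimit (E : BanachFunctionSpace) (x : L0) (l : ℝ) : Prop :=
  Tendsto (fun s : ℝ => 1 / s * E.norm (dilatedRearr s x)) atTop (𝓝 l)

/-- The closure of a set `A` with respect to the norm of `E`. -/
def normClosure (E : BanachFunctionSpace) (A : Set L0) : Set L0 :=
  {y | y ∈ E.carrier ∧ ∀ ε > 0, ∃ z ∈ A, z ∈ E.carrier ∧ E.norm (y - z) < ε}

/-- `Q' (x)`: the norm-closed convex hull of the set of all `y` such that `y* = x*` and
`y χ_{y < y* (∞)} = 0`. -/
def Qprime (E : BanachFunctionSpace) (x : L0) : Set L0 :=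
  E.normClosure (convexHull ℝ {y : L0 | Equimeasurable y x ∧
    ∀ᵐ t ∂leb, y t < (rearrTop y).toReal → y t = 0})

end BanachFunctionSpace

/-- `T ∈ Σ₊`: a positive linear operator on `L₁ + L_∞` that is a contraction
both of `L₁` and of `L_∞`. -/
structure IsSubstochastic (T : L1Linf →ₗ[ℝ] L1Linf) : Prop where
  nonneg : ∀ f : L1Linf, (0 : L0) ≤ f → (0 : L0) ≤ T f
  contr_L1 : ∀ f : L1Linf, (f : L0) ∈ L1 →
    (T f : L0) ∈ L1 ∧ eLpNorm (T f : L0) 1 leb ≤ eLpNorm (f : L0) 1 leb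
  contr_Linf : ∀ f : L1Linf, (f : L0) ∈ Linf →
    (T f : L0) ∈ Linf ∧ eLpNorm (T f : L0) ∞ leb ≤ eLpNorm (f : L0) ∞ leb

/-- The orbit `Ω₊ (x) = {T x : T ∈ Σ₊}` of `x ∈ L₁ + L_∞`. -/
def orbitPlus (x : L0) : Set L0 :=
  {y | ∃ T : L1Linf →ₗ[ℝ] L1Linf, IsSubstochastic T ∧
    ∃ f : L1Linf, (f : L0) = x ∧ (T f : L0) = y}

end

end SymmOrbit

/-! Everything is measured by the excess ∫(|u| - s)₊. By the layer-cake formula it depends only on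
the distribution function, and for t > 0 the integral of u* over (0, t) is the minimum over s of
excess + st. Domination of excesses therefore gives submajorization and, E being fully symmetric,
domination of norms (`mem_of_excess_le`). The excess of (1/M) σ_M x* at s is the excess of x at Ms,
so φ(x) = 0 says: if the excess of e at s is at most that of x at Ms for all s, then e has small
norm once M is large (`exists_nat_norm_lt`).

The orbit lies in Q'(x). Let g be a nonnegative representative of a generator. If the complement of
F has infinite measure, the part of g outside F can be moved to any of N disjoint sets; averaging
the N generators leaves g on F plus N disjoint copies of g/N, which are small by the hypothesis, so
gχ_F is in Q'(x). Further averaging removes the condition on F, then gives every 0 ≤ p ≤ g, and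
finally every y ≥ 0 whose distribution function is dominated by that of x
(`mem_Qprime_of_distr_le`). To reach Tx, let X be x raised to the level x*(∞), which has the same
distribution, and cut the half-line into cells of finite measure on which TX is almost constant. On
a cell A, r ↦ ∫_A Tχ_{X > r} acts as a distribution function, and the mean of TX over A is compared
with the mean of M of its quantiles. Splitting each cell into M equal parts and permuting the
quantiles cyclically gives M functions with distribution dominated by that of x, whose average takes
the mean quantile on each cell. The defect has excess at s at most that of x at Ms, so it is small
again (`lintegral_stepFun_sub_le`).

Q'(x) lies in the orbit. The orbit is convex, so it suffices that generators are in its closure and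
that it is closed. A generator y is approximated, with small relative error, by x ∘ ψ, where ψ
transports geometric level sets of y into those of x (`exists_isSubstochastic_of_mem_gens`).
Closedness is a weak compactness argument: along an ultrafilter the weighted integrals of T_n f over
sets converge, uniform absolute continuity provides densities, and these define a limit operator in
Σ₊ (`exists_ultralimit`). -/

open MeasureTheory Set Filter Topology
open scoped ENNReal

namespace SymmOrbit

noncomputable section

/-! ### Distribution function, excess and submajorization. -/

/-- The distribution function `s ↦ m {|x| > s}`. -/
def distr (x : L0) (s : ℝ≥0∞) : ℝ≥0∞ := leb {u | s < ENNReal.ofReal |x u|}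

/-- The excess `∫ (|x| - s)₊`. -/
def excess (x : L0) (s : ℝ≥0∞) : ℝ≥0∞ := ∫⁻ u, (ENNReal.ofReal |x u| - s) ∂leb

theorem measurable_ofReal_abs (x : L0) : Measurable fun u => ENNReal.ofReal |x u| :=
  (continuous_abs.measurable.comp x.measurable).ennreal_ofReal

theorem distr_antitone (x : L0) : Antitone (distr x) := fun _ _ h =>
  measure_mono fun _ hu => lt_of_le_of_lt h hu

theorem excess_antitone (x : L0) : Antitone (excess x) := fun _ _ h =>
  lintegral_mono fun _ => tsub_le_tsub_left h _

/-- Right continuity of the distribution function, from continuity of the measure from below. -/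
theorem exists_lt_measure_gt {α : Type*} [MeasurableSpace α] (μ : Measure α) (f : α → ℝ≥0∞)
    {s a : ℝ≥0∞} (h : a < μ {u | s < f u}) : ∃ s' > s, a < μ {u | s' < f u} := by
  have hs : s < ∞ := by
    by_contra hs
    have : s = ∞ := by simpa using hs
    simp [this] at h
  obtain ⟨v, hv, hvs, hlim⟩ := exists_seq_strictAnti_tendsto' hs
  have hU : {u | s < f u} = ⋃ n, {u | v n < f u} := by
    ext u
    simp only [mem_ofPred_eq, mem_iUnion]
    constructor
    · intro hu
      exact (hlim.eventually (gt_mem_nhds hu)).exists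
    · rintro ⟨n, hn⟩
      exact (hvs n).1.trans hn
  have hm : Monotone fun n => {u | v n < f u} := fun m n hmn u hu =>
    lt_of_le_of_lt (hv.antitone hmn) hu
  rw [hU, hm.measure_iUnion] at h
  obtain ⟨n, hn⟩ := lt_iSup_iff.1 h
  exact ⟨v n, (hvs n).1, hn⟩

/-- Right continuity makes it irrelevant that x* is defined through {|x| ≥ s} while `distr` uses
strict inequality. -/
theorem lt_rearr_iff (x : L0) (t : ℝ) (s : ℝ≥0∞) :
    s < rearr x t ↔ ENNReal.ofReal t < distr x s := by
  constructor
  · intro h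
    by_contra hc
    refine absurd h (not_lt.2 (le_of_forall_gt_imp_ge_of_dense fun s' hs' => sInf_le ?_))
    exact (measure_mono fun u hu => lt_of_lt_of_le hs' hu).trans (not_lt.1 hc)
  · intro h
    obtain ⟨s', hs', h'⟩ := exists_lt_measure_gt leb _ h
    refine lt_of_lt_of_le hs' (le_sInf fun r hr => ?_)
    by_contra hc
    refine absurd (h'.trans_le ((measure_mono fun u hu => ?_).trans hr)) (lt_irrefl _)
    exact ((not_le.1 hc).trans hu).le

theorem rearr_eq_of_distr_eq {x y : L0} (h : ∀ s, distr y s = distr x s) (t : ℝ) :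
    rearr y t = rearr x t :=
  eq_of_forall_lt_iff fun s => by rw [lt_rearr_iff, lt_rearr_iff, h]

/-- Initial segments of length a are written in this form throughout so that a = ∞ is included. -/
theorem leb_ofReal_lt (a : ℝ≥0∞) : leb {t | ENNReal.ofReal t < a} = a := by
  have hm : MeasurableSet {t | ENNReal.ofReal t < a} :=
    measurableSet_lt ENNReal.measurable_ofReal measurable_const
  rw [Measure.restrict_apply hm]
  rcases eq_or_ne a ∞ with rfl | ha
  · have : {t | ENNReal.ofReal t < ∞} ∩ Ioi (0 : ℝ) = Ioi 0 := by ext; simp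
    rw [this, Real.volume_Ioi]
  · have : {t | ENNReal.ofReal t < a} ∩ Ioi (0 : ℝ) = Ioo 0 a.toReal := by
      ext t
      simp only [mem_inter_iff, mem_ofPred_eq, mem_Ioi, mem_Ioo]
      constructor
      · rintro ⟨h, h0⟩
        exact ⟨h0, (ENNReal.ofReal_lt_iff_lt_toReal h0.le ha).1 h⟩
      · rintro ⟨h0, h⟩
        exact ⟨(ENNReal.ofReal_lt_iff_lt_toReal h0.le ha).2 h, h0⟩
    rw [this, Real.volume_Ioo, sub_zero, ENNReal.ofReal_toReal ha]

theorem leb_lt_rearr (x : L0) (s : ℝ≥0∞) : leb {t | s < rearr x t} = distr x s := by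
  simp_rw [lt_rearr_iff, leb_ofReal_lt]

theorem ae_leb_pos : ∀ᵐ t ∂leb, 0 < t := ae_restrict_mem measurableSet_Ioi

theorem equimeasurable_iff {x y : L0} : Equimeasurable y x ↔ ∀ s, distr y s = distr x s := by
  constructor
  · intro h s
    rw [← leb_lt_rearr, ← leb_lt_rearr]
    refine measure_congr ?_
    filter_upwards [ae_leb_pos] with t ht
    exact propext (by change s < rearr y t ↔ s < rearr x t; rw [h t ht])
  · intro h t _
    exact rearr_eq_of_distr_eq h t

theorem lintegral_eq_lintegral_measure_lt {α : Type*} [MeasurableSpace α] (μ : Measure α)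
    [SFinite μ] {f : α → ℝ≥0∞} (hf : Measurable f) :
    ∫⁻ a, f a ∂μ = ∫⁻ r, μ {a | ENNReal.ofReal r < f a} ∂leb := by
  have h1 : ∀ a, f a = ∫⁻ r, ({p : α × ℝ | ENNReal.ofReal p.2 < f p.1}.indicator 1 (a, r)) ∂leb := by
    intro a
    conv_lhs => rw [← leb_ofReal_lt (f a)]
    rw [← lintegral_indicator_one
      (measurableSet_lt ENNReal.measurable_ofReal measurable_const)]
    rfl
  have hm : MeasurableSet {p : α × ℝ | ENNReal.ofReal p.2 < f p.1} :=
    measurableSet_lt (ENNReal.measurable_ofReal.comp measurable_snd) (hf.comp measurable_fst)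
  rw [lintegral_congr h1, lintegral_lintegral_swap]
  · refine lintegral_congr fun r => ?_
    rw [← lintegral_indicator_one (measurableSet_lt measurable_const hf)]
    rfl
  · exact (measurable_one.indicator hm).aemeasurable

/-- Layer cake: the excess is a monotone function of the distribution function alone. -/
theorem excess_eq_lintegral_distr (x : L0) (s : ℝ≥0∞) :
    excess x s = ∫⁻ r, distr x (s + ENNReal.ofReal r) ∂leb := by
  rw [excess, lintegral_eq_lintegral_measure_lt leb ((measurable_ofReal_abs x).sub_const s)]
  simp_rw [lt_tsub_iff_left, distr]

theorem lintegral_rearr_sub (x : L0) (s : ℝ≥0∞) :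
    ∫⁻ t, (rearr x t - s) ∂leb = excess x s := by
  rw [excess_eq_lintegral_distr, lintegral_eq_lintegral_measure_lt leb
    ((rearr_antitone x).measurable.sub_const s)]
  simp_rw [lt_tsub_iff_left, leb_lt_rearr]

theorem excess_le_of_distr_le {x y : L0} (h : ∀ s, distr y s ≤ distr x s) (s : ℝ≥0∞) :
    excess y s ≤ excess x s := by
  rw [excess_eq_lintegral_distr, excess_eq_lintegral_distr]
  exact lintegral_mono fun r => h _

/-- With `le_lintegral_Ioc_rearr` this expresses the integral of y* over (0, t) as a minimum over s,
attained at s = y*(t). Submajorization thereby reduces to comparing excesses. -/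
theorem lintegral_Ioc_rearr_le (y : L0) (t : ℝ) (s : ℝ≥0∞) :
    ∫⁻ r in Ioc 0 t, rearr y r ≤ excess y s + s * ENNReal.ofReal t := by
  calc ∫⁻ r in Ioc 0 t, rearr y r ≤ ∫⁻ r in Ioc 0 t, ((rearr y r - s) + s) :=
        lintegral_mono fun r => le_tsub_add
    _ = (∫⁻ r in Ioc 0 t, (rearr y r - s)) + s * ENNReal.ofReal t := by
        rw [lintegral_add_right _ measurable_const]
        simp
    _ ≤ _ := by
        gcongr
        rw [← lintegral_rearr_sub]
        exact lintegral_mono_set Ioc_subset_Ioi_self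

theorem le_lintegral_Ioc_rearr (z : L0) {t : ℝ} (ht : 0 < t) :
    excess z (rearr z t) + rearr z t * ENNReal.ofReal t ≤ ∫⁻ r in Ioc 0 t, rearr z r := by
  have hm := (rearr_antitone z).measurable
  have h1 : excess z (rearr z t) = ∫⁻ r in Ioc 0 t, (rearr z r - rearr z t) := by
    rw [← lintegral_rearr_sub, leb, ← Ioc_union_Ioi_eq_Ioi ht.le,
      lintegral_union measurableSet_Ioi (Ioc_disjoint_Ioi le_rfl)]
    have : ∫⁻ r in Ioi t, (rearr z r - rearr z t) = ∫⁻ r in Ioi t, 0 :=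
      setLIntegral_congr_fun measurableSet_Ioi fun r hr =>
        tsub_eq_zero_of_le (rearr_antitone z (le_of_lt hr))
    rw [this]
    simp
  have h2 : rearr z t * ENNReal.ofReal t = ∫⁻ _ in Ioc 0 t, rearr z t := by simp
  rw [h1, h2, ← lintegral_add_right _ measurable_const]
  refine (setLIntegral_mono hm fun r hr => ?_)
  rw [tsub_add_cancel_of_le (rearr_antitone z hr.2)]

theorem submajorized_of_excess_le {y z : L0} (h : ∀ s, excess y s ≤ excess z s) :
    Submajorized y z := by
  intro t ht
  rcases ht.eq_or_lt with rfl | ht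
  · simp
  · exact (lintegral_Ioc_rearr_le y t (rearr z t)).trans
      ((add_le_add_left (h _) _).trans (le_lintegral_Ioc_rearr z ht))

theorem excess_smul_le {x : L0} {c : ℝ} (hc : 0 < c) (s : ℝ≥0∞) :
    excess (c • x) s = ENNReal.ofReal c * excess x (s / ENNReal.ofReal c) := by
  have h0 : ENNReal.ofReal c ≠ 0 := by simpa using hc
  rw [excess, excess, ← lintegral_const_mul' _ _ ENNReal.ofReal_ne_top]
  refine lintegral_congr_ae ?_
  filter_upwards [AEEqFun.coeFn_smul c x] with u hu
  rw [hu, Pi.smul_apply, smul_eq_mul, abs_mul, abs_of_pos hc, ENNReal.ofReal_mul hc.le,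
    ENNReal.mul_sub (fun _ _ => ENNReal.ofReal_ne_top),
    ENNReal.mul_div_cancel h0 ENNReal.ofReal_ne_top]

theorem rearrTop_lt_top {x : L0} (hx : x ∈ S0) : rearrTop x < ∞ := by
  obtain ⟨s, hs⟩ := hx
  obtain ⟨t, ht⟩ : ∃ t : ℝ, leb {u | s < |x u|} ≤ ENNReal.ofReal t :=
    ⟨(leb {u | s < |x u|}).toReal, by rw [ENNReal.ofReal_toReal hs.ne]⟩
  refine lt_of_le_of_lt (iInf_le _ t) (lt_of_le_of_lt (b := ENNReal.ofReal s) ?_ ENNReal.ofReal_lt_top)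
  refine not_lt.1 fun h => ?_
  rw [lt_rearr_iff] at h
  refine absurd (h.trans_le ((measure_mono fun u hu => ?_).trans ht)) (lt_irrefl _)
  exact (ENNReal.ofReal_lt_ofReal_iff'.1 hu).1

/-- The level x*(∞) is the threshold between infinite and finite values of the distribution
function. Below it, estimates by `distr x` or `excess x` are trivial. -/
theorem distr_eq_top_of_lt {x : L0} {s : ℝ≥0∞} (h : s < rearrTop x) : distr x s = ∞ := by
  refine ENNReal.eq_top_of_forall_nnreal_le fun r => ?_
  have := (lt_rearr_iff x r s).1 (h.trans_le (iInf_le _ _))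
  simpa using this.le

theorem distr_lt_top_of_lt {x : L0} {s : ℝ≥0∞} (h : rearrTop x < s) : distr x s < ∞ := by
  obtain ⟨t, ht⟩ := iInf_lt_iff.1 h
  refine lt_of_le_of_lt (b := ENNReal.ofReal t) (not_lt.1 fun h' => ?_) ENNReal.ofReal_lt_top
  exact absurd ((lt_rearr_iff x t s).2 h') (not_lt.2 ht.le)

theorem rearrTop_eq_of_distr_eq {x y : L0} (h : ∀ s, distr y s = distr x s) :
    rearrTop y = rearrTop x := by
  simp_rw [rearrTop, rearr_eq_of_distr_eq h]

theorem excess_eq_top_of_lt {x : L0} {s : ℝ≥0∞} (h : s < rearrTop x) : excess x s = ∞ := by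
  rw [← lintegral_rearr_sub]
  refine top_unique ?_
  calc ∞ = ∫⁻ _, (rearrTop x - s) ∂leb := by
        rw [lintegral_const, Measure.restrict_apply_univ, Real.volume_Ioi,
          ENNReal.mul_top (tsub_pos_of_lt h).ne']
    _ ≤ _ := lintegral_mono fun t => tsub_le_tsub_right (iInf_le _ t) s

theorem excess_mono {x y : L0} (h : ∀ᵐ t ∂leb, |x t| ≤ |y t|) (s : ℝ≥0∞) :
    excess x s ≤ excess y s := by
  refine lintegral_mono_ae ?_
  filter_upwards [h] with t ht
  exact tsub_le_tsub_right (ENNReal.ofReal_le_ofReal ht) s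

theorem distr_mono {x y : L0} (h : ∀ᵐ t ∂leb, |x t| ≤ |y t|) (s : ℝ≥0∞) :
    distr x s ≤ distr y s := by
  refine measure_mono_ae ?_
  filter_upwards [h] with t ht hs
  exact lt_of_lt_of_le hs (ENNReal.ofReal_le_ofReal ht)

/-- The class of a measurable function. -/
def ofFun (f : ℝ → ℝ) (hf : Measurable f) : L0 := AEEqFun.mk f hf.aestronglyMeasurable

theorem coe_ofFun (f : ℝ → ℝ) (hf : Measurable f) : ofFun f hf =ᵐ[leb] f := AEEqFun.coeFn_mk _ _

theorem ofFun_coe (x : L0) : ofFun x x.measurable = x := AEEqFun.mk_coeFn x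

theorem excess_ofFun (f : ℝ → ℝ) (hf : Measurable f) (s : ℝ≥0∞) :
    excess (ofFun f hf) s = ∫⁻ u, (ENNReal.ofReal |f u| - s) ∂leb := by
  refine lintegral_congr_ae ?_
  filter_upwards [coe_ofFun f hf] with u hu
  rw [hu]

theorem distr_ofFun (f : ℝ → ℝ) (hf : Measurable f) (s : ℝ≥0∞) :
    distr (ofFun f hf) s = leb {u | s < ENNReal.ofReal |f u|} := by
  refine measure_congr ?_
  filter_upwards [coe_ofFun f hf] with u hu
  exact propext (by change s < _ ↔ s < _; rw [hu])

theorem map_mul_leb {M : ℝ} (hM : 0 < M) {f : ℝ → ℝ≥0∞} (hf : Measurable f) :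
    ∫⁻ t, f (t / M) ∂leb = ENNReal.ofReal M * ∫⁻ t, f t ∂leb := by
  have hd : Measurable fun t : ℝ => t / M := measurable_id.div_const M
  have h : Measure.map (fun t : ℝ => t / M) leb = ENNReal.ofReal M • leb := by
    have h2 : Measure.map (fun t : ℝ => t / M) volume = ENNReal.ofReal M • volume := by
      have := Real.map_volume_mul_right (a := M⁻¹) (inv_ne_zero hM.ne')
      simpa [div_eq_mul_inv, abs_of_pos hM] using this
    have h3 : (fun t : ℝ => t / M) ⁻¹' Ioi 0 = Ioi 0 := by
      ext t
      simp [hM]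
    rw [leb, ← Measure.restrict_smul, ← h2,
      Measure.restrict_map hd measurableSet_Ioi, h3]
  rw [← lintegral_map hf hd, h, lintegral_smul_measure, smul_eq_mul]

theorem exists_distr_lt {x : L0} (hx : x ∈ S0) {a : ℝ≥0∞} (ha : 0 < a) :
    ∃ s : ℝ≥0∞, s < ∞ ∧ distr x s < a := by
  obtain ⟨r, hr⟩ := hx
  have hlim : Tendsto (fun n : ℕ => distr x n) atTop
      (𝓝 (leb (⋂ n : ℕ, {u | (n : ℝ≥0∞) < ENNReal.ofReal |x u|}))) := by
    refine tendsto_measure_iInter_atTop (fun n => ?_) ?_ ?_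
    · exact (measurableSet_lt measurable_const (measurable_ofReal_abs x)).nullMeasurableSet
    · intro m n hmn u hu
      have hmn' : (m : ℝ≥0∞) ≤ n := by exact_mod_cast hmn
      exact lt_of_le_of_lt hmn' hu
    · obtain ⟨n, hn⟩ := exists_nat_ge r
      refine ⟨n, ((measure_mono fun u hu => ?_).trans_lt hr).ne⟩
      have : (n : ℝ≥0∞) < ENNReal.ofReal |x u| := hu
      rw [← ENNReal.ofReal_natCast] at this
      exact hn.trans_lt (ENNReal.ofReal_lt_ofReal_iff'.1 this).1
  have hemp : (⋂ n : ℕ, {u | (n : ℝ≥0∞) < ENNReal.ofReal |x u|}) = ∅ := by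
    ext u
    simp only [mem_iInter, mem_ofPred_eq, mem_empty_iff_false, iff_false, not_forall, not_lt]
    obtain ⟨n, hn⟩ := exists_nat_ge |x u|
    exact ⟨n, by rw [← ENNReal.ofReal_natCast]; exact ENNReal.ofReal_le_ofReal hn⟩
  rw [hemp, measure_empty] at hlim
  obtain ⟨n, hn⟩ := (hlim.eventually (gt_mem_nhds ha)).exists
  exact ⟨n, ENNReal.natCast_lt_top n, hn⟩

theorem rearr_lt_top {x : L0} (hx : x ∈ S0) {t : ℝ} (ht : 0 < t) : rearr x t < ∞ := by
  obtain ⟨s, hs, h⟩ := exists_distr_lt hx (ENNReal.ofReal_pos.2 ht)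
  refine lt_of_le_of_lt (not_lt.1 fun h' => ?_) hs
  exact absurd (((lt_rearr_iff x t s).1 h').trans h) (lt_irrefl _)

/-- Dilation by M multiplies the measure of every level set by M. Membership in `S0` makes x* finite
on (0, ∞), so `toReal` loses nothing. -/
theorem excess_dilatedRearr {x : L0} (hx : x ∈ S0) {M : ℝ} (hM : 0 < M) (s : ℝ≥0∞) :
    excess (dilatedRearr M x) s = ENNReal.ofReal M * excess x s := by
  have hfin : ∀ᵐ t ∂leb, rearr x t < ∞ := ae_leb_pos.mono fun t ht => rearr_lt_top hx ht
  have hfin' : ∫⁻ t, (ENNReal.ofReal (rearr x t).toReal - s) ∂leb = excess x s := by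
    rw [← lintegral_rearr_sub]
    refine lintegral_congr_ae ?_
    filter_upwards [hfin] with t ht
    rw [ENNReal.ofReal_toReal ht.ne]
  have := excess_ofFun _ (measurable_dilate_rearr M x) s
  rw [dilatedRearr]
  refine this.trans ?_
  simp only [dilate, abs_of_nonneg ENNReal.toReal_nonneg]
  rw [map_mul_leb hM (f := fun t => ENNReal.ofReal (rearr x t).toReal - s), hfin']
  exact (rearr_antitone x).measurable.ennreal_toReal.ennreal_ofReal.sub_const s


/-! ### The space L₁ + L_∞ and truncation. -/

theorem abs_le_abs_iff_ae {x y : L0} : |y| ≤ |x| ↔ ∀ᵐ t ∂leb, |y t| ≤ |x t| := by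
  rw [← AEEqFun.coeFn_le]
  constructor
  · intro h
    filter_upwards [h, AEEqFun.coeFn_abs x, AEEqFun.coeFn_abs y] with t h1 h2 h3
    rwa [h2, h3] at h1
  · intro h
    filter_upwards [h, AEEqFun.coeFn_abs x, AEEqFun.coeFn_abs y] with t h1 h2 h3
    rwa [h2, h3]

theorem nonneg_iff_ae {x : L0} : 0 ≤ x ↔ ∀ᵐ t ∂leb, 0 ≤ x t := by
  rw [← AEEqFun.coeFn_le]
  constructor
  · intro h
    filter_upwards [h, AEEqFun.coeFn_zero (β := ℝ) (μ := leb)] with t h1 h2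
    rwa [h2] at h1
  · intro h
    filter_upwards [h, AEEqFun.coeFn_zero (β := ℝ) (μ := leb)] with t h1 h2
    rw [h2]; exact h1

theorem mem_L1_iff {u : L0} : u ∈ L1 ↔ ∫⁻ t, ENNReal.ofReal |u t| ∂leb < ∞ := by
  change eLpNorm u 1 leb < ∞ ↔ _
  rw [eLpNorm_one_eq_lintegral_enorm]
  simp_rw [Real.enorm_eq_ofReal_abs]

theorem eLpNorm_one_eq (u : L0) : eLpNorm u 1 leb = ∫⁻ t, ENNReal.ofReal |u t| ∂leb := by
  rw [eLpNorm_one_eq_lintegral_enorm]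
  simp_rw [Real.enorm_eq_ofReal_abs]

theorem mem_Linf_of_ae_le {u : L0} {s : ℝ} (h : ∀ᵐ t ∂leb, |u t| ≤ s) : u ∈ Linf := by
  change eLpNorm u ∞ leb < ∞
  exact (memLp_top_of_bound u.aestronglyMeasurable s (by simpa using h)).2

theorem ae_le_of_mem_Linf {u : L0} (h : u ∈ Linf) :
    ∀ᵐ t ∂leb, |u t| ≤ (eLpNorm u ∞ leb).toReal := by
  have h' : eLpNorm u ∞ leb < ∞ := h
  filter_upwards [ae_le_eLpNormEssSup (f := u) (μ := leb)] with t ht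
  rw [Real.enorm_eq_ofReal_abs, ← eLpNorm_exponent_top] at ht
  exact (ENNReal.ofReal_le_iff_le_toReal h'.ne).1 ht

/-- The truncation of `u` to `[-s, s]`. -/
def clamp (u : L0) (s : ℝ) : L0 :=
  ofFun (fun t => max (-s) (min (u t) s)) (measurable_const.max (u.measurable.min measurable_const))

theorem abs_clamp_le (u : L0) {s : ℝ} (hs : 0 ≤ s) : ∀ᵐ t ∂leb, |clamp u s t| ≤ s := by
  filter_upwards [coe_ofFun _ (measurable_const.max (u.measurable.min measurable_const) :
    Measurable fun t => max (-s) (min (u t) s))] with t ht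
  rw [clamp, ht, abs_le]
  exact ⟨le_max_left _ _, max_le (by linarith) (min_le_right _ _)⟩

theorem abs_sub_clamp (u : L0) {s : ℝ} (hs : 0 ≤ s) :
    ∀ᵐ t ∂leb, ENNReal.ofReal |(u - clamp u s) t| = ENNReal.ofReal |u t| - ENNReal.ofReal s := by
  filter_upwards [coe_ofFun _ (measurable_const.max (u.measurable.min measurable_const) :
    Measurable fun t => max (-s) (min (u t) s)), AEEqFun.coeFn_sub u (clamp u s)] with t ht h2
  rw [h2, Pi.sub_apply, clamp, ht, ← ENNReal.ofReal_sub _ hs]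
  rcases le_or_gt (u t) s with h | h
  · rw [min_eq_left h]
    rcases le_or_gt (-s) (u t) with h' | h'
    · rw [max_eq_right h', sub_self, abs_zero, ENNReal.ofReal_zero, ENNReal.ofReal_of_nonpos]
      linarith [abs_le.2 ⟨h', h⟩]
    · rw [max_eq_left h'.le, abs_of_neg (by linarith), abs_of_neg (by linarith)]
      congr 1; ring
  · rw [min_eq_right h.le, max_eq_right (by linarith), abs_of_pos (by linarith),
      abs_of_pos (by linarith)]

theorem lintegral_abs_sub_clamp (u : L0) {s : ℝ} (hs : 0 ≤ s) :
    ∫⁻ t, ENNReal.ofReal |(u - clamp u s) t| ∂leb = excess u (ENNReal.ofReal s) :=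
  lintegral_congr_ae (abs_sub_clamp u hs)

/-- The truncation at height s is bounded, and the excess is the L₁ norm of the rest. Together with
`exists_excess_lt_top` this characterizes L₁ + L_∞ by finiteness of some excess. -/
theorem mem_L1Linf_of_excess {u : L0} {s : ℝ≥0∞} (hs : s < ∞) (h : excess u s < ∞) :
    u ∈ L1Linf := by
  have h0 : 0 ≤ s.toReal := ENNReal.toReal_nonneg
  have h1 : u - clamp u s.toReal ∈ L1 := by
    rw [mem_L1_iff, lintegral_abs_sub_clamp u h0, ENNReal.ofReal_toReal hs.ne]
    exact h
  have h2 : clamp u s.toReal ∈ Linf := mem_Linf_of_ae_le (abs_clamp_le u h0)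
  have := Submodule.add_mem_sup h1 h2
  rwa [sub_add_cancel] at this

theorem exists_excess_lt_top {u : L0} (h : u ∈ L1Linf) : ∃ s : ℝ≥0∞, s < ∞ ∧ excess u s < ∞ := by
  obtain ⟨a, ha, b, hb, rfl⟩ := Submodule.mem_sup.1 h
  refine ⟨ENNReal.ofReal (eLpNorm b ∞ leb).toReal, ENNReal.ofReal_lt_top,
    lt_of_le_of_lt ?_ (mem_L1_iff.1 ha)⟩
  refine lintegral_mono_ae ?_
  filter_upwards [ae_le_of_mem_Linf hb, AEEqFun.coeFn_add a b] with t h1 h2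
  rw [h2, Pi.add_apply, tsub_le_iff_right, ← ENNReal.ofReal_add (abs_nonneg _) (by positivity)]
  exact ENNReal.ofReal_le_ofReal ((abs_add_le _ _).trans (by linarith))

/-! ### Embedding of E in L₁ + L_∞, and the norm estimate drawn from φ(x) = 0. -/

/-- The indicator function of `(0, 1]`. -/
def unitInd : L0 := ofFun ((Ioc (0 : ℝ) 1).indicator 1) (measurable_one.indicator measurableSet_Ioc)

theorem unitInd_ne_zero : unitInd ≠ 0 := by
  intro h
  have h1 := coe_ofFun ((Ioc (0 : ℝ) 1).indicator 1) (measurable_one.indicator measurableSet_Ioc)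
  have h2 : ∀ᵐ t ∂leb, t ∉ Ioc (0 : ℝ) 1 := by
    rw [← unitInd, h] at h1
    filter_upwards [h1, AEEqFun.coeFn_zero (β := ℝ) (μ := leb)] with t h3 h4 h5
    rw [h4, indicator_of_mem h5] at h3
    simp at h3
  have h3 : leb (Ioc (0 : ℝ) 1) = 0 := measure_eq_zero_iff_ae_notMem.2 h2
  rw [Measure.restrict_apply measurableSet_Ioc,
    inter_eq_left.2 (Ioc_subset_Ioi_self)] at h3
  simp at h3

theorem excess_smul_unitInd {a : ℝ} (ha : 0 ≤ a) (s : ℝ≥0∞) :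
    excess (a • unitInd) s = ENNReal.ofReal a - s := by
  have h1 := coe_ofFun ((Ioc (0 : ℝ) 1).indicator 1) (measurable_one.indicator measurableSet_Ioc)
  have : excess (a • unitInd) s =
      ∫⁻ t, (Ioc (0 : ℝ) 1).indicator (fun _ => ENNReal.ofReal a - s) t ∂leb := by
    refine lintegral_congr_ae ?_
    filter_upwards [h1, AEEqFun.coeFn_smul a unitInd] with t h2 h3
    rw [h3, Pi.smul_apply, unitInd, h2]
    by_cases ht : t ∈ Ioc (0 : ℝ) 1 <;> simp [ht, abs_of_nonneg ha]
  rw [this, lintegral_indicator_const measurableSet_Ioc, leb,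
    Measure.restrict_apply measurableSet_Ioc, inter_eq_left.2 Ioc_subset_Ioi_self]
  simp

theorem smul_unitInd_mem {a : ℝ} (ha : 0 ≤ a) : a • unitInd ∈ L1Linf :=
  mem_L1Linf_of_excess (s := 0) ENNReal.zero_lt_top
    (by rw [excess_smul_unitInd ha]; simp)

/-- For t < 1 this is concavity of the integral of x* over (0, t): its value is at least t times the
value at 1, because x* on (t, 1] is at most x*(t), which is at most the mean over (0, t]. -/
theorem submajorized_smul_unitInd {a : ℝ} (ha : 0 ≤ a) {x : L0}
    (h : ENNReal.ofReal a ≤ ∫⁻ r in Ioc 0 1, rearr x r) : Submajorized (a • unitInd) x := by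
  intro t ht
  rcases le_or_gt 1 t with h1 | h1
  · calc _ ≤ excess (a • unitInd) 0 + 0 * ENNReal.ofReal t := lintegral_Ioc_rearr_le _ _ _
      _ = ENNReal.ofReal a := by rw [excess_smul_unitInd ha]; simp
      _ ≤ _ := h
      _ ≤ _ := lintegral_mono_set (Ioc_subset_Ioc_right h1)
  · rcases ht.eq_or_lt with rfl | ht
    · simp
    have h2 : ∫⁻ r in Ioc 0 t, rearr (a • unitInd) r ≤ ENNReal.ofReal a * ENNReal.ofReal t := by
      refine (lintegral_Ioc_rearr_le _ t (ENNReal.ofReal a)).trans ?_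
      rw [excess_smul_unitInd ha]; simp
    have h3 : ENNReal.ofReal a * ENNReal.ofReal t ≤
        (∫⁻ r in Ioc 0 1, rearr x r) * ENNReal.ofReal t := by gcongr
    refine h2.trans (h3.trans ?_)
    have hu : Ioc (0 : ℝ) 1 = Ioc 0 t ∪ Ioc t 1 := (Ioc_union_Ioc_eq_Ioc ht.le h1.le).symm
    have hd : ∫⁻ r in Ioc t 1, rearr x r ≤ rearr x t * ENNReal.ofReal (1 - t) := by
      calc _ ≤ ∫⁻ _ in Ioc t 1, rearr x t :=
            setLIntegral_mono measurable_const fun r hr => rearr_antitone x hr.1.le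
        _ = _ := by simp
    have hl : rearr x t * ENNReal.ofReal t ≤ ∫⁻ r in Ioc 0 t, rearr x r := by
      calc _ = ∫⁻ _ in Ioc 0 t, rearr x t := by simp
        _ ≤ _ := setLIntegral_mono (rearr_antitone x).measurable fun r hr => rearr_antitone x hr.2
    rw [hu, lintegral_union measurableSet_Ioc (Ioc_disjoint_Ioc_of_le le_rfl), add_mul]
    calc _ ≤ (∫⁻ r in Ioc 0 t, rearr x r) * ENNReal.ofReal t +
          rearr x t * ENNReal.ofReal (1 - t) * ENNReal.ofReal t := by gcongr
      _ = (∫⁻ r in Ioc 0 t, rearr x r) * ENNReal.ofReal t +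
          rearr x t * ENNReal.ofReal t * ENNReal.ofReal (1 - t) := by ring
      _ ≤ (∫⁻ r in Ioc 0 t, rearr x r) * ENNReal.ofReal t +
          (∫⁻ r in Ioc 0 t, rearr x r) * ENNReal.ofReal (1 - t) := by gcongr
      _ = _ := by
          rw [← mul_add, ← ENNReal.ofReal_add ht.le (by linarith)]; simp

namespace BanachFunctionSpace

variable {E : BanachFunctionSpace}

theorem norm_zero (E : BanachFunctionSpace) : E.norm 0 = 0 := by
  have := E.norm_smul 0 0 E.carrier.zero_mem
  simpa using this

theorem norm_neg {u : L0} (hu : u ∈ E.carrier) : E.norm (-u) = E.norm u := by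
  have := E.norm_smul (-1) u hu
  simpa using this

theorem norm_nonneg {u : L0} (hu : u ∈ E.carrier) : 0 ≤ E.norm u := by
  have := E.norm_add_le u hu (-u) (E.carrier.neg_mem hu)
  rw [add_neg_cancel, E.norm_zero, norm_neg hu] at this
  linarith

theorem norm_sub_le {u v w : L0} (hu : u ∈ E.carrier) (hv : v ∈ E.carrier) (hw : w ∈ E.carrier) :
    E.norm (u - w) ≤ E.norm (u - v) + E.norm (v - w) := by
  have := E.norm_add_le _ (E.carrier.sub_mem hu hv) _ (E.carrier.sub_mem hv hw)
  rwa [sub_add_sub_cancel] at this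

theorem ideal_ae (hE : E.IsFullySymmetric) {x y : L0} (hx : x ∈ E.carrier)
    (h : ∀ᵐ t ∂leb, |y t| ≤ |x t|) : y ∈ E.carrier ∧ E.norm y ≤ E.norm x :=
  hE.ideal x hx y (abs_le_abs_iff_ae.2 h)

/-- Otherwise all multiples of the unit indicator are submajorized by x; their norms are then
bounded by that of x, which forces the unit indicator to have norm zero. -/
theorem lintegral_rearr_lt_top (hE : E.IsFullySymmetric) {x : L0} (hx : x ∈ E.carrier) :
    ∫⁻ r in Ioc 0 1, rearr x r < ∞ := by
  by_contra h
  have h' : ∫⁻ r in Ioc 0 1, rearr x r = ∞ := by simpa using h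
  have h1 : ∀ n : ℕ, ((n : ℝ) • unitInd) ∈ E.carrier ∧ E.norm ((n : ℝ) • unitInd) ≤ E.norm x :=
    fun n => hE.full x hx _ (smul_unitInd_mem n.cast_nonneg)
      (submajorized_smul_unitInd n.cast_nonneg (by rw [h']; exact le_top))
  have hu : unitInd ∈ E.carrier := by simpa using (h1 1).1
  have h0 : E.norm unitInd = 0 := by
    by_contra hne
    have hpos : 0 < E.norm unitInd := lt_of_le_of_ne (norm_nonneg hu) (Ne.symm hne)
    obtain ⟨n, hn⟩ := exists_nat_gt (E.norm x / E.norm unitInd)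
    have h2 := (h1 n).2
    rw [E.norm_smul _ _ hu, abs_of_nonneg n.cast_nonneg] at h2
    rw [div_lt_iff₀ hpos] at hn
    linarith
  exact unitInd_ne_zero (E.eq_zero_of_norm _ hu h0)

theorem carrier_le_L1Linf (hE : E.IsFullySymmetric) {x : L0} (hx : x ∈ E.carrier) :
    x ∈ L1Linf := by
  have h := lintegral_rearr_lt_top hE hx
  have h1 := (le_lintegral_Ioc_rearr x one_pos).trans_lt h
  have h2 : rearr x 1 < ∞ := by
    have := (le_add_self (a := rearr x 1 * ENNReal.ofReal 1) (b := excess x (rearr x 1))).trans_lt h1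
    simpa using this
  exact mem_L1Linf_of_excess h2 (le_self_add.trans_lt h1)

/-- Monotonicity of the norm with respect to the excess. -/
theorem mem_of_excess_le (hE : E.IsFullySymmetric) {x u : L0} (hx : x ∈ E.carrier)
    (h : ∀ s, excess u s ≤ excess x s) : u ∈ E.carrier ∧ E.norm u ≤ E.norm x := by
  obtain ⟨s, hs, hs'⟩ := exists_excess_lt_top (carrier_le_L1Linf hE hx)
  exact hE.full x hx u (mem_L1Linf_of_excess hs ((h s).trans_lt hs')) (submajorized_of_excess_le h)

theorem unitInd_mem_or_eq_zero (hE : E.IsFullySymmetric) {x : L0} (hx : x ∈ E.carrier) :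
    unitInd ∈ E.carrier ∨ x = 0 := by
  rcases eq_or_ne (∫⁻ r in Ioc 0 1, rearr x r) 0 with h | h
  · right
    have h1 := (le_lintegral_Ioc_rearr x one_pos).trans h.le
    have h2 : rearr x 1 = 0 := by
      have := (le_add_self (a := rearr x 1 * ENNReal.ofReal 1) (b := excess x (rearr x 1))).trans h1
      simpa using this
    have h3 : excess x 0 = 0 := by
      have := le_self_add.trans h1
      rw [h2] at this
      simpa using this
    rw [excess, lintegral_eq_zero_iff ((measurable_ofReal_abs x).sub_const 0)] at h3
    refine AEEqFun.ext ?_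
    filter_upwards [h3, AEEqFun.coeFn_zero (β := ℝ) (μ := leb)] with t h4 h5
    rw [h5]
    simpa using h4
  · left
    set a := (∫⁻ r in Ioc 0 1, rearr x r).toReal with ha
    have hfin := lintegral_rearr_lt_top hE hx
    have hpos : 0 < a := ENNReal.toReal_pos h hfin.ne
    have h1 := hE.full x hx _ (smul_unitInd_mem hpos.le)
      (submajorized_smul_unitInd hpos.le (by rw [ha, ENNReal.ofReal_toReal hfin.ne]))
    have := E.carrier.smul_mem a⁻¹ h1.1
    rwa [smul_smul, inv_mul_cancel₀ hpos.ne', one_smul] at this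

/-- Quantitative form of the embedding in L₁ + L_∞; it makes weighted integrals continuous for the
norm of E. -/
theorem lintegral_rearr_le (hE : E.IsFullySymmetric) (hu : unitInd ∈ E.carrier) {x : L0}
    (hx : x ∈ E.carrier) :
    ∫⁻ r in Ioc 0 1, rearr x r ≤ ENNReal.ofReal (E.norm x / E.norm unitInd) := by
  set a := (∫⁻ r in Ioc 0 1, rearr x r).toReal with ha
  have hfin := lintegral_rearr_lt_top hE hx
  have h1 := hE.full x hx _ (smul_unitInd_mem ENNReal.toReal_nonneg)
      (submajorized_smul_unitInd (a := a) ENNReal.toReal_nonneg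
        (by rw [ha, ENNReal.ofReal_toReal hfin.ne]))
  have hpos : 0 < E.norm unitInd := lt_of_le_of_ne (norm_nonneg hu)
    fun h => unitInd_ne_zero (E.eq_zero_of_norm _ hu h.symm)
  rw [E.norm_smul _ _ hu, abs_of_nonneg ENNReal.toReal_nonneg] at h1
  rw [← ENNReal.ofReal_toReal hfin.ne]
  exact ENNReal.ofReal_le_ofReal ((le_div_iff₀ hpos).2 h1.2)

/-- The right-hand side is the excess of (1/M) σ_M x* at s, whose norm is below ε for large M. All
later uses of φ(x) = 0 go through this form. -/
theorem exists_nat_norm_lt (hE : E.IsFullySymmetric) {x : L0} (hx : x ∈ E.carrier)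
    (hφ : E.HasDilationLimit x 0) {ε : ℝ} (hε : 0 < ε) :
    ∃ N : ℕ, 0 < N ∧ ∀ M ≥ N, ∀ e : L0,
      (∀ s : ℝ≥0∞, excess e s ≤ excess x (M * s)) → e ∈ E.carrier ∧ E.norm e < ε := by
  obtain ⟨a, ha⟩ := (hφ.eventually (gt_mem_nhds hε)).exists_forall_of_atTop
  obtain ⟨N, hN⟩ := exists_nat_ge a
  refine ⟨N + 1, Nat.succ_pos _, fun M hM e he => ?_⟩
  have hM0 : (0 : ℝ) < M := by exact_mod_cast (Nat.succ_pos N).trans_le hM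
  have hM1 : ENNReal.ofReal (M : ℝ) = M := ENNReal.ofReal_natCast M
  have hMne : (M : ℝ≥0∞) ≠ 0 := by
    exact_mod_cast (Nat.succ_pos N |>.trans_le hM).ne'
  have haM : a ≤ M := hN.trans (by exact_mod_cast (Nat.le_succ N).trans hM)
  have hxS := hE.subset_S0 x hx
  -- The dilation belongs to E because its excess is dominated by that of Mx, as M ≥ 1.
  have hd : dilatedRearr M x ∈ E.carrier := by
    refine (mem_of_excess_le hE (E.carrier.smul_mem (M : ℝ) hx) fun s => ?_).1
    rw [excess_dilatedRearr hxS hM0, excess_smul_le hM0]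
    gcongr
    refine excess_antitone x (ENNReal.div_le_of_le_mul ?_)
    rw [hM1]
    have : (1 : ℝ≥0∞) ≤ M := by exact_mod_cast Nat.one_le_cast.2 ((Nat.succ_pos N).trans_le hM)
    exact le_mul_of_one_le_right' this
  have h1 := mem_of_excess_le hE (u := e) (E.carrier.smul_mem (1 / (M : ℝ)) hd) fun s => by
    refine (he s).trans (le_of_eq ?_)
    rw [excess_smul_le (by positivity), excess_dilatedRearr hxS hM0, ← mul_assoc,
      ← ENNReal.ofReal_mul (by positivity), one_div, inv_mul_cancel₀ hM0.ne', ENNReal.ofReal_one,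
      one_mul, ENNReal.ofReal_inv_of_pos hM0, hM1, ENNReal.div_eq_inv_mul, inv_inv]
  refine ⟨h1.1, h1.2.trans_lt ?_⟩
  rw [E.norm_smul _ _ hd, abs_of_pos (by positivity)]
  exact ha M haM

end BanachFunctionSpace

/-! ### Transport of Lebesgue measure between sets. -/

theorem leb_Iic_le (t : ℝ) : leb (Iic t) ≤ ENNReal.ofReal t := by
  rw [leb, Measure.restrict_apply measurableSet_Iic, Iic_inter_Ioi, Real.volume_Ioc, sub_zero]

theorem leb_inter_Iic_lt_top (B : Set ℝ) (t : ℝ) : leb (B ∩ Iic t) < ∞ :=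
  (measure_mono inter_subset_right).trans_lt ((leb_Iic_le t).trans_lt ENNReal.ofReal_lt_top)

/-- The cumulative measure function of a set. -/
def cumul (B : Set ℝ) (t : ℝ) : ℝ := (leb (B ∩ Iic t)).toReal

theorem ofReal_cumul (B : Set ℝ) (t : ℝ) : ENNReal.ofReal (cumul B t) = leb (B ∩ Iic t) :=
  ENNReal.ofReal_toReal (leb_inter_Iic_lt_top B t).ne

theorem cumul_nonneg (B : Set ℝ) (t : ℝ) : 0 ≤ cumul B t := ENNReal.toReal_nonneg

theorem cumul_mono (B : Set ℝ) : Monotone (cumul B) := fun _ b h =>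
  ENNReal.toReal_mono (leb_inter_Iic_lt_top B b).ne
    (measure_mono (inter_subset_inter_right _ (Iic_subset_Iic.2 h)))

theorem cumul_le_add (B : Set ℝ) {s t : ℝ} (h : s ≤ t) : cumul B t ≤ cumul B s + (t - s) := by
  have h1 : leb (B ∩ Iic t) ≤ leb (B ∩ Iic s) + ENNReal.ofReal (t - s) := by
    calc leb (B ∩ Iic t) ≤ leb ((B ∩ Iic s) ∪ Ioc s t) := by
          refine measure_mono fun u hu => ?_
          rcases le_or_gt u s with h' | h'
          · exact Or.inl ⟨hu.1, h'⟩
          · exact Or.inr ⟨h', hu.2⟩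
      _ ≤ leb (B ∩ Iic s) + leb (Ioc s t) := measure_union_le _ _
      _ ≤ _ := by
          gcongr
          exact (Measure.restrict_apply_le _ _).trans (by rw [Real.volume_Ioc])
  rw [← ofReal_cumul, ← ofReal_cumul, ← ENNReal.ofReal_add (cumul_nonneg _ _) (by linarith)] at h1
  exact (ENNReal.ofReal_le_ofReal_iff (add_nonneg (cumul_nonneg _ _) (by linarith))).1 h1

theorem continuous_cumul (B : Set ℝ) : Continuous (cumul B) := by
  have : LipschitzWith 1 (cumul B) := by
    refine LipschitzWith.of_le_add fun s t => ?_
    rw [Real.dist_eq]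
    rcases le_total s t with h | h
    · exact (cumul_mono B h).trans (le_add_of_nonneg_right (abs_nonneg _))
    · exact (cumul_le_add B h).trans (by rw [abs_of_nonneg (by linarith)])
  exact this.continuous

theorem cumul_of_nonpos (B : Set ℝ) {t : ℝ} (h : t ≤ 0) : cumul B t = 0 := by
  have : leb (B ∩ Iic t) = 0 := le_antisymm ((measure_mono inter_subset_right).trans
    ((leb_Iic_le t).trans (by simp [h]))) bot_le
  simp [cumul, this]

theorem exists_lt_cumul {B : Set ℝ} {u : ℝ} (hu : ENNReal.ofReal u < leb B) :
    ∃ t, u < cumul B t := by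
  have hU : B = ⋃ n : ℕ, B ∩ Iic (n : ℝ) := by
    rw [← inter_iUnion]
    refine (inter_eq_left.2 fun t _ => ?_).symm
    obtain ⟨n, hn⟩ := exists_nat_ge t
    exact mem_iUnion.2 ⟨n, hn⟩
  have hm : Monotone fun n : ℕ => B ∩ Iic (n : ℝ) := fun m n hmn =>
    inter_subset_inter_right _ (Iic_subset_Iic.2 (by exact_mod_cast hmn))
  rw [hU, hm.measure_iUnion] at hu
  obtain ⟨n, hn⟩ := lt_iSup_iff.1 hu
  rw [← ofReal_cumul] at hn
  exact ⟨n, (ENNReal.ofReal_lt_ofReal_iff'.1 hn).1⟩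

theorem cumul_le_of_leb_le {B : Set ℝ} {u : ℝ} (hu : leb B ≤ ENNReal.ofReal u) (h0 : 0 ≤ u)
    (t : ℝ) : cumul B t ≤ u :=
  (ENNReal.ofReal_le_ofReal_iff h0).1
    (by rw [ofReal_cumul]; exact (measure_mono inter_subset_left).trans hu)

/-- By monotonicity and continuity the sublevel set is a closed half-line ending at a point where
`cumul B` equals u exactly, unless u exhausts the measure of B. -/
theorem leb_inter_cumul_le (B : Set ℝ) {u : ℝ} (h0 : 0 ≤ u) :
    leb (B ∩ {t | cumul B t ≤ u}) = min (ENNReal.ofReal u) (leb B) := by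
  rcases le_or_gt (leb B) (ENNReal.ofReal u) with h | h
  · have hs : B ⊆ {t | cumul B t ≤ u} := fun t _ => cumul_le_of_leb_le h h0 t
    rw [min_eq_right h, inter_eq_left.2 hs]
  · rw [min_eq_left h.le]
    obtain ⟨t1, ht1⟩ := exists_lt_cumul h
    have hbdd : BddAbove {t | cumul B t ≤ u} := by
      refine ⟨t1, fun t ht => ?_⟩
      by_contra hc
      exact absurd (ht1.trans_le ((cumul_mono B (not_le.1 hc).le).trans ht)) (lt_irrefl _)
    have hne : {t | cumul B t ≤ u}.Nonempty := ⟨0, by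
      change cumul B 0 ≤ u; rw [cumul_of_nonpos B le_rfl]; exact h0⟩
    have hcl : IsClosed {t | cumul B t ≤ u} := isClosed_le (continuous_cumul B) continuous_const
    set t0 := sSup {t | cumul B t ≤ u}
    have ht0 : cumul B t0 ≤ u := hcl.csSup_mem hne hbdd
    have ht0' : u ≤ cumul B t0 := by
      have hlim : Tendsto (cumul B) (𝓝[>] t0) (𝓝 (cumul B t0)) :=
        (continuous_cumul B).continuousAt.tendsto.mono_left nhdsWithin_le_nhds
      refine ge_of_tendsto hlim ?_
      filter_upwards [self_mem_nhdsWithin] with t ht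
      by_contra hc
      exact absurd (le_csSup hbdd (not_le.1 hc).le) (not_le.2 ht)
    have : {t | cumul B t ≤ u} = Iic t0 := by
      ext t
      exact ⟨fun h => le_csSup hbdd h, fun h => (cumul_mono B h).trans ht0⟩
    rw [this, ← ofReal_cumul, le_antisymm ht0 ht0']

theorem ext_of_Iic_pos {μ ν : Measure ℝ} (hfin : ∀ u, μ (Iic u) < ∞) (h0 : μ (Iic 0) = 0)
    (h0' : ν (Iic 0) = 0) (h : ∀ u > 0, μ (Iic u) = ν (Iic u)) : μ = ν := by
  have h' : ∀ u, μ (Iic u) = ν (Iic u) := fun u => by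
    rcases le_or_gt u 0 with hu | hu
    · rw [measure_mono_null (Iic_subset_Iic.2 hu) h0, measure_mono_null (Iic_subset_Iic.2 hu) h0']
    · exact h u hu
  refine Measure.ext_of_Ioc' μ ν (fun a b _ => ?_) fun a b hab => ?_
  · exact ((measure_mono Ioc_subset_Iic_self).trans_lt (hfin b)).ne
  · rw [← Iic_sdiff_Iic, measure_sdiff (Iic_subset_Iic.2 hab.le) nullMeasurableSet_Iic (hfin a).ne,
      measure_sdiff (Iic_subset_Iic.2 hab.le) nullMeasurableSet_Iic (h' a ▸ (hfin a).ne), h', h']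

theorem restrict_lt_Iic (a : ℝ≥0∞) (u : ℝ) :
    leb.restrict {r | ENNReal.ofReal r < a} (Iic u) = min (ENNReal.ofReal u) a := by
  have hm : MeasurableSet {r | ENNReal.ofReal r < a} :=
    measurableSet_lt ENNReal.measurable_ofReal measurable_const
  rw [Measure.restrict_apply measurableSet_Iic, ← leb_ofReal_lt (min (ENNReal.ofReal u) a)]
  refine measure_congr ?_
  have hne : ∀ᵐ r ∂leb, r ≠ u := by
    refine ae_restrict_of_ae ?_
    exact measure_eq_zero_iff_ae_notMem.1 (measure_singleton u)
  filter_upwards [hne, ae_leb_pos] with r hr h0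
  refine propext ?_
  change (r ≤ u ∧ ENNReal.ofReal r < a) ↔ ENNReal.ofReal r < min (ENNReal.ofReal u) a
  rw [lt_min_iff, ENNReal.ofReal_lt_ofReal_iff']
  exact and_congr_left' ⟨fun h => ⟨lt_of_le_of_ne h hr, h0.trans_le h⟩, fun h => h.1.le⟩

/-- A criterion for a map to carry `leb` on `S` to `leb` on an initial segment. -/
theorem map_eq_of_leb_inter {S : Set ℝ} {τ : ℝ → ℝ} (hτ : Measurable τ)
    (h : ∀ u > 0, leb (S ∩ {t | τ t ≤ u}) = min (ENNReal.ofReal u) (leb S)) :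
    (leb.restrict S).map τ = leb.restrict {r | ENNReal.ofReal r < leb S} := by
  have happ : ∀ u, (leb.restrict S).map τ (Iic u) = leb (S ∩ {t | τ t ≤ u}) := fun u => by
    rw [Measure.map_apply hτ measurableSet_Iic, Measure.restrict_apply (hτ measurableSet_Iic),
      inter_comm]
    rfl
  have h0 : leb (S ∩ {t | τ t ≤ 0}) = 0 := by
    refine le_antisymm (le_of_forall_gt_imp_ge_of_dense fun ε hε => ?_) bot_le
    obtain ⟨r, hr0, hr⟩ := ENNReal.lt_iff_exists_real_btwn.1 hε
    have hr0' : 0 < r := by simpa using hr.1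
    calc _ ≤ leb (S ∩ {t | τ t ≤ r}) := measure_mono (inter_subset_inter_right _
            fun t (ht : τ t ≤ 0) => ht.trans hr0'.le)
      _ ≤ ENNReal.ofReal r := (h r hr0').le.trans (min_le_left _ _)
      _ ≤ ε := hr.2.le
  refine ext_of_Iic_pos (fun u => ?_) ?_ ?_ fun u hu => ?_
  · rw [happ]
    calc _ ≤ leb (S ∩ {t | τ t ≤ max u 1}) := measure_mono (inter_subset_inter_right _
            fun t (ht : τ t ≤ u) => ht.trans (le_max_left _ _))
      _ ≤ _ := (h (max u 1) (by positivity)).le.trans (min_le_left _ _)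
      _ < ∞ := ENNReal.ofReal_lt_top
  · rw [happ, h0]
  · rw [restrict_lt_Iic]; simp
  · rw [happ, restrict_lt_Iic, h u hu]

theorem map_cumul (B : Set ℝ) :
    (leb.restrict B).map (cumul B) = leb.restrict {r | ENNReal.ofReal r < leb B} :=
  map_eq_of_leb_inter (continuous_cumul B).measurable fun _ hu => leb_inter_cumul_le B hu.le

/-- The right inverse of `cumul`. -/
def cumulInv (B : Set ℝ) (u : ℝ) : ℝ :=
  -- The value 0 is a default: `map_cumulInv` restricts to u below the measure of B. The constraint
  -- 0 ≤ t bounds the set from below.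
  if ENNReal.ofReal u < leb B then sInf {t | 0 ≤ t ∧ u ≤ cumul B t} else 0

theorem cumulInv_le_iff {B : Set ℝ} {u t : ℝ} (hu : ENNReal.ofReal u < leb B) (ht : 0 ≤ t) :
    cumulInv B u ≤ t ↔ u ≤ cumul B t := by
  rw [cumulInv, if_pos hu]
  have hb : BddBelow {t | 0 ≤ t ∧ u ≤ cumul B t} := ⟨0, fun t h => h.1⟩
  constructor
  · intro h
    obtain ⟨t1, h1⟩ := exists_lt_cumul hu
    have hne : {t | 0 ≤ t ∧ u ≤ cumul B t}.Nonempty :=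
      ⟨max 0 t1, le_max_left _ _, h1.le.trans (cumul_mono B (le_max_right _ _))⟩
    have hcl : IsClosed {t | 0 ≤ t ∧ u ≤ cumul B t} :=
      (isClosed_le continuous_const continuous_id).inter
        (isClosed_le continuous_const (continuous_cumul B))
    exact (hcl.csInf_mem hne hb).2.trans (cumul_mono B h)
  · intro h
    exact csInf_le hb ⟨ht, h⟩

theorem cumulInv_nonneg (B : Set ℝ) (u : ℝ) : 0 ≤ cumulInv B u := by
  rw [cumulInv]
  split_ifs
  · exact Real.sInf_nonneg fun t h => h.1
  · exact le_rfl

theorem measurable_cumulInv (B : Set ℝ) : Measurable (cumulInv B) := by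
  refine measurable_of_Iic fun t => ?_
  rcases lt_or_ge t 0 with ht | ht
  · have : cumulInv B ⁻¹' Iic t = ∅ := by
      ext u
      simp only [mem_preimage, mem_Iic, mem_empty_iff_false, iff_false, not_le]
      exact ht.trans_le (cumulInv_nonneg B u)
    rw [this]; exact MeasurableSet.empty
  · have : cumulInv B ⁻¹' Iic t =
        {u | ENNReal.ofReal u < leb B}ᶜ ∪ Iic (cumul B t) := by
      ext u
      by_cases hu : ENNReal.ofReal u < leb B
      · refine (cumulInv_le_iff hu ht).trans ⟨Or.inr, fun h => h.resolve_left fun h => h hu⟩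
      · have h0 : cumulInv B u = 0 := if_neg hu
        exact ⟨fun _ => Or.inl hu, fun _ => by rw [mem_preimage, h0]; exact ht⟩
    rw [this]
    exact (measurableSet_lt ENNReal.measurable_ofReal measurable_const).compl.union measurableSet_Iic

/-- The preimage of a half-line ending at t is, on the initial segment, the half-line ending at
`cumul B t`, so the two measures agree on half-lines. -/
theorem map_cumulInv (B : Set ℝ) :
    (leb.restrict {r | ENNReal.ofReal r < leb B}).map (cumulInv B) = leb.restrict B := by
  have hm : MeasurableSet {r | ENNReal.ofReal r < leb B} :=
    measurableSet_lt ENNReal.measurable_ofReal measurable_const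
  have key : ∀ t, 0 ≤ t → (leb.restrict {r | ENNReal.ofReal r < leb B}).map (cumulInv B) (Iic t)
      = leb.restrict B (Iic t) := fun t ht => by
    rw [Measure.map_apply (measurable_cumulInv B) measurableSet_Iic,
      Measure.restrict_apply (measurable_cumulInv B measurableSet_Iic),
      Measure.restrict_apply measurableSet_Iic, inter_comm (Iic t)]
    have h1 : cumulInv B ⁻¹' Iic t ∩ {r | ENNReal.ofReal r < leb B} =
        Iic (cumul B t) ∩ {r | ENNReal.ofReal r < leb B} := by
      ext u
      simp only [mem_inter_iff, mem_preimage, mem_Iic, and_congr_left_iff]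
      exact fun hu => cumulInv_le_iff hu ht
    rw [h1, ← Measure.restrict_apply measurableSet_Iic, restrict_lt_Iic, ofReal_cumul,
      min_eq_left (measure_mono inter_subset_left)]
  have h0 : leb.restrict B (Iic 0) = 0 := by
    rw [Measure.restrict_apply measurableSet_Iic]
    exact le_antisymm ((measure_mono inter_subset_left).trans ((leb_Iic_le 0).trans (by simp)))
      bot_le
  refine ext_of_Iic_pos (fun u => ?_) ((key 0 le_rfl).trans h0) h0 fun u hu => key u hu.le
  refine (measure_mono (Iic_subset_Iic.2 (le_max_left u 0))).trans_lt ?_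
  rw [key _ (le_max_right _ _), Measure.restrict_apply measurableSet_Iic, inter_comm]
  exact leb_inter_Iic_lt_top _ _

/-- A transport map between sets of finite or infinite measure. -/
theorem exists_transport {A B : Set ℝ} (h : leb A ≤ leb B) :
    ∃ ψ : ℝ → ℝ, Measurable ψ ∧ (leb.restrict A).map ψ ≤ leb.restrict B ∧
      (leb A = leb B → (leb.restrict A).map ψ = leb.restrict B) := by
  have hmap : (leb.restrict A).map (cumulInv B ∘ cumul A) =
      (leb.restrict {r | ENNReal.ofReal r < leb A}).map (cumulInv B) := by
    rw [← Measure.map_map (measurable_cumulInv B) (continuous_cumul A).measurable, map_cumul]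
  refine ⟨cumulInv B ∘ cumul A, (measurable_cumulInv B).comp (continuous_cumul A).measurable,
    ?_, fun he => ?_⟩
  · rw [hmap, ← map_cumulInv B]
    refine Measure.map_mono (Measure.restrict_mono (fun r hr => ?_) le_rfl)
      (measurable_cumulInv B)
    exact lt_of_lt_of_le hr h
  · rw [hmap, he, map_cumulInv]

/-- A set of infinite measure splits into infinitely many sets of infinite measure. -/
theorem exists_split {F : Set ℝ} (hF : MeasurableSet F) (h : leb F = ∞) :
    ∃ B : ℕ → Set ℝ, (∀ j, MeasurableSet (B j)) ∧ Pairwise (Function.onFun Disjoint B) ∧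
      (∀ j, B j ⊆ F) ∧ ∀ j, leb (B j) = ∞ := by
  -- F is cut into pieces of unit measure by the integer values of `cumul F`; the pairing function
  -- allots infinitely many of these pieces to each index j.
  have hJm : ∀ j : ℕ, MeasurableSet {u : ℝ | (Nat.unpair ⌊u⌋₊).1 = j} := fun j =>
    (Nat.measurable_floor : Measurable fun u : ℝ => ⌊u⌋₊) (MeasurableSet.of_discrete
      (s := {n : ℕ | (Nat.unpair n).1 = j}))
  have hc := (continuous_cumul F).measurable
  refine ⟨fun j => F ∩ cumul F ⁻¹' {u | (Nat.unpair ⌊u⌋₊).1 = j},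
    fun j => hF.inter (hc (hJm j)), fun i j hij => ?_, fun j => inter_subset_left, fun j => ?_⟩
  · refine Set.disjoint_left.2 fun t h1 h2 => hij ?_
    exact h1.2.symm.trans h2.2
  · change leb (F ∩ cumul F ⁻¹' {u | (Nat.unpair ⌊u⌋₊).1 = j}) = ∞
    rw [inter_comm, ← Measure.restrict_apply (hc (hJm j)), ← Measure.map_apply hc (hJm j),
      map_cumul, h]
    have h1 : {r : ℝ | ENNReal.ofReal r < ∞} = univ := by ext; simp
    rw [h1, Measure.restrict_univ]
    have hsub : (⋃ k : ℕ, Ioo ((Nat.pair j k : ℕ) : ℝ) (Nat.pair j k + 1)) ⊆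
        {u : ℝ | (Nat.unpair ⌊u⌋₊).1 = j} := by
      refine iUnion_subset fun k u hu => ?_
      have : ⌊u⌋₊ = Nat.pair j k :=
        (Nat.floor_eq_iff ((Nat.cast_nonneg _).trans hu.1.le)).2 ⟨hu.1.le, hu.2⟩
      change (Nat.unpair ⌊u⌋₊).1 = j
      rw [this, Nat.unpair_pair]
    refine top_unique (le_trans (le_of_eq ?_) (measure_mono hsub))
    rw [measure_iUnion]
    · have : ∀ k : ℕ, leb (Ioo ((Nat.pair j k : ℕ) : ℝ) (Nat.pair j k + 1)) = 1 := fun k => by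
        rw [leb, Measure.restrict_apply measurableSet_Ioo, inter_eq_left.2, Real.volume_Ioo]
        · simp
        · exact fun u hu => lt_of_le_of_lt (Nat.cast_nonneg _) hu.1
      simp_rw [this]
      rw [ENNReal.tsum_const_eq_top_of_ne_zero one_ne_zero]
    · intro k l hkl
      refine Set.disjoint_left.2 fun u h1 h2 => hkl ?_
      have e1 : ⌊u⌋₊ = Nat.pair j k :=
        (Nat.floor_eq_iff ((Nat.cast_nonneg _).trans h1.1.le)).2 ⟨h1.1.le, h1.2⟩
      have e2 : ⌊u⌋₊ = Nat.pair j l :=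
        (Nat.floor_eq_iff ((Nat.cast_nonneg _).trans h2.1.le)).2 ⟨h2.1.le, h2.2⟩
      exact (Nat.pair_eq_pair.1 (e1.symm.trans e2)).2
    · exact fun k => measurableSet_Ioo

/-! ### Decreasing rank and domination by a rearrangement. -/

/-- The position of `t` in the decreasing arrangement of the values of `p`, ties being broken by
the order of the line. -/
def rankE (p : ℝ → ℝ) (t : ℝ) : ℝ≥0∞ := leb {u | p t < p u} + leb {u | p u = p t ∧ u ≤ t}

/-- The real-valued version of `rankE`. -/
def rank (p : ℝ → ℝ) (t : ℝ) : ℝ := (rankE p t).toReal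

theorem measurable_rank {p : ℝ → ℝ} (hp : Measurable p) : Measurable (rank p) := by
  refine Measurable.ennreal_toReal (Measurable.add ?_ ?_)
  · exact measurable_measure_prodMk_left (ν := leb) (s := {q : ℝ × ℝ | p q.1 < p q.2})
      (measurableSet_lt (hp.comp measurable_fst) (hp.comp measurable_snd))
  · exact measurable_measure_prodMk_left (ν := leb)
      (s := {q : ℝ × ℝ | p q.2 = p q.1} ∩ {q : ℝ × ℝ | q.2 ≤ q.1})
      ((measurableSet_eq_fun (hp.comp measurable_snd) (hp.comp measurable_fst)).inter
        (measurableSet_le measurable_snd measurable_fst))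

theorem rankE_le {p : ℝ → ℝ} (hp : Measurable p) (t : ℝ) : rankE p t ≤ leb {u | p t ≤ p u} := by
  have hd : Disjoint {u | p t < p u} {u | p u = p t ∧ u ≤ t} :=
    Set.disjoint_left.2 fun u h1 h2 => absurd h2.1 (ne_of_gt h1)
  rw [rankE, ← measure_union' hd (measurableSet_lt measurable_const hp)]
  refine measure_mono ?_
  rintro u (h | h)
  · exact (show p t < p u from h).le
  · exact h.1.ge

theorem leb_le_lt_top {p : ℝ → ℝ} (hfin : ∀ s > 0, leb {u | s < p u} < ∞) {s : ℝ} (hs : 0 < s) :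
    leb {u | s ≤ p u} < ∞ :=
  (measure_mono fun u (hu : s ≤ p u) => (show s / 2 < p u by linarith)).trans_lt
    (hfin (s / 2) (by linarith))

theorem ofReal_rank {p : ℝ → ℝ} (hp : Measurable p) (hfin : ∀ s > 0, leb {u | s < p u} < ∞)
    {t : ℝ} (ht : 0 < p t) : ENNReal.ofReal (rank p t) = rankE p t :=
  ENNReal.ofReal_toReal ((rankE_le hp t).trans_lt (leb_le_lt_top hfin ht)).ne

/-- Ranks are uniformly distributed: those at most u occupy {p > s0} and the initial part of the tie
{p = s0} of measure u - D0, where s0 = p*(u) and D0 is the measure of {p > s0}. -/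
theorem leb_inter_rank_le {p : ℝ → ℝ} (hp : Measurable p) (h0 : ∀ t, 0 ≤ p t)
    (hfin : ∀ s > 0, leb {u | s < p u} < ∞) {u : ℝ} (hu : 0 < u) :
    leb ({t | 0 < p t} ∩ {t | rank p t ≤ u}) = min (ENNReal.ofReal u) (leb {t | 0 < p t}) := by
  have hiff : ∀ t, 0 < p t → (rank p t ≤ u ↔ rankE p t ≤ ENNReal.ofReal u) := fun t ht => by
    rw [← ofReal_rank hp hfin ht, ENNReal.ofReal_le_ofReal_iff hu.le]
  rcases le_or_gt (leb {t | 0 < p t}) (ENNReal.ofReal u) with h | h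
  · rw [min_eq_right h]
    congr 1
    refine inter_eq_left.2 fun t ht => (hiff t ht).2 ((rankE_le hp t).trans (le_trans ?_ h))
    exact measure_mono fun v (hv : p t ≤ p v) => show 0 < p v from lt_of_lt_of_le ht hv
  rw [min_eq_left h.le]
  have hd : ∀ s : ℝ, 0 ≤ s → distr (ofFun p hp) (ENNReal.ofReal s) = leb {v | s < p v} :=
    fun s hs => by
      rw [distr_ofFun]
      congr 1
      ext v
      rw [mem_ofPred_eq, mem_ofPred_eq, abs_of_nonneg (h0 v), ENNReal.ofReal_lt_ofReal_iff']
      exact ⟨fun h => h.1, fun h => ⟨h, hs.trans_lt h⟩⟩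
  have hS0 : ofFun p hp ∈ S0 := by
    refine ⟨1, lt_of_le_of_lt (le_of_eq (measure_congr ?_)) (hfin 1 one_pos)⟩
    filter_upwards [coe_ofFun p hp] with v hv
    exact propext (by change 1 < |ofFun p hp v| ↔ 1 < p v; rw [hv, abs_of_nonneg (h0 v)])
  set s0 := (rearr (ofFun p hp) u).toReal with hs0
  have hs0' : ENNReal.ofReal s0 = rearr (ofFun p hp) u :=
    ENNReal.ofReal_toReal (rearr_lt_top hS0 hu).ne
  have hs00 : 0 ≤ s0 := ENNReal.toReal_nonneg
  have hlt : ∀ s, 0 ≤ s → (s < s0 ↔ ENNReal.ofReal u < leb {v | s < p v}) := fun s hs => by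
    rw [← hd s hs, ← lt_rearr_iff, ← hs0', ENNReal.ofReal_lt_ofReal_iff']
    exact ⟨fun h => ⟨h, hs.trans_lt h⟩, fun h => h.1⟩
  have hpos : 0 < s0 := (hlt 0 le_rfl).2 h
  have hD0 : leb {v | s0 < p v} ≤ ENNReal.ofReal u := not_lt.1 fun h' =>
    absurd ((hlt s0 hs00).2 h') (lt_irrefl _)
  have hDfin := hfin s0 hpos
  have hmlt : MeasurableSet {v | s0 < p v} := measurableSet_lt measurable_const hp
  -- Continuity from above along levels increasing to s0; the level sets have finite measure because
  -- the levels are positive.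
  have hDle : ENNReal.ofReal u ≤ leb {v | s0 ≤ p v} := by
    obtain ⟨w, hw, hws, hlim⟩ := exists_seq_strictMono_tendsto' hpos
    have hI : {v | s0 ≤ p v} = ⋂ n, {v | w n < p v} := by
      ext v
      simp only [mem_ofPred_eq, mem_iInter]
      exact ⟨fun h n => (hws n).2.trans_le h, fun h => le_of_tendsto' hlim fun n => (h n).le⟩
    have hlim' : Tendsto (fun n => leb {v | w n < p v}) atTop (𝓝 (leb {v | s0 ≤ p v})) := by
      rw [hI]
      refine tendsto_measure_iInter_atTop
        (fun n => (measurableSet_lt measurable_const hp).nullMeasurableSet)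
        (fun m n hmn v hv => lt_of_le_of_lt (hw.monotone hmn) hv) ⟨0, (hfin _ (hws 0).1).ne⟩
    exact ge_of_tendsto' hlim' fun n => ((hlt _ (hws n).1.le).1 (hws n).2).le
  set D0 := (leb {v | s0 < p v}).toReal
  have hD0' : ENNReal.ofReal D0 = leb {v | s0 < p v} := ENNReal.ofReal_toReal hDfin.ne
  have hD0u : D0 ≤ u := (ENNReal.ofReal_le_ofReal_iff hu.le).1 (hD0' ▸ hD0)
  have hset : {t | 0 < p t} ∩ {t | rank p t ≤ u} =
      {v | s0 < p v} ∪ ({v | p v = s0} ∩ {t | cumul {v | p v = s0} t ≤ u - D0}) := by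
    ext t
    rcases lt_trichotomy (p t) s0 with h1 | h1 | h1
    · refine iff_of_false ?_ ?_
      · rintro ⟨h2, h3⟩
        have h4 := (hlt _ (h0 t)).1 h1
        exact absurd ((h4.trans_le (self_le_add_right _ _)).trans_le ((hiff t h2).1 h3)) (lt_irrefl _)
      · rintro (h2 | h2)
        · exact absurd h2 (not_lt.2 h1.le)
        · exact absurd h2.1 h1.ne
    · have h2 : 0 < p t := h1 ▸ hpos
      have h3 : rankE p t = ENNReal.ofReal (D0 + cumul {v | p v = s0} t) := by
        rw [ENNReal.ofReal_add ENNReal.toReal_nonneg (cumul_nonneg _ _), hD0', ofReal_cumul, rankE,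
          h1]
        rfl
      have h4 : rank p t ≤ u ↔ cumul {v | p v = s0} t ≤ u - D0 := by
        rw [hiff t h2, h3, ENNReal.ofReal_le_ofReal_iff hu.le, le_sub_iff_add_le']
      refine ⟨fun h => Or.inr ⟨h1, h4.1 h.2⟩, fun h => ⟨h2, h4.2 ?_⟩⟩
      rcases h with h | h
      · exact absurd h1.symm (ne_of_lt h)
      · exact h.2
    · refine iff_of_true ⟨hpos.trans h1, ?_⟩ (Or.inl h1)
      refine (hiff t (hpos.trans h1)).2 ((rankE_le hp t).trans (le_trans ?_ hD0))
      exact measure_mono fun v hv => lt_of_lt_of_le h1 hv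
  have hle : ENNReal.ofReal (u - D0) ≤ leb {v | p v = s0} := by
    rw [ENNReal.ofReal_sub _ ENNReal.toReal_nonneg, hD0', tsub_le_iff_left]
    refine hDle.trans (le_trans (measure_mono ?_) (measure_union_le _ _))
    intro v hv
    rcases lt_or_eq_of_le (show s0 ≤ p v from hv) with h | h
    · exact Or.inl h
    · exact Or.inr h.symm
  have hdisj : Disjoint {v | s0 < p v}
      ({v | p v = s0} ∩ {t | cumul {v | p v = s0} t ≤ u - D0}) :=
    Set.disjoint_left.2 fun v h1 h2 => absurd h2.1 (ne_of_gt h1)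
  rw [hset, measure_union' hdisj hmlt,
    leb_inter_cumul_le _ (by linarith), min_eq_left hle, ← hD0',
    ← ENNReal.ofReal_add ENNReal.toReal_nonneg (by linarith)]
  congr 1
  ring

theorem leb_univ : leb univ = ∞ := by simp [leb]

/-- An extension of `rank` to a map carrying `leb` on a larger set to `leb`. -/
theorem exists_rank_extension {p : ℝ → ℝ} (hp : Measurable p) (h0 : ∀ t, 0 ≤ p t)
    (hfin : ∀ s > 0, leb {u | s < p u} < ∞) :
    ∃ (S : Set ℝ) (σ : ℝ → ℝ), MeasurableSet S ∧ Measurable σ ∧ {t | 0 < p t} ⊆ S ∧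
      (∀ t, 0 < p t → ENNReal.ofReal (σ t) ≤ leb {u | p t ≤ p u}) ∧
      (leb.restrict S).map σ = leb ∧ (leb {t | 0 < p t} < ∞ → S = univ) := by
  have hS : MeasurableSet {t | 0 < p t} := measurableSet_lt measurable_const hp
  have hr := measurable_rank hp
  have htop : {r : ℝ | ENNReal.ofReal r < ∞} = univ := by ext; simp
  rcases eq_or_ne (leb {t | 0 < p t}) ∞ with h | h
  · refine ⟨{t | 0 < p t}, rank p, hS, hr, le_rfl,
      fun t ht => (ofReal_rank hp hfin ht).le.trans (rankE_le hp t), ?_, fun h' => absurd h h'.ne⟩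
    rw [map_eq_of_leb_inter hr fun u hu => leb_inter_rank_le hp h0 hfin hu, h, htop,
      Measure.restrict_univ]
  -- When the support has finite measure m, its ranks fill (0, m), and the complement, of infinite
  -- measure, is sent onto (m, ∞). When the measure is infinite, the ranks alone already fill the
  -- half-line.
  set S1 := {t | 0 < p t}
  have hc := (continuous_cumul S1ᶜ).measurable
  have hcompl : leb S1ᶜ = ∞ := by
    by_contra hne
    have := measure_union_le (μ := leb) S1 S1ᶜ
    rw [union_compl_self, leb_univ] at this
    exact absurd this (not_le.2 (ENNReal.add_lt_top.2 ⟨h.lt_top, Ne.lt_top hne⟩))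
  set m := (leb S1).toReal with hm
  have hm' : ENNReal.ofReal m = leb S1 := ENNReal.ofReal_toReal h
  have hm0 : 0 ≤ m := ENNReal.toReal_nonneg
  classical
  have hσ : Measurable fun t => if t ∈ S1 then rank p t else m + cumul S1ᶜ t :=
    Measurable.ite hS hr (measurable_const.add hc)
  refine ⟨univ, fun t => if t ∈ S1 then rank p t else m + cumul S1ᶜ t, MeasurableSet.univ,
    hσ, subset_univ _, fun t ht => ?_, ?_, fun _ => rfl⟩
  · have ht' : t ∈ S1 := ht
    simp only [if_pos ht']
    exact (ofReal_rank hp hfin ht).le.trans (rankE_le hp t)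
  · rw [map_eq_of_leb_inter hσ fun u hu => ?_, leb_univ, htop, Measure.restrict_univ]
    have hset : univ ∩ {t | (if t ∈ S1 then rank p t else m + cumul S1ᶜ t) ≤ u} =
        (S1 ∩ {t | rank p t ≤ u}) ∪ (S1ᶜ ∩ {t | m + cumul S1ᶜ t ≤ u}) := by
      ext t
      by_cases ht : t ∈ S1
      · simp [ht]
      · simp [ht]
    have hdisj : Disjoint (S1 ∩ {t | rank p t ≤ u}) (S1ᶜ ∩ {t | m + cumul S1ᶜ t ≤ u}) :=
      disjoint_compl_right.mono inter_subset_left inter_subset_left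
    rw [hset, measure_union hdisj (hS.compl.inter (measurableSet_le
      (measurable_const.add hc) measurable_const)), leb_inter_rank_le hp h0 hfin hu, leb_univ,
      min_eq_left le_top]
    rcases le_or_gt m u with hmu | hmu
    · have : {t | m + cumul S1ᶜ t ≤ u} = {t | cumul S1ᶜ t ≤ u - m} := by
        ext t
        exact (le_sub_iff_add_le' (a := m) (b := cumul S1ᶜ t) (c := u)).symm
      rw [this, leb_inter_cumul_le _ (by linarith), hcompl, min_eq_left le_top, ← hm',
        min_eq_right (ENNReal.ofReal_le_ofReal hmu), ← ENNReal.ofReal_add hm0 (by linarith)]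
      congr 1
      ring
    · have : S1ᶜ ∩ {t | m + cumul S1ᶜ t ≤ u} = ∅ := by
        ext t
        simp only [mem_inter_iff, mem_ofPred_eq, mem_empty_iff_false, iff_false, not_and, not_le]
        intro _
        linarith [cumul_nonneg S1ᶜ t]
      rw [this, measure_empty, add_zero, ← hm', min_eq_left (ENNReal.ofReal_le_ofReal hmu.le)]

/-- The left-continuous decreasing rearrangement. -/
def lrearr (x : L0) (u : ℝ) : ℝ≥0∞ := sInf {s | distr x s < ENNReal.ofReal u}

theorem lrearr_antitone (x : L0) : Antitone (lrearr x) := fun _ _ h =>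
  sInf_le_sInf fun _ hs => lt_of_lt_of_le hs (ENNReal.ofReal_le_ofReal h)

theorem lrearr_lt_top {x : L0} (hx : x ∈ S0) {u : ℝ} (hu : 0 < u) : lrearr x u < ∞ := by
  obtain ⟨s, hs, h⟩ := exists_distr_lt hx (ENNReal.ofReal_pos.2 hu)
  have h1 : lrearr x u ≤ s := sInf_le h
  exact h1.trans_lt hs

theorem rearrTop_le_lrearr (x : L0) (u : ℝ) : rearrTop x ≤ lrearr x u :=
  le_sInf fun s hs => not_lt.1 fun h => by
    have h1 : distr x s < ENNReal.ofReal u := hs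
    rw [distr_eq_top_of_lt h] at h1
    exact absurd h1 (not_lt.2 le_top)

theorem leb_lt_lrearr (x : L0) (s : ℝ≥0∞) : leb {u | s < lrearr x u} = distr x s := by
  rw [← leb_ofReal_lt (distr x s)]
  refine measure_congr ?_
  have hne : ∀ᵐ r ∂leb, r ≠ (distr x s).toReal :=
    ae_restrict_of_ae (measure_eq_zero_iff_ae_notMem.1 (measure_singleton _))
  filter_upwards [hne, ae_leb_pos] with u hu h0
  refine propext ?_
  change s < lrearr x u ↔ ENNReal.ofReal u < distr x s
  constructor
  · intro h
    have h1 : ENNReal.ofReal u ≤ distr x s := not_lt.1 fun h' => by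
      have h2 : lrearr x u ≤ s := sInf_le h'
      exact absurd h2 (not_le.2 h)
    refine lt_of_le_of_ne h1 fun h2 => hu ?_
    rw [← h2, ENNReal.toReal_ofReal h0.le]
  · intro h
    obtain ⟨s', hs', h'⟩ := exists_lt_measure_gt leb _ h
    refine lt_of_lt_of_le hs' (le_sInf fun r hr => ?_)
    by_contra hc
    exact absurd ((h'.trans_le (distr_antitone x (not_le.1 hc).le)).trans hr) (lt_irrefl _)

/-- A nonnegative function whose distribution function is dominated by that of `x` is, up to a
constant factor close to one, dominated by a rearrangement of `x`. -/
theorem exists_dominating_rearrangement {x : L0} (hx : x ∈ S0) {p : ℝ → ℝ} (hp : Measurable p)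
    (h0 : ∀ t, 0 ≤ p t) (hpx : ∀ s, leb {u | s < ENNReal.ofReal (p u)} ≤ distr x s)
    {δ : ℝ} (hδ : 0 < δ) :
    ∃ g : ℝ → ℝ, Measurable g ∧ (∀ t, 0 ≤ g t) ∧
      (∀ s, leb {u | s < ENNReal.ofReal (g u)} = distr x s) ∧
      (∀ᵐ t ∂leb, g t < (rearrTop x).toReal → g t = 0) ∧ ∀ᵐ t ∂leb, p t ≤ (1 + δ) * g t := by
  set c := (rearrTop x).toReal with hc
  have hc0 : 0 ≤ c := ENNReal.toReal_nonneg
  have hc' : ENNReal.ofReal c = rearrTop x := ENNReal.ofReal_toReal (rearrTop_lt_top hx).ne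
  -- Only values above (1 + δ) x*(∞) are ranked. If x*(∞) > 0 this set has finite measure, which is
  -- the reason for losing the factor 1 + δ.
  set S1 := {t | (1 + δ) * c < p t} with hS1
  have hS1m : MeasurableSet S1 := measurableSet_lt measurable_const hp
  have hq := hp.indicator hS1m
  have hq0 : ∀ t, 0 ≤ S1.indicator p t := indicator_nonneg fun t _ => h0 t
  have hfinS : ∀ s, c < s → leb {u | s < p u} < ∞ := fun s hs => by
    refine lt_of_le_of_lt (measure_mono fun u (hu : s < p u) => ?_)
      ((hpx (ENNReal.ofReal s)).trans_lt (distr_lt_top_of_lt ?_))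
    · exact (ENNReal.ofReal_lt_ofReal_iff (hc0.trans_lt (hs.trans hu))).2 hu
    · rw [← hc']
      exact (ENNReal.ofReal_lt_ofReal_iff (hc0.trans_lt hs)).2 hs
  have hfin : ∀ s > 0, leb {u | s < S1.indicator p u} < ∞ := fun s hs => by
    have hcs : c < max s ((1 + δ) * c) := by
      rcases hc0.eq_or_lt with h | h
      · rw [← h]; exact lt_max_of_lt_left hs
      · exact lt_max_of_lt_right (by nlinarith)
    refine (measure_mono fun u hu => ?_).trans_lt (hfinS _ hcs)
    by_cases h : u ∈ S1
    · rw [mem_ofPred_eq, indicator_of_mem h] at hu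
      exact max_lt hu h
    · rw [mem_ofPred_eq, indicator_of_notMem h] at hu
      exact absurd hu (not_lt.2 hs.le)
  have hposS : {t | 0 < S1.indicator p t} = S1 := by
    ext t
    by_cases h : t ∈ S1
    · rw [mem_ofPred_eq, indicator_of_mem h]
      refine iff_of_true (lt_of_le_of_lt ?_ h) h
      positivity
    · rw [mem_ofPred_eq, indicator_of_notMem h]
      exact iff_of_false (lt_irrefl _) h
  obtain ⟨S, σ, hS, hσ, hsub, hσle, hmap, huniv⟩ := exists_rank_extension hq hq0 hfin
  rw [hposS] at hsub huniv
  have hL : Measurable fun u => (lrearr x u).toReal := (lrearr_antitone x).measurable.ennreal_toReal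
  have hσpos : ∀ᵐ t ∂leb, t ∈ S → 0 < σ t := by
    rw [← ae_restrict_iff' hS]
    have : ∀ᵐ r ∂(leb.restrict S).map σ, 0 < r := by rw [hmap]; exact ae_leb_pos
    exact ae_of_ae_map hσ.aemeasurable this
  have hofL : ∀ u, 0 < u → ENNReal.ofReal (lrearr x u).toReal = lrearr x u := fun u hu =>
    ENNReal.ofReal_toReal (lrearr_lt_top hx hu).ne
  have hcL : ∀ u, 0 < u → c ≤ (lrearr x u).toReal := fun u hu =>
    ENNReal.toReal_mono (lrearr_lt_top hx hu).ne (rearrTop_le_lrearr x u)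
  refine ⟨S.indicator fun t => (lrearr x (σ t)).toReal, (hL.comp hσ).indicator hS,
    indicator_nonneg fun t _ => ENNReal.toReal_nonneg, fun s => ?_, ?_, ?_⟩
  · have hms : MeasurableSet {u | s < lrearr x u} :=
      measurableSet_lt measurable_const (lrearr_antitone x).measurable
    rw [← leb_lt_lrearr x s]
    nth_rewrite 2 [← hmap]
    rw [Measure.map_apply hσ hms, Measure.restrict_apply (hσ hms)]
    refine measure_congr ?_
    filter_upwards [hσpos] with t ht
    refine propext ?_
    change s < ENNReal.ofReal (S.indicator _ t) ↔ s < lrearr x (σ t) ∧ t ∈ S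
    by_cases h : t ∈ S
    · rw [indicator_of_mem h, hofL _ (ht h)]
      exact ⟨fun h' => ⟨h', h⟩, fun h' => h'.1⟩
    · rw [indicator_of_notMem h]
      simp [h]
  · filter_upwards [hσpos] with t ht hlt
    by_cases h : t ∈ S
    · rw [indicator_of_mem h] at hlt
      exact absurd hlt (not_lt.2 (hcL _ (ht h)))
    · rw [indicator_of_notMem h]
  · filter_upwards [hσpos] with t ht
    by_cases h1 : t ∈ S1
    · have h := hsub h1
      rw [indicator_of_mem h]
      have h2 : ENNReal.ofReal (p t) ≤ lrearr x (σ t) := by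
        refine le_sInf fun s hs => not_lt.1 fun hlt => ?_
        have h3 : ENNReal.ofReal (σ t) ≤ leb {u | s < ENNReal.ofReal (p u)} := by
          have hpt : 0 < S1.indicator p t := by
            have : t ∈ {t | 0 < S1.indicator p t} := by rw [hposS]; exact h1
            exact this
          refine (hσle t hpt).trans (measure_mono fun u hu => ?_)
          rw [mem_ofPred_eq, indicator_of_mem h1] at hu
          rw [indicator_of_mem h1] at hpt
          have hu' : p t ≤ p u := by
            by_cases h4 : u ∈ S1
            · rwa [indicator_of_mem h4] at hu
            · rw [indicator_of_notMem h4] at hu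
              exact absurd hu (not_le.2 hpt)
          exact hlt.trans_le (ENNReal.ofReal_le_ofReal hu')
        exact absurd (lt_of_lt_of_le hs (h3.trans (hpx s))) (lt_irrefl _)
      rw [← hofL _ (ht h), ENNReal.ofReal_le_ofReal_iff ENNReal.toReal_nonneg] at h2
      nlinarith [h0 t]
    · have h2 : p t ≤ (1 + δ) * c := not_lt.1 h1
      by_cases h : t ∈ S
      · rw [indicator_of_mem h]
        have := hcL _ (ht h)
        nlinarith
      · rw [indicator_of_notMem h, mul_zero]
        -- A point outside S exists only if S1 has infinite measure, and this forces x*(∞) = 0;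
        -- there p vanishes.
        have hS1top : ¬ leb S1 < ∞ := fun h' => h (huniv h' ▸ mem_univ t)
        have hc00 : c = 0 := by
          by_contra hne
          refine hS1top (hfinS _ ?_)
          have : 0 < c := lt_of_le_of_ne hc0 (Ne.symm hne)
          nlinarith
        rwa [hc00, mul_zero] at h2

/-- This and `min_le_add_sum_ite` count the grid points (k + 1)η below z: the count times η recovers
z, capped at Kη, up to one step. They replace integration both in the values and in the quantiles.
-/
theorem sum_ite_le_self {η z : ℝ} (hz : 0 ≤ z) (K : ℕ) :
    ∑ k ∈ Finset.range K, (if ((k : ℝ) + 1) * η ≤ z then η else 0) ≤ min z (K * η) := by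
  induction K with
  | zero => simp [hz]
  | succ K ih =>
    rw [Finset.sum_range_succ]
    have h1 := ih.trans (min_le_left _ _)
    have h2 := ih.trans (min_le_right _ _)
    push_cast
    split_ifs with h
    · exact le_min (by linarith) (by linarith)
    · exact le_min (by linarith) (by linarith)

theorem min_le_add_sum_ite {η z : ℝ} (hη : 0 ≤ η) (K : ℕ) :
    min z (K * η) ≤ η + ∑ k ∈ Finset.range K, (if ((k : ℝ) + 1) * η < z then η else 0) := by
  have hall : ∀ K : ℕ, (K : ℝ) * η < z →
      ∑ k ∈ Finset.range K, (if ((k : ℝ) + 1) * η < z then η else 0) = K * η := fun K hK => by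
    rw [Finset.sum_congr rfl fun k hk => if_pos ?_]
    · simp
    · refine lt_of_le_of_lt ?_ hK
      have : (k : ℝ) + 1 ≤ K := by exact_mod_cast Finset.mem_range.1 hk
      gcongr
  rcases lt_or_ge ((K : ℝ) * η) z with h | h
  · rw [hall K h, min_eq_right h.le]
    linarith
  rw [min_eq_left h]
  induction K with
  | zero => simp at h ⊢; linarith
  | succ K ih =>
    rw [Finset.sum_range_succ]
    have h0 : 0 ≤ if ((K : ℝ) + 1) * η < z then η else 0 := by split_ifs <;> simp [hη]
    rcases lt_or_ge ((K : ℝ) * η) z with h' | h'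
    · rw [hall K h']
      push_cast at h
      linarith
    · linarith [ih h']

theorem ofFun_congr {f g : ℝ → ℝ} {hf : Measurable f} {hg : Measurable g} (h : f =ᵐ[leb] g) :
    ofFun f hf = ofFun g hg := AEEqFun.mk_eq_mk.2 h

theorem eq_ofFun {y : L0} {f : ℝ → ℝ} {hf : Measurable f} (h : y =ᵐ[leb] f) : y = ofFun f hf := by
  rw [← ofFun_coe y]
  exact ofFun_congr h

theorem sum_ofFun {ι : Type*} (s : Finset ι) (f : ι → ℝ → ℝ) (hf : ∀ i, Measurable (f i)) :
    ∑ i ∈ s, ofFun (f i) (hf i) =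
      ofFun (fun t => ∑ i ∈ s, f i t) (Finset.measurable_fun_sum s fun i _ => hf i) := by
  classical
  induction s using Finset.induction_on with
  | empty => simp only [Finset.sum_empty]; rfl
  | insert a s ha ih =>
    rw [Finset.sum_insert ha, ih]
    simp_rw [Finset.sum_insert ha]
    rfl

theorem smul_ofFun (c : ℝ) (f : ℝ → ℝ) (hf : Measurable f) :
    c • ofFun f hf = ofFun (fun t => c * f t) (hf.const_mul c) := rfl

theorem ofFun_sub_ofFun {f g : ℝ → ℝ} (hf : Measurable f) (hg : Measurable g) :
    ofFun f hf - ofFun g hg = ofFun (fun t => f t - g t) (hf.sub hg) := rfl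

theorem average_mem_of_convex {V : Type*} [AddCommGroup V] [Module ℝ V] {C : Set V}
    (hC : Convex ℝ C) {N : ℕ} (hN : 0 < N) {y : ℕ → V} (hy : ∀ j < N, y j ∈ C) :
    (1 / (N : ℝ)) • ∑ j ∈ Finset.range N, y j ∈ C := by
  rw [Finset.smul_sum]
  refine hC.sum_mem (fun _ _ => by positivity) ?_ fun j hj => hy j (Finset.mem_range.1 hj)
  have : (N : ℝ) ≠ 0 := by exact_mod_cast hN.ne'
  simp [this]

/-! ### Elements of Q'(x) obtained by averaging. -/

/-- The generators of `Q' (x)`. -/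
def gens (x : L0) : Set L0 :=
  {y | Equimeasurable y x ∧ ∀ᵐ t ∂leb, y t < (rearrTop y).toReal → y t = 0}

/-- `g` is a nonnegative function representing a generator of `Q' (x)`. -/
structure IsRearrangement (x : L0) (g : ℝ → ℝ) : Prop where
  measurable : Measurable g
  nonneg : ∀ t, 0 ≤ g t
  distr_eq : ∀ s, leb {u | s < ENNReal.ofReal (g u)} = distr x s
  ae_eq_zero : ∀ᵐ t ∂leb, g t < (rearrTop x).toReal → g t = 0

namespace IsRearrangement

variable {x : L0} {g : ℝ → ℝ}

theorem distr_ofFun_eq (hg : IsRearrangement x g) (s : ℝ≥0∞) :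
    distr (ofFun g hg.measurable) s = distr x s := by
  rw [distr_ofFun]
  simp_rw [abs_of_nonneg (hg.nonneg _)]
  exact hg.distr_eq s

theorem mem_gens (hg : IsRearrangement x g) : ofFun g hg.measurable ∈ gens x := by
  refine ⟨equimeasurable_iff.2 hg.distr_ofFun_eq, ?_⟩
  filter_upwards [hg.ae_eq_zero, coe_ofFun g hg.measurable] with t h1 h2
  rw [rearrTop_eq_of_distr_eq hg.distr_ofFun_eq, h2]
  exact h1

theorem lintegral_sub_eq (hg : IsRearrangement x g) (s : ℝ≥0∞) :
    ∫⁻ u, (ENNReal.ofReal (g u) - s) ∂leb = excess x s := by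
  have h : excess (ofFun g hg.measurable) s = excess x s := by
    rw [excess_eq_lintegral_distr, excess_eq_lintegral_distr]
    simp_rw [hg.distr_ofFun_eq]
  rw [← h, excess_ofFun]
  simp_rw [abs_of_nonneg (hg.nonneg _)]

/-- Moving the part of a rearrangement outside `F` to a set `B` disjoint from `F`. -/
theorem move (hg : IsRearrangement x g) {F B : Set ℝ} (hF : MeasurableSet F)
    (hB : MeasurableSet B) (hBF : B ⊆ Fᶜ) {ψ : ℝ → ℝ} (hψ : Measurable ψ)
    (hmap : (leb.restrict B).map ψ = leb.restrict Fᶜ) :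
    IsRearrangement x (fun t => F.indicator g t + B.indicator (g ∘ ψ) t) := by
  have hgψ : Measurable (g ∘ ψ) := hg.measurable.comp hψ
  refine ⟨(hg.measurable.indicator hF).add (hgψ.indicator hB), fun t => ?_, fun s => ?_, ?_⟩
  · exact add_nonneg (indicator_nonneg (fun t _ => hg.nonneg t) t)
      (indicator_nonneg (fun t _ => hg.nonneg _) t)
  · have hm : MeasurableSet {u | s < ENNReal.ofReal (g u)} :=
      measurableSet_lt measurable_const hg.measurable.ennreal_ofReal
    have hset : {u | s < ENNReal.ofReal (F.indicator g u + B.indicator (g ∘ ψ) u)} =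
        ({u | s < ENNReal.ofReal (g u)} ∩ F) ∪ (ψ ⁻¹' {u | s < ENNReal.ofReal (g u)} ∩ B) := by
      ext u
      by_cases h1 : u ∈ F
      · have h2 : u ∉ B := fun h => hBF h h1
        simp [h1, h2]
      · by_cases h2 : u ∈ B <;> simp [h1, h2]
    have hd : Disjoint ({u | s < ENNReal.ofReal (g u)} ∩ F)
        (ψ ⁻¹' {u | s < ENNReal.ofReal (g u)} ∩ B) :=
      Set.disjoint_left.2 fun u h1 h2 => hBF h2.2 h1.2
    rw [hset, measure_union hd ((hψ hm).inter hB), ← hg.distr_eq s,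
      ← Measure.restrict_apply (hψ hm), ← Measure.map_apply hψ hm, hmap,
      Measure.restrict_apply hm,
      ← measure_inter_add_sdiff {u | s < ENNReal.ofReal (g u)} hF]
    rfl
  · have h1 : ∀ᵐ t ∂leb, t ∈ B → (g (ψ t) < (rearrTop x).toReal → g (ψ t) = 0) := by
      rw [← ae_restrict_iff' hB]
      refine ae_of_ae_map (p := fun t => g t < (rearrTop x).toReal → g t = 0) hψ.aemeasurable ?_
      rw [hmap]
      exact ae_restrict_of_ae hg.ae_eq_zero
    filter_upwards [h1, hg.ae_eq_zero] with t h1 h2 h3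
    by_cases hF' : t ∈ F
    · have hB' : t ∉ B := fun h => hBF h hF'
      simp only [hF', hB', indicator_of_mem, indicator_of_notMem, not_false_eq_true, add_zero]
        at h3 ⊢
      exact h2 h3
    · by_cases hB' : t ∈ B
      · simp only [hF', hB', indicator_of_mem, indicator_of_notMem, not_false_eq_true, zero_add,
          Function.comp_apply] at h3 ⊢
        exact h1 hB' h3
      · simp [hF', hB']

end IsRearrangement

namespace BanachFunctionSpace

variable {E : BanachFunctionSpace} {x : L0}

theorem gens_subset (hE : E.IsFullySymmetric) (hx : x ∈ E.carrier) : gens x ⊆ E.carrier :=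
  fun y hy => (hE.symm x hx y hy.1).1

theorem convexHull_gens_subset (hE : E.IsFullySymmetric) (hx : x ∈ E.carrier) :
    convexHull ℝ (gens x) ⊆ E.carrier :=
  convexHull_min (gens_subset hE hx) E.carrier.convex

theorem convexHull_gens_subset_Qprime (hE : E.IsFullySymmetric) (hx : x ∈ E.carrier) :
    convexHull ℝ (gens x) ⊆ E.Qprime x := fun y hy =>
  ⟨convexHull_gens_subset hE hx hy, fun ε hε => ⟨y, hy, convexHull_gens_subset hE hx hy, by
    rwa [sub_self, E.norm_zero]⟩⟩

theorem mem_Qprime_of_approx {y : L0} (hy : y ∈ E.carrier)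
    (h : ∀ ε > 0, ∃ z ∈ E.Qprime x, E.norm (y - z) < ε) : y ∈ E.Qprime x := by
  refine ⟨hy, fun ε hε => ?_⟩
  obtain ⟨z, hz, hyz⟩ := h (ε / 2) (by linarith)
  obtain ⟨w, hw, hwE, hzw⟩ := hz.2 (ε / 2) (by linarith)
  exact ⟨w, hw, hwE, (norm_sub_le hy hz.1 hwE).trans_lt (by linarith)⟩

theorem convex_normClosure {A : Set L0} (hA : Convex ℝ A) : Convex ℝ (E.normClosure A) := by
  intro y hy z hz a b ha hb hab
  refine ⟨E.carrier.convex hy.1 hz.1 ha hb hab, fun ε hε => ?_⟩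
  obtain ⟨y', hy', hyE, hyy⟩ := hy.2 ε hε
  obtain ⟨z', hz', hzE, hzz⟩ := hz.2 ε hε
  refine ⟨a • y' + b • z', hA hy' hz' ha hb hab,
    E.carrier.convex hyE hzE ha hb hab, ?_⟩
  have h1 : a • y + b • z - (a • y' + b • z') = a • (y - y') + b • (z - z') := by
    rw [smul_sub, smul_sub]; abel
  have hyd := E.carrier.sub_mem hy.1 hyE
  have hzd := E.carrier.sub_mem hz.1 hzE
  rw [h1]
  refine (E.norm_add_le _ (E.carrier.smul_mem a hyd) _ (E.carrier.smul_mem b hzd)).trans_lt ?_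
  rw [E.norm_smul _ _ hyd, E.norm_smul _ _ hzd, abs_of_nonneg ha, abs_of_nonneg hb]
  rcases ha.eq_or_lt with rfl | ha'
  · have : b = 1 := by linarith
    subst this
    linarith
  · nlinarith

theorem convex_Qprime : Convex ℝ (E.Qprime x) :=
  convex_normClosure (convex_convexHull ℝ _)

theorem mem_of_distr_le (hE : E.IsFullySymmetric) (hx : x ∈ E.carrier) {u : L0}
    (h : ∀ s, distr u s ≤ distr x s) : u ∈ E.carrier ∧ E.norm u ≤ E.norm x :=
  mem_of_excess_le hE hx (excess_le_of_distr_le h)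

theorem ofFun_mem (hE : E.IsFullySymmetric) (hx : x ∈ E.carrier) {g : ℝ → ℝ}
    (hg : IsRearrangement x g) {f : ℝ → ℝ} (hf : Measurable f) {C : ℝ} (hC : 0 ≤ C)
    (h : ∀ t, |f t| ≤ C * g t) : ofFun f hf ∈ E.carrier ∧ E.norm (ofFun f hf) ≤ C * E.norm x := by
  have h1 := mem_of_distr_le hE hx fun s => (hg.distr_ofFun_eq s).le
  have h2 := ideal_ae hE (E.carrier.smul_mem C h1.1) (y := ofFun f hf) (by
    rw [smul_ofFun]
    filter_upwards [coe_ofFun f hf, coe_ofFun _ (hg.measurable.const_mul C)] with t h2 h3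
    rw [h2, h3]
    exact (h t).trans (le_abs_self _))
  refine ⟨h2.1, h2.2.trans ?_⟩
  rw [E.norm_smul _ _ h1.1, abs_of_nonneg hC]
  exact mul_le_mul_of_nonneg_left h1.2 hC

/-- The copies are disjointly supported, so their excesses add: N times ∫(g/N - s)₊ is ∫(g - Ns)₊.
The sum thus satisfies the bound required by `exists_nat_norm_lt`. -/
theorem excess_sum_indicator_le {g : ℝ → ℝ} (hg : IsRearrangement x g) {F : Set ℝ}
    {B : ℕ → Set ℝ} (hB : ∀ j, MeasurableSet (B j))
    (hd : Pairwise (Function.onFun Disjoint B)) {ψ : ℕ → ℝ → ℝ} (hψ : ∀ j, Measurable (ψ j))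
    (hmap : ∀ j, (leb.restrict (B j)).map (ψ j) = leb.restrict Fᶜ) {N : ℕ} (hN : 0 < N)
    (s : ℝ≥0∞) :
    ∫⁻ t, (ENNReal.ofReal (1 / (N : ℝ) * ∑ j ∈ Finset.range N, (B j).indicator (g ∘ ψ j) t) - s)
      ∂leb ≤ excess x (N * s) := by
  have hN0 : (0 : ℝ) < N := by exact_mod_cast hN
  have hmG : Measurable fun u => ENNReal.ofReal (1 / (N : ℝ) * g u) - s :=
    (hg.measurable.const_mul _).ennreal_ofReal.sub_const s
  have hpt : ∀ t, (ENNReal.ofReal (1 / (N : ℝ) *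
      ∑ j ∈ Finset.range N, (B j).indicator (g ∘ ψ j) t) - s) ≤
      ∑ j ∈ Finset.range N,
        (B j).indicator (fun t => ENNReal.ofReal (1 / (N : ℝ) * g (ψ j t)) - s) t := fun t => by
    by_cases h : ∃ i ∈ Finset.range N, t ∈ B i
    · obtain ⟨i, hi, hti⟩ := h
      have hne : ∀ j ∈ Finset.range N, j ≠ i → t ∉ B j := fun j _ hj htj =>
        Set.disjoint_left.1 (hd hj) htj hti
      rw [Finset.sum_eq_single_of_mem i hi fun j hj hji => indicator_of_notMem (hne j hj hji) _,
        Finset.sum_eq_single_of_mem i hi fun j hj hji => indicator_of_notMem (hne j hj hji) _,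
        indicator_of_mem hti, indicator_of_mem hti]
      rfl
    · push Not at h
      rw [Finset.sum_eq_zero fun j hj => indicator_of_notMem (h j hj) _]
      simp
  calc _ ≤ ∫⁻ t, ∑ j ∈ Finset.range N,
        (B j).indicator (fun t => ENNReal.ofReal (1 / (N : ℝ) * g (ψ j t)) - s) t ∂leb :=
        lintegral_mono hpt
    _ = ∑ j ∈ Finset.range N, ∫⁻ t in Fᶜ, (ENNReal.ofReal (1 / (N : ℝ) * g t) - s) ∂leb := by
        have hmGψ : ∀ j, Measurable fun t => ENNReal.ofReal (1 / (N : ℝ) * g (ψ j t)) - s :=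
          fun j => hmG.comp (hψ j)
        rw [lintegral_finsetSum _ fun j _ => (hmGψ j).indicator (hB j)]
        refine Finset.sum_congr rfl fun j _ => ?_
        rw [lintegral_indicator (hB j), ← hmap j, lintegral_map hmG (hψ j)]
    _ ≤ N * ∫⁻ t, (ENNReal.ofReal (1 / (N : ℝ) * g t) - s) ∂leb := by
        rw [Finset.sum_const, Finset.card_range, nsmul_eq_mul]
        gcongr
        exact Measure.restrict_le_self
    _ = excess x (N * s) := by
        rw [← lintegral_const_mul _ hmG, ← hg.lintegral_sub_eq]
        refine lintegral_congr fun t => ?_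
        have hNt : (N : ℝ≥0∞) = ENNReal.ofReal N := (ENNReal.ofReal_natCast N).symm
        rw [ENNReal.mul_sub fun _ _ => ENNReal.natCast_ne_top N, hNt,
          ← ENNReal.ofReal_mul hN0.le, ← mul_assoc, mul_one_div_cancel hN0.ne', one_mul]

/-- The part of g outside F is moved into each of N disjoint subsets of the complement. Averaging
keeps g on F and spreads the rest into copies of g/N, negligible because φ(x) = 0. -/
theorem indicator_mem_Qprime_of_compl (hE : E.IsFullySymmetric) (hx : x ∈ E.carrier)
    (hφ : E.HasDilationLimit x 0) {g : ℝ → ℝ} (hg : IsRearrangement x g) {F : Set ℝ}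
    (hF : MeasurableSet F) (hFc : leb Fᶜ = ∞) :
    ofFun (F.indicator g) (hg.measurable.indicator hF) ∈ E.Qprime x := by
  have hFE := (ofFun_mem hE hx hg (hg.measurable.indicator hF) zero_le_one fun t => by
    rw [one_mul, abs_of_nonneg (indicator_nonneg (fun t _ => hg.nonneg t) t)]
    exact indicator_le_self' (fun t _ => hg.nonneg t) t).1
  refine mem_Qprime_of_approx hFE fun ε hε => ?_
  obtain ⟨N, hN, hNe⟩ := exists_nat_norm_lt hE hx hφ hε
  have hN0 : (0 : ℝ) < N := by exact_mod_cast hN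
  obtain ⟨B, hB, hd, hBF, hBtop⟩ := exists_split hF.compl hFc
  have hex : ∀ j, ∃ ψ : ℝ → ℝ, Measurable ψ ∧
      (leb.restrict (B j)).map ψ = leb.restrict Fᶜ := fun j => by
    obtain ⟨ψ, h1, -, h2⟩ := exists_transport (A := B j) (B := Fᶜ) (by rw [hBtop, hFc])
    exact ⟨ψ, h1, h2 (by rw [hBtop, hFc])⟩
  choose ψ hψ hmap using hex
  have hgj := fun j => hg.move hF (hB j) (hBF j) (hψ j) (hmap j)
  refine ⟨(1 / (N : ℝ)) • ∑ j ∈ Finset.range N, ofFun _ (hgj j).measurable,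
    average_mem_of_convex convex_Qprime hN fun j _ => convexHull_gens_subset_Qprime hE hx
      (subset_convexHull ℝ _ (hgj j).mem_gens), ?_⟩
  rw [sum_ofFun, smul_ofFun, ofFun_sub_ofFun]
  refine (hNe N le_rfl _ fun s => ?_).2
  rw [excess_ofFun]
  refine le_trans (lintegral_mono fun t => ?_)
    (excess_sum_indicator_le hg hB hd hψ hmap hN s)
  have h1 : 0 ≤ 1 / (N : ℝ) * ∑ j ∈ Finset.range N, (B j).indicator (g ∘ ψ j) t :=
    mul_nonneg (by positivity) (Finset.sum_nonneg fun j _ =>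
      indicator_nonneg (fun t _ => hg.nonneg _) t)
  have h2 : F.indicator g t - 1 / (N : ℝ) * ∑ j ∈ Finset.range N,
      (F.indicator g t + (B j).indicator (g ∘ ψ j) t) =
      -(1 / (N : ℝ) * ∑ j ∈ Finset.range N, (B j).indicator (g ∘ ψ j) t) := by
    rw [Finset.sum_add_distrib, Finset.sum_const, Finset.card_range, nsmul_eq_mul, mul_add,
      ← mul_assoc, one_div_mul_cancel hN0.ne', one_mul]
    ring
  simp only [h2, abs_neg, abs_of_nonneg h1, le_refl]

theorem exists_nat_mul_lt (C : ℝ) {ε : ℝ} (hε : 0 < ε) :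
    ∃ N : ℕ, 0 < N ∧ 1 / (N : ℝ) * C < ε := by
  obtain ⟨N, hN⟩ := exists_nat_gt (C / ε)
  refine ⟨N + 1, Nat.succ_pos _, ?_⟩
  have hN0 : (0 : ℝ) < (N + 1 : ℕ) := by positivity
  rw [one_div, inv_mul_lt_iff₀ hN0]
  rw [div_lt_iff₀ hε] at hN
  push_cast
  linarith

/-- Removing from F one of N disjoint sets of infinite measure reduces to the previous case. Each
point is lost at most once, so the average differs from gχ_F by at most g/N. -/
theorem indicator_mem_Qprime (hE : E.IsFullySymmetric) (hx : x ∈ E.carrier)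
    (hφ : E.HasDilationLimit x 0) {g : ℝ → ℝ} (hg : IsRearrangement x g) {F : Set ℝ}
    (hF : MeasurableSet F) :
    ofFun (F.indicator g) (hg.measurable.indicator hF) ∈ E.Qprime x := by
  have hFE := (ofFun_mem hE hx hg (hg.measurable.indicator hF) zero_le_one fun t => by
    rw [one_mul, abs_of_nonneg (indicator_nonneg (fun t _ => hg.nonneg t) t)]
    exact indicator_le_self' (fun t _ => hg.nonneg t) t).1
  refine mem_Qprime_of_approx hFE fun ε hε => ?_
  obtain ⟨N, hN, hNe⟩ := exists_nat_mul_lt (E.norm x) hε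
  have hN0 : (0 : ℝ) < N := by exact_mod_cast hN
  obtain ⟨B, hB, hd, -, hBtop⟩ := exists_split MeasurableSet.univ leb_univ
  have hm : ∀ j, Measurable ((F \ B j).indicator g) := fun j =>
    hg.measurable.indicator (hF.diff (hB j))
  refine ⟨(1 / (N : ℝ)) • ∑ j ∈ Finset.range N, ofFun _ (hm j),
    average_mem_of_convex convex_Qprime hN fun j _ => indicator_mem_Qprime_of_compl hE hx hφ hg
      (hF.diff (hB j)) (top_unique ((hBtop j).ge.trans (measure_mono fun t ht h => h.2 ht))), ?_⟩
  rw [sum_ofFun, smul_ofFun, ofFun_sub_ofFun]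
  refine (ofFun_mem hE hx hg _ (C := 1 / (N : ℝ)) (by positivity) fun t => ?_).2.trans_lt hNe
  have h1 : ∑ j ∈ Finset.range N, ((F.indicator g t) - (F \ B j).indicator g t) ≤ g t ∧
      0 ≤ ∑ j ∈ Finset.range N, ((F.indicator g t) - (F \ B j).indicator g t) := by
    have hterm : ∀ j, (F.indicator g t) - (F \ B j).indicator g t = (F ∩ B j).indicator g t :=
      fun j => by
        by_cases h1 : t ∈ F <;> by_cases h2 : t ∈ B j <;> simp [h1, h2]
    simp_rw [hterm]
    refine ⟨?_, Finset.sum_nonneg fun j _ => indicator_nonneg (fun t _ => hg.nonneg t) t⟩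
    by_cases h : ∃ i ∈ Finset.range N, t ∈ B i
    · obtain ⟨i, hi, hti⟩ := h
      rw [Finset.sum_eq_single_of_mem i hi fun j _ hj => indicator_of_notMem (fun h' =>
        Set.disjoint_left.1 (hd hj) h'.2 hti) _]
      exact indicator_le_self' (fun t _ => hg.nonneg t) t
    · push Not at h
      rw [Finset.sum_eq_zero fun j hj => indicator_of_notMem (fun h' => h j hj h'.2) _]
      exact hg.nonneg t
  have h2 : F.indicator g t - 1 / (N : ℝ) * ∑ j ∈ Finset.range N, (F \ B j).indicator g t =
      1 / (N : ℝ) * ∑ j ∈ Finset.range N, ((F.indicator g t) - (F \ B j).indicator g t) := by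
    rw [Finset.sum_sub_distrib, Finset.sum_const, Finset.card_range, nsmul_eq_mul, mul_sub,
      ← mul_assoc, one_div_mul_cancel hN0.ne', one_mul]
  rw [h2, abs_of_nonneg (mul_nonneg (by positivity) h1.2)]
  exact mul_le_mul_of_nonneg_left h1.1 (by positivity)

/-- The sets {(j + 1)g ≤ Np} discretize the ratio p/g in steps of 1/N; averaging gχ over them gives
p with error at most g/N. -/
theorem mem_Qprime_of_le_rearrangement (hE : E.IsFullySymmetric) (hx : x ∈ E.carrier)
    (hφ : E.HasDilationLimit x 0) {g : ℝ → ℝ} (hg : IsRearrangement x g) {p : ℝ → ℝ}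
    (hp : Measurable p) (h0 : ∀ t, 0 ≤ p t) (hpg : ∀ t, p t ≤ g t) :
    ofFun p hp ∈ E.Qprime x := by
  have hpE := (ofFun_mem hE hx hg hp zero_le_one fun t => by
    rw [one_mul, abs_of_nonneg (h0 t)]
    exact hpg t).1
  refine mem_Qprime_of_approx hpE fun ε hε => ?_
  obtain ⟨N, hN, hNe⟩ := exists_nat_mul_lt (E.norm x) hε
  have hN0 : (0 : ℝ) < N := by exact_mod_cast hN
  have hF : ∀ j : ℕ, MeasurableSet {t | ((j : ℝ) + 1) * g t ≤ N * p t} := fun j =>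
    measurableSet_le (hg.measurable.const_mul _) (hp.const_mul _)
  refine ⟨(1 / (N : ℝ)) • ∑ j ∈ Finset.range N, ofFun _ (hg.measurable.indicator (hF j)),
    average_mem_of_convex convex_Qprime hN fun j _ => indicator_mem_Qprime hE hx hφ hg (hF j), ?_⟩
  rw [sum_ofFun, smul_ofFun, ofFun_sub_ofFun]
  refine (ofFun_mem hE hx hg _ (C := 1 / (N : ℝ)) (by positivity) fun t => ?_).2.trans_lt hNe
  have hz : 0 ≤ N * p t := mul_nonneg hN0.le (h0 t)
  have h1 := (sum_ite_le_self (η := g t) hz N).trans (min_le_left _ _)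
  have h2 := min_le_add_sum_ite (z := N * p t) (hg.nonneg t) N
  rw [min_eq_left (mul_le_mul_of_nonneg_left (hpg t) hN0.le)] at h2
  have h3 : ∑ k ∈ Finset.range N, (if ((k : ℝ) + 1) * g t < N * p t then g t else 0) ≤
      ∑ k ∈ Finset.range N, (if ((k : ℝ) + 1) * g t ≤ N * p t then g t else 0) := by
    refine Finset.sum_le_sum fun k _ => ?_
    split_ifs with h4 h5 h5
    · exact le_rfl
    · exact absurd h4.le h5
    · exact hg.nonneg t
    · exact le_rfl
  have h4 : ∑ k ∈ Finset.range N, {t | ((k : ℝ) + 1) * g t ≤ N * p t}.indicator g t =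
      ∑ k ∈ Finset.range N, (if ((k : ℝ) + 1) * g t ≤ N * p t then g t else 0) :=
    Finset.sum_congr rfl fun k _ => by simp [indicator_apply]
  rw [h4]
  have h5 : p t = 1 / (N : ℝ) * (N * p t) := by
    rw [← mul_assoc, one_div_mul_cancel hN0.ne', one_mul]
  rw [h5, ← mul_sub, abs_mul, abs_of_pos (show 0 < 1 / (N : ℝ) by positivity)]
  refine mul_le_mul_of_nonneg_left ?_ (by positivity)
  rw [← h5, abs_le]
  constructor <;> linarith [hg.nonneg t]

/-- Every nonnegative element whose distribution function is dominated by that of `x` belongs to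
`Q' (x)`. -/
theorem mem_Qprime_of_distr_le (hE : E.IsFullySymmetric) (hx : x ∈ E.carrier)
    (hφ : E.HasDilationLimit x 0) {y : L0} (hy0 : 0 ≤ y) (hyx : ∀ s, distr y s ≤ distr x s) :
    y ∈ E.Qprime x := by
  have hyE := mem_of_distr_le hE hx hyx
  set p : ℝ → ℝ := fun t => max (y t) 0 with hpdef
  have hp : Measurable p := y.measurable.max measurable_const
  have hp0 : ∀ t, 0 ≤ p t := fun t => le_max_right _ _
  have hyp : y = ofFun p hp := eq_ofFun (by
    filter_upwards [nonneg_iff_ae.1 hy0] with t ht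
    exact (max_eq_left ht).symm)
  have hpd : ∀ s, leb {u | s < ENNReal.ofReal (p u)} ≤ distr x s := fun s => by
    refine le_trans (le_of_eq ?_) (hyx s)
    rw [hyp, distr_ofFun]
    simp_rw [abs_of_nonneg (hp0 _)]
  refine mem_Qprime_of_approx hyE.1 fun ε hε => ?_
  have hny := norm_nonneg hyE.1
  set δ := ε / (E.norm y + 1) with hδ
  have hδ0 : 0 < δ := by positivity
  obtain ⟨g, hgm, hg0, hgd, hgc, hpg⟩ :=
    exists_dominating_rearrangement (hE.subset_S0 x hx) hp hp0 hpd hδ0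
  have hg : IsRearrangement x g := ⟨hgm, hg0, hgd, hgc⟩
  -- The minimum with g is there only to have q ≤ g at every point; almost everywhere q = p/(1 + δ).
  have hqm : Measurable fun t => min (1 / (1 + δ) * p t) (g t) := (hp.const_mul _).min hgm
  refine ⟨ofFun _ hqm, mem_Qprime_of_le_rearrangement hE hx hφ hg hqm
    (fun t => le_min (mul_nonneg (by positivity) (hp0 t)) (hg0 t)) (fun t => min_le_right _ _), ?_⟩
  have h1 : y - ofFun _ hqm = (δ / (1 + δ)) • y := by
    have h2 : ofFun _ hqm = (1 / (1 + δ)) • y := by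
      rw [hyp, smul_ofFun]
      refine ofFun_congr ?_
      filter_upwards [hpg] with t ht
      refine min_eq_left ?_
      rw [one_div, inv_mul_le_iff₀ (by positivity)]
      exact ht
    rw [h2]
    nth_rewrite 1 [← one_smul ℝ y]
    rw [← sub_smul]
    congr 1
    field_simp
    ring
  rw [h1, E.norm_smul _ _ hyE.1, abs_of_pos (by positivity)]
  calc δ / (1 + δ) * E.norm y ≤ δ * E.norm y :=
        mul_le_mul_of_nonneg_right (div_le_self hδ0.le (by linarith)) hny
    _ < ε := by
        rw [hδ, div_mul_eq_mul_div, div_lt_iff₀ (by positivity)]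
        nlinarith

end BanachFunctionSpace

/-! ### Step functions and partitions into cells. -/

section StepFunctions

variable {ι : Type*}

open Classical in
/-- The function equal to `V i` on `B i` and to `0` outside the union of the `B i`. -/
def stepFun (B : ι → Set ℝ) (V : ι → ℝ) (t : ℝ) : ℝ :=
  if h : ∃ i, t ∈ B i then V h.choose else 0

theorem stepFun_of_mem {B : ι → Set ℝ} (hd : Pairwise (Function.onFun Disjoint B)) (V : ι → ℝ)
    {i : ι} {t : ℝ} (ht : t ∈ B i) : stepFun B V t = V i := by
  have h : ∃ i, t ∈ B i := ⟨i, ht⟩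
  rw [stepFun, dif_pos h]
  congr 1
  by_contra hne
  exact Set.disjoint_left.1 (hd hne) h.choose_spec ht

theorem stepFun_of_notMem {B : ι → Set ℝ} (V : ι → ℝ) {t : ℝ} (ht : ∀ i, t ∉ B i) :
    stepFun B V t = 0 := dif_neg fun ⟨i, hi⟩ => ht i hi

/-- The condition F(0) = 0 disposes of the points outside all cells. -/
theorem comp_stepFun {B : ι → Set ℝ} (hd : Pairwise (Function.onFun Disjoint B)) (V : ι → ℝ)
    {F : ℝ → ℝ≥0∞} (hF : F 0 = 0) (t : ℝ) :
    F (stepFun B V t) = ∑' i, (B i).indicator (fun _ => F (V i)) t := by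
  by_cases h : ∃ i, t ∈ B i
  · obtain ⟨i, hi⟩ := h
    rw [stepFun_of_mem hd V hi, tsum_eq_single i fun j hj => indicator_of_notMem
      (fun hj' => Set.disjoint_left.1 (hd hj) hj' hi) _, indicator_of_mem hi]
  · push Not at h
    rw [stepFun_of_notMem V h, hF]
    simp [h]

theorem measurable_stepFun [Countable ι] {B : ι → Set ℝ} (hB : ∀ i, MeasurableSet (B i))
    (hd : Pairwise (Function.onFun Disjoint B)) (V : ι → ℝ) : Measurable (stepFun B V) := by
  classical
  intro U _
  have : stepFun B V ⁻¹' U =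
      (⋃ i, if V i ∈ U then B i else ∅) ∪ (if (0 : ℝ) ∈ U then (⋃ i, B i)ᶜ else ∅) := by
    ext t
    by_cases h : ∃ i, t ∈ B i
    · obtain ⟨i, hi⟩ := h
      have hi' : t ∉ (if (0 : ℝ) ∈ U then (⋃ i, B i)ᶜ else ∅) := by
        split_ifs
        · exact fun h' => h' (mem_iUnion.2 ⟨i, hi⟩)
        · exact fun h' => h'
      rw [mem_preimage, stepFun_of_mem hd V hi, mem_union, or_iff_left hi', mem_iUnion]
      constructor
      · intro h
        exact ⟨i, by rwa [if_pos h]⟩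
      · rintro ⟨j, hj⟩
        split_ifs at hj with h'
        · have : j = i := by
            by_contra hne
            exact Set.disjoint_left.1 (hd hne) hj hi
          rwa [← this]
        · exact absurd hj (notMem_empty _)
    · push Not at h
      rw [mem_preimage, stepFun_of_notMem V h, mem_union, mem_iUnion, or_iff_right]
      · split_ifs with h0
        · simp [h0, h]
        · simp [h0]
      · rintro ⟨i, hi⟩
        split_ifs at hi
        · exact h i hi
        · exact hi
  rw [this]
  refine (MeasurableSet.iUnion fun i => ?_).union ?_
  · split_ifs
    exacts [hB i, MeasurableSet.empty]
  · split_ifs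
    exacts [(MeasurableSet.iUnion hB).compl, MeasurableSet.empty]

theorem lintegral_comp_stepFun [Countable ι] {B : ι → Set ℝ} (hB : ∀ i, MeasurableSet (B i))
    (hd : Pairwise (Function.onFun Disjoint B)) (V : ι → ℝ) {F : ℝ → ℝ≥0∞} (hF : F 0 = 0) :
    ∫⁻ t, F (stepFun B V t) ∂leb = ∑' i, F (V i) * leb (B i) := by
  rw [lintegral_congr (comp_stepFun hd V hF),
    lintegral_tsum fun i => (measurable_const.indicator (hB i)).aemeasurable]
  simp_rw [lintegral_indicator_const (hB _)]

end StepFunctions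

/-- A partition of the set of positivity of `z` into cells of finite measure on which `z` is almost
constant. -/
theorem exists_cells {z : ℝ → ℝ} (hz : Measurable z) {b : ℝ} (hb : 1 < b) :
    ∃ A : ℕ × ℤ → Set ℝ, (∀ i, MeasurableSet (A i)) ∧ Pairwise (Function.onFun Disjoint A) ∧
      (∀ i, leb (A i) < ∞) ∧ (∀ t, 0 < t → 0 < z t → ∃ i, t ∈ A i) ∧
      ∀ i, ∀ t ∈ A i, ∀ t' ∈ A i, 0 < z t ∧ z t ≤ b * z t' := by
  have hfl : Measurable fun t : ℝ => ⌊t⌋₊ := Nat.measurable_floor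
  have hlog : Measurable fun t : ℝ => ⌊Real.logb b (z t)⌋ :=
    Int.measurable_floor.comp ((Real.measurable_log.comp hz).div_const _)
  -- The first index is the unit interval, which keeps the measure finite; the second is the integer
  -- part of log_b z, which bounds the oscillation by the factor b.
  refine ⟨fun i => {t | 0 < z t} ∩ ({t | ⌊t⌋₊ = i.1} ∩ {t | ⌊Real.logb b (z t)⌋ = i.2}),
    fun i => (measurableSet_lt measurable_const hz).inter
      ((hfl (measurableSet_singleton i.1)).inter (hlog (measurableSet_singleton i.2))),
    fun i j hij => ?_, fun i => ?_, fun t _ h => ⟨(⌊t⌋₊, ⌊Real.logb b (z t)⌋), h, rfl, rfl⟩, ?_⟩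
  · refine Set.disjoint_left.2 fun t h1 h2 => hij (Prod.ext ?_ ?_)
    · exact h1.2.1.symm.trans h2.2.1
    · exact h1.2.2.symm.trans h2.2.2
  · refine (measure_mono fun t ht => ?_).trans_lt
      ((leb_Iic_le ((i.1 : ℝ) + 1)).trans_lt ENNReal.ofReal_lt_top)
    have h1 : ⌊t⌋₊ = i.1 := ht.2.1
    have := Nat.lt_floor_add_one t
    rw [h1] at this
    exact this.le
  · rintro i t ⟨h0, -, h1⟩ t' ⟨h0', -, h1'⟩
    have h2 : ⌊Real.logb b (z t)⌋ = i.2 := h1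
    have h2' : ⌊Real.logb b (z t')⌋ = i.2 := h1'
    have h0 : 0 < z t := h0
    have h0' : 0 < z t' := h0'
    refine ⟨h0, (Real.logb_le_logb hb h0 (by positivity)).1 ?_⟩
    rw [Real.logb_mul (by positivity) h0'.ne', Real.logb_self_eq_one hb]
    have h3 := Int.lt_floor_add_one (Real.logb b (z t))
    have h4 := Int.floor_le (Real.logb b (z t'))
    rw [h2] at h3
    rw [h2'] at h4
    linarith

/-- A set of finite measure splits into `M` pieces of equal measure. -/
theorem exists_equal_split {A : Set ℝ} (hA : MeasurableSet A) (hfin : leb A < ∞) {M : ℕ}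
    (hM : 0 < M) :
    ∃ B : Fin M → Set ℝ, (∀ k, MeasurableSet (B k)) ∧ Pairwise (Function.onFun Disjoint B) ∧
      (∀ k, B k ⊆ A) ∧ (∀ k, leb (B k) = ENNReal.ofReal ((leb A).toReal / M)) ∧
      ∀ᵐ t ∂leb, t ∈ A → ∃ k, t ∈ B k := by
  have hM0 : (0 : ℝ) < M := by exact_mod_cast hM
  set a := (leb A).toReal with ha
  have ha0 : 0 ≤ a := ENNReal.toReal_nonneg
  have ha' : ENNReal.ofReal a = leb A := ENNReal.ofReal_toReal hfin.ne
  have hc := (continuous_cumul A).measurable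
  have hlev : ∀ v, 0 ≤ v → v ≤ a → leb (A ∩ {t | cumul A t ≤ v}) = ENNReal.ofReal v :=
    fun v hv hva => by
      rw [leb_inter_cumul_le A hv, ← ha', min_eq_left (ENNReal.ofReal_le_ofReal hva)]
  have hmle : ∀ v, MeasurableSet (A ∩ {t | cumul A t ≤ v}) := fun v =>
    hA.inter (measurableSet_le hc measurable_const)
  -- The pieces are cut out by equal consecutive windows of values of `cumul A`.
  refine ⟨fun k => A ∩ {t | ((k : ℕ) : ℝ) * (a / M) < cumul A t ∧
      cumul A t ≤ (((k : ℕ) : ℝ) + 1) * (a / M)}, fun k => hA.inter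
      ((measurableSet_lt measurable_const hc).inter (measurableSet_le hc measurable_const)),
    fun i j hij => ?_, fun k => inter_subset_left, fun k => ?_, ?_⟩
  · refine Set.disjoint_left.2 fun t h1 h2 => hij (Fin.ext ?_)
    have key : ∀ i j : ℕ, (i : ℝ) * (a / M) < cumul A t → cumul A t ≤ ((j : ℝ) + 1) * (a / M) →
        i ≤ j := fun i j h3 h4 => by
      by_contra hc
      have h5 : (j : ℝ) + 1 ≤ i := by exact_mod_cast not_le.1 hc
      have : ((j : ℝ) + 1) * (a / M) ≤ i * (a / M) := by gcongr
      linarith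
    exact le_antisymm (key _ _ h1.2.1 h2.2.2) (key _ _ h2.2.1 h1.2.2)
  · have hk : ((k : ℕ) : ℝ) + 1 ≤ M := by exact_mod_cast k.2
    have hset : A ∩ {t | ((k : ℕ) : ℝ) * (a / M) < cumul A t ∧
        cumul A t ≤ (((k : ℕ) : ℝ) + 1) * (a / M)} =
        (A ∩ {t | cumul A t ≤ (((k : ℕ) : ℝ) + 1) * (a / M)}) \
          (A ∩ {t | cumul A t ≤ ((k : ℕ) : ℝ) * (a / M)}) := by
      ext t
      simp only [mem_inter_iff, mem_ofPred_eq, Set.mem_sdiff, not_and, not_le]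
      tauto
    have hle1 : (((k : ℕ) : ℝ) + 1) * (a / M) ≤ a := by
      rw [← mul_div_assoc, div_le_iff₀ hM0, mul_comm]
      gcongr
    have hstep : ((k : ℕ) : ℝ) * (a / M) ≤ (((k : ℕ) : ℝ) + 1) * (a / M) := by
      gcongr; linarith
    have hsub : A ∩ {t | cumul A t ≤ ((k : ℕ) : ℝ) * (a / M)} ⊆
        A ∩ {t | cumul A t ≤ (((k : ℕ) : ℝ) + 1) * (a / M)} :=
      inter_subset_inter_right _ fun t (ht : _ ≤ _) => ht.trans hstep
    refine (congrArg leb hset).trans ?_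
    rw [measure_sdiff hsub (hmle _).nullMeasurableSet
      ((measure_mono inter_subset_left).trans_lt hfin).ne, hlev _ (by positivity) hle1,
      hlev _ (by positivity) (hstep.trans hle1), ← ENNReal.ofReal_sub _ (by positivity)]
    congr 1
    ring
  · have h0 : leb (A ∩ {t | cumul A t ≤ 0}) = 0 := by rw [hlev 0 le_rfl ha0]; simp
    filter_upwards [measure_eq_zero_iff_ae_notMem.1 h0] with t ht htA
    have hpos : 0 < cumul A t := not_le.1 fun h => ht ⟨htA, h⟩
    have hle : cumul A t ≤ a := by
      refine cumul_le_of_leb_le ha'.ge ha0 t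
    have ha00 : 0 < a := hpos.trans_le hle
    have hη : 0 < a / M := by positivity
    obtain ⟨n, hn⟩ : ∃ n : ℕ, cumul A t ≤ ((n : ℝ) + 1) * (a / M) := by
      refine ⟨M, hle.trans ?_⟩
      rw [← mul_div_assoc, le_div_iff₀ hM0]
      nlinarith
    classical
    have hspec := Nat.find_spec (⟨n, hn⟩ : ∃ n : ℕ, cumul A t ≤ ((n : ℝ) + 1) * (a / M))
    set m := Nat.find (⟨n, hn⟩ : ∃ n : ℕ, cumul A t ≤ ((n : ℝ) + 1) * (a / M)) with hm
    have hmin : ∀ j < m, ¬ cumul A t ≤ ((j : ℝ) + 1) * (a / M) := fun j hj => Nat.find_min _ hj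
    have hlow : (m : ℝ) * (a / M) < cumul A t := by
      rcases Nat.eq_zero_or_pos m with h | h
      · rw [h]; simpa using hpos
      · have := not_le.1 (hmin (m - 1) (by omega))
        have h' : ((m - 1 : ℕ) : ℝ) + 1 = m := by
          exact_mod_cast Nat.sub_add_cancel h
        rwa [h'] at this
    have hmM : m < M := by
      by_contra hc
      have : (M : ℝ) ≤ m := by exact_mod_cast not_lt.1 hc
      have h1 : (M : ℝ) * (a / M) ≤ m * (a / M) := by gcongr
      rw [mul_div_cancel₀ _ hM0.ne'] at h1
      linarith
    exact ⟨⟨m, hmM⟩, htA, hlow, hspec⟩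

/-! ### Substochastic operators and their integrals over cells. -/

theorem mem_L1Linf_of_abs_le {u v : L0} (hv : v ∈ L1Linf) (h : ∀ᵐ t ∂leb, |u t| ≤ |v t|) :
    u ∈ L1Linf := by
  obtain ⟨s, hs, hs'⟩ := exists_excess_lt_top hv
  exact mem_L1Linf_of_excess hs ((excess_mono h s).trans_lt hs')

theorem integrableOn_of_mem_L1Linf {u : L0} (hu : u ∈ L1Linf) {A : Set ℝ} (hA : leb A < ∞) :
    IntegrableOn u A leb := by
  obtain ⟨a, ha, c, hc, rfl⟩ := Submodule.mem_sup.1 hu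
  have h1 : IntegrableOn a A leb := by
    have : MemLp a 1 leb := ⟨a.aestronglyMeasurable, ha⟩
    exact (memLp_one_iff_integrable.1 this).integrableOn
  have h2 : IntegrableOn c A leb := by
    have : MemLp c ∞ leb := ⟨c.aestronglyMeasurable, hc⟩
    have : MemLp c ∞ (leb.restrict A) := this.restrict A
    have hfin : IsFiniteMeasure (leb.restrict A) := ⟨by simpa using hA⟩
    exact this.integrable le_top
  exact (h1.add h2).congr (ae_restrict_of_ae (AEEqFun.coeFn_add a c).symm)

/-- The excess part `(f - s)₊`. -/
def posExcess (u : L0) (s : ℝ) : L0 :=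
  ofFun (fun t => max (u t - s) 0) ((u.measurable.sub_const s).max measurable_const)

theorem coe_posExcess (u : L0) (s : ℝ) :
    posExcess u s =ᵐ[leb] fun t => max (u t - s) 0 := coe_ofFun _ _

theorem posExcess_nonneg (u : L0) (s : ℝ) : 0 ≤ posExcess u s :=
  nonneg_iff_ae.2 ((coe_posExcess u s).mono fun t ht => by rw [ht]; exact le_max_right _ _)

theorem posExcess_mem {u : L0} (hu : u ∈ L1Linf) (hu0 : 0 ≤ u) {s : ℝ}
    (hs : 0 ≤ s) : posExcess u s ∈ L1Linf := by
  refine mem_L1Linf_of_abs_le hu ?_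
  filter_upwards [coe_posExcess u s, nonneg_iff_ae.1 hu0] with t h1 h2
  rw [h1, abs_of_nonneg (le_max_right _ _), abs_of_nonneg h2]
  exact max_le (by linarith) h2

theorem lintegral_posExcess {u : L0} (hu0 : 0 ≤ u) {s : ℝ} (hs : 0 ≤ s) :
    ∫⁻ t, ENNReal.ofReal (posExcess u s t) ∂leb = excess u (ENNReal.ofReal s) := by
  refine lintegral_congr_ae ?_
  filter_upwards [coe_posExcess u s, nonneg_iff_ae.1 hu0] with t h1 h2
  rw [h1, abs_of_nonneg h2, ← ENNReal.ofReal_sub _ hs, ENNReal.ofReal_max, ENNReal.ofReal_zero,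
    max_eq_left zero_le]

/-- The functional `f ↦ ∫_A T f`. -/
def intOn (T : L1Linf →ₗ[ℝ] L1Linf) (A : Set ℝ) (f : L1Linf) : ℝ :=
  ∫ t in A, (T f : L0) t ∂leb

theorem intOn_add (T : L1Linf →ₗ[ℝ] L1Linf) {A : Set ℝ} (hA : leb A < ∞)
    (f g : L1Linf) : intOn T A (f + g) = intOn T A f + intOn T A g := by
  rw [intOn, intOn, intOn, ← integral_add (integrableOn_of_mem_L1Linf (T f).2 hA)
    (integrableOn_of_mem_L1Linf (T g).2 hA)]
  refine integral_congr_ae (ae_restrict_of_ae ?_)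
  rw [map_add]
  exact AEEqFun.coeFn_add _ _

theorem intOn_smul (T : L1Linf →ₗ[ℝ] L1Linf) (A : Set ℝ) (c : ℝ)
    (f : L1Linf) : intOn T A (c • f) = c * intOn T A f := by
  rw [intOn, intOn, ← integral_const_mul]
  refine integral_congr_ae (ae_restrict_of_ae ?_)
  rw [map_smul]
  exact AEEqFun.coeFn_smul _ _

theorem intOn_sum (T : L1Linf →ₗ[ℝ] L1Linf) {A : Set ℝ} (hA : leb A < ∞)
    {ι : Type*} (s : Finset ι) (f : ι → L1Linf) :
    intOn T A (∑ i ∈ s, f i) = ∑ i ∈ s, intOn T A (f i) := by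
  classical
  induction s using Finset.induction_on with
  | empty =>
    have := intOn_smul T A 0 0
    simpa using this
  | insert a s ha ih => rw [Finset.sum_insert ha, Finset.sum_insert ha, intOn_add T hA, ih]

namespace IsSubstochastic

variable {T : L1Linf →ₗ[ℝ] L1Linf}

theorem mono (hT : IsSubstochastic T) {f g : L1Linf} (h : (f : L0) ≤ g) :
    (T f : L0) ≤ T g := by
  have h1 := nonneg_iff_ae.1 (hT.nonneg (g - f) (nonneg_iff_ae.2 ?_))
  · rw [map_sub, AddSubgroupClass.coe_sub] at h1
    rw [← AEEqFun.coeFn_le]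
    filter_upwards [h1, AEEqFun.coeFn_sub (T g : L0) (T f)] with t h2 h3
    rw [h3, Pi.sub_apply] at h2
    linarith
  · rw [AddSubgroupClass.coe_sub]
    filter_upwards [AEEqFun.coeFn_le.2 h, AEEqFun.coeFn_sub (g : L0) f] with t h2 h3
    rw [h3, Pi.sub_apply]
    linarith

theorem le_const (hT : IsSubstochastic T) {f : L1Linf} {s : ℝ} (hs : 0 ≤ s)
    (h : ∀ᵐ t ∂leb, (f : L0) t ≤ s) : ∀ᵐ t ∂leb, (T f : L0) t ≤ s := by
  set k : L0 := ofFun (fun _ => s) measurable_const with hk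
  have hkc : k =ᵐ[leb] fun _ => s := coe_ofFun _ _
  have hkm : k ∈ Linf := mem_Linf_of_ae_le (s := s) (hkc.mono fun t ht => by
    rw [ht, abs_of_nonneg hs])
  set K : L1Linf := ⟨k, Submodule.mem_sup_right hkm⟩ with hK
  have h1 : (f : L0) ≤ K := by
    rw [← AEEqFun.coeFn_le]
    filter_upwards [h, hkc] with t h1 h2
    exact h1.trans h2.ge
  have h2 := hT.contr_Linf K hkm
  have h3 : eLpNorm k ∞ leb ≤ ENNReal.ofReal s := by
    rw [eLpNorm_exponent_top]
    refine eLpNormEssSup_le_of_ae_bound (hkc.mono fun t ht => ?_)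
    rw [ht, Real.norm_of_nonneg hs]
  have h4 := AEEqFun.coeFn_le.2 (hT.mono h1)
  filter_upwards [h4, ae_le_of_mem_Linf h2.1] with t h5 h6
  refine h5.trans ((le_abs_self _).trans (h6.trans ?_))
  exact ENNReal.toReal_le_of_le_ofReal hs (h2.2.trans h3)

theorem lintegral_le (hT : IsSubstochastic T) {f : L1Linf} (hf : 0 ≤ (f : L0)) :
    ∫⁻ t, ENNReal.ofReal ((T f : L0) t) ∂leb ≤ ∫⁻ t, ENNReal.ofReal ((f : L0) t) ∂leb := by
  have h0 := nonneg_iff_ae.1 hf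
  have h0' := nonneg_iff_ae.1 (hT.nonneg f hf)
  have e1 : ∫⁻ t, ENNReal.ofReal ((f : L0) t) ∂leb = eLpNorm (f : L0) 1 leb := by
    rw [eLpNorm_one_eq]
    exact lintegral_congr_ae (h0.mono fun t ht => by simp only [abs_of_nonneg ht])
  have e2 : ∫⁻ t, ENNReal.ofReal ((T f : L0) t) ∂leb = eLpNorm (T f : L0) 1 leb := by
    rw [eLpNorm_one_eq]
    exact lintegral_congr_ae (h0'.mono fun t ht => by simp only [abs_of_nonneg ht])
  rw [e1, e2]
  rcases eq_or_ne (eLpNorm (f : L0) 1 leb) ∞ with h | h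
  · rw [h]; exact le_top
  · exact (hT.contr_L1 f h.lt_top).2

/-- With R = (f - s)₊ one has f - R ≤ s, hence Tf ≤ s + TR by the L_∞ bound, so (Tf - s)₊ ≤ TR. The
L₁ bound for R concludes. -/
theorem excess_le (hT : IsSubstochastic T) {f : L1Linf} (hf : 0 ≤ (f : L0)) (s : ℝ≥0∞) :
    excess (T f) s ≤ excess f s := by
  rcases eq_or_ne s ∞ with rfl | hs
  · simp [excess]
  have hs0 : 0 ≤ s.toReal := ENNReal.toReal_nonneg
  have hs' : ENNReal.ofReal s.toReal = s := ENNReal.ofReal_toReal hs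
  set R : L1Linf := ⟨posExcess f s.toReal, posExcess_mem f.2 hf hs0⟩ with hR
  have hRc := coe_posExcess (f : L0) s.toReal
  have h1 : ∀ᵐ t ∂leb, ((f - R : L1Linf) : L0) t ≤ s.toReal := by
    filter_upwards [hRc, AEEqFun.coeFn_sub (f : L0) R] with t h2 h3
    rw [AddSubgroupClass.coe_sub, h3, Pi.sub_apply, h2]
    linarith [le_max_left ((f : L0) t - s.toReal) 0]
  have h2 := hT.le_const hs0 h1
  rw [← hs', ← lintegral_posExcess hf hs0]
  refine le_trans (lintegral_mono_ae ?_) (hT.lintegral_le (f := R) (posExcess_nonneg _ _))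
  have h0' := nonneg_iff_ae.1 (hT.nonneg f hf)
  rw [map_sub] at h2
  filter_upwards [h2, h0', AEEqFun.coeFn_sub (T f : L0) (T R)] with t h3 h4 h5
  rw [AddSubgroupClass.coe_sub, h5, Pi.sub_apply] at h3
  rw [abs_of_nonneg h4, ← ENNReal.ofReal_sub _ hs0]
  exact ENNReal.ofReal_le_ofReal (by linarith)

theorem intOn_mono (hT : IsSubstochastic T) {A : Set ℝ} (hA : leb A < ∞) {f g : L1Linf}
    (h : (f : L0) ≤ g) : intOn T A f ≤ intOn T A g :=
  integral_mono_ae (integrableOn_of_mem_L1Linf (T f).2 hA) (integrableOn_of_mem_L1Linf (T g).2 hA)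
    (ae_restrict_of_ae (AEEqFun.coeFn_le.2 (hT.mono h)))

theorem intOn_le_const (hT : IsSubstochastic T) {A : Set ℝ} (hA : leb A < ∞) {f : L1Linf} {s : ℝ}
    (hs : 0 ≤ s) (h : ∀ᵐ t ∂leb, (f : L0) t ≤ s) : intOn T A f ≤ s * (leb A).toReal := by
  have h1 : intOn T A f ≤ ∫ _ in A, s ∂leb :=
    integral_mono_ae (integrableOn_of_mem_L1Linf (T f).2 hA)
      (integrableOn_const hA.ne) (ae_restrict_of_ae (hT.le_const hs h))
  rw [setIntegral_const, smul_eq_mul, mul_comm] at h1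
  exact h1

theorem intOn_nonneg (hT : IsSubstochastic T) (A : Set ℝ) {f : L1Linf} (h : 0 ≤ (f : L0)) :
    0 ≤ intOn T A f :=
  integral_nonneg_of_ae (ae_restrict_of_ae (nonneg_iff_ae.1 (hT.nonneg f h)))

theorem ofReal_intOn (hT : IsSubstochastic T) {A : Set ℝ} (hA : leb A < ∞) {f : L1Linf}
    (h : 0 ≤ (f : L0)) :
    ENNReal.ofReal (intOn T A f) = ∫⁻ t in A, ENNReal.ofReal ((T f : L0) t) ∂leb :=
  ofReal_integral_eq_lintegral_ofReal (integrableOn_of_mem_L1Linf (T f).2 hA)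
    (ae_restrict_of_ae (nonneg_iff_ae.1 (hT.nonneg f h)))

theorem tsum_ofReal_intOn_le (hT : IsSubstochastic T) {ι : Type*} [Countable ι] {A : ι → Set ℝ}
    (hA : ∀ i, MeasurableSet (A i)) (hd : Pairwise (Function.onFun Disjoint A))
    (hfin : ∀ i, leb (A i) < ∞) {f : L1Linf} (h : 0 ≤ (f : L0)) :
    ∑' i, ENNReal.ofReal (intOn T (A i) f) ≤ ∫⁻ t, ENNReal.ofReal ((f : L0) t) ∂leb := by
  simp_rw [hT.ofReal_intOn (hfin _) h]
  rw [← lintegral_iUnion hA hd]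
  exact (lintegral_mono' Measure.restrict_le_self le_rfl).trans (hT.lintegral_le h)

end IsSubstochastic

/-! ### Quantiles of a substochastic operator on a cell. -/

/-- The truncation of `x` from below at the level `x* (∞)`. -/
def topped (x : L0) : L0 :=
  ofFun (fun t => max (x t) (rearrTop x).toReal) (x.measurable.max measurable_const)

theorem coe_topped (x : L0) : topped x =ᵐ[leb] fun t => max (x t) (rearrTop x).toReal :=
  coe_ofFun _ _

theorem topped_nonneg (x : L0) : 0 ≤ topped x :=
  nonneg_iff_ae.2 ((coe_topped x).mono fun t ht => by
    rw [ht]; exact ENNReal.toReal_nonneg.trans (le_max_right _ _))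

/-- Below x*(∞) both values are infinite; at and above it, raising the small values is invisible.
Thus x is dominated by a function with the same distribution. -/
theorem distr_topped {x : L0} (hx : x ∈ S0) (hx0 : 0 ≤ x) (s : ℝ≥0∞) :
    distr (topped x) s = distr x s := by
  have hc := ENNReal.ofReal_toReal (rearrTop_lt_top hx).ne
  rcases lt_or_ge s (rearrTop x) with h | h
  · rw [distr_eq_top_of_lt h]
    refine top_unique ?_
    rw [← distr_eq_top_of_lt h]
    refine distr_mono ?_ s
    filter_upwards [coe_topped x, nonneg_iff_ae.1 hx0] with t h1 h2
    rw [h1, abs_of_nonneg h2]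
    exact (le_max_left _ _).trans (le_abs_self _)
  · refine measure_congr ?_
    filter_upwards [coe_topped x, nonneg_iff_ae.1 hx0] with t h1 h2
    refine propext ?_
    change s < ENNReal.ofReal |topped x t| ↔ s < ENNReal.ofReal |x t|
    rw [h1, abs_of_nonneg h2, abs_of_nonneg (h2.trans (le_max_left _ _)), ENNReal.ofReal_max, hc,
      lt_max_iff, or_iff_left (not_lt.2 h)]

theorem excess_topped {x : L0} (hx : x ∈ S0) (hx0 : 0 ≤ x) (s : ℝ≥0∞) :
    excess (topped x) s = excess x s := by
  rw [excess_eq_lintegral_distr, excess_eq_lintegral_distr]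
  simp_rw [distr_topped hx hx0]

theorem topped_mem {x : L0} (hx : x ∈ S0) (hx0 : 0 ≤ x) (h : x ∈ L1Linf) :
    topped x ∈ L1Linf := by
  obtain ⟨s, hs, hs'⟩ := exists_excess_lt_top h
  exact mem_L1Linf_of_excess hs (by rwa [excess_topped hx hx0])

/-- The indicator function of `{x > s}`. -/
def levelInd (x : L0) (s : ℝ) : L0 :=
  ofFun ({t | s < x t}.indicator 1)
    (measurable_one.indicator (measurableSet_lt measurable_const x.measurable))

theorem coe_levelInd (x : L0) (s : ℝ) : levelInd x s =ᵐ[leb] {t | s < x t}.indicator 1 :=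
  coe_ofFun _ _

theorem levelInd_nonneg (x : L0) (s : ℝ) : 0 ≤ levelInd x s :=
  nonneg_iff_ae.2 ((coe_levelInd x s).mono fun t ht => by
    rw [ht]; exact indicator_nonneg (fun _ _ => zero_le_one) _)

theorem levelInd_le_one (x : L0) (s : ℝ) : ∀ᵐ t ∂leb, levelInd x s t ≤ 1 :=
  (coe_levelInd x s).mono fun t ht => by
    rw [ht]; exact indicator_le_self' (fun _ _ => zero_le_one) _

theorem levelInd_mem (x : L0) (s : ℝ) : levelInd x s ∈ L1Linf := by
  refine Submodule.mem_sup_right (mem_Linf_of_ae_le (s := 1) ?_)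
  filter_upwards [levelInd_le_one x s, nonneg_iff_ae.1 (levelInd_nonneg x s)] with t h1 h2
  rwa [abs_of_nonneg h2]

/-- `levelInd` as an element of `L₁ + L_∞`. -/
def level (x : L0) (s : ℝ) : L1Linf := ⟨levelInd x s, levelInd_mem x s⟩

theorem level_antitone (x : L0) {s s' : ℝ} (h : s ≤ s') : (level x s' : L0) ≤ level x s := by
  rw [← AEEqFun.coeFn_le]
  filter_upwards [coe_levelInd x s, coe_levelInd x s'] with t h1 h2
  change levelInd x s' t ≤ levelInd x s t
  rw [h1, h2]
  exact indicator_le_indicator_of_subset (fun t ht => lt_of_le_of_lt h ht)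
    (fun _ => zero_le_one) t

theorem lintegral_level {x : L0} (hx0 : 0 ≤ x) {s : ℝ} (hs : 0 ≤ s) :
    ∫⁻ t, ENNReal.ofReal ((level x s : L0) t) ∂leb = distr x (ENNReal.ofReal s) := by
  have hm : MeasurableSet {t | ENNReal.ofReal s < ENNReal.ofReal |x t|} :=
    measurableSet_lt measurable_const (measurable_ofReal_abs x)
  rw [distr, ← lintegral_indicator_one hm]
  refine lintegral_congr_ae ?_
  filter_upwards [coe_levelInd x s, nonneg_iff_ae.1 hx0] with t h1 h2
  change ENNReal.ofReal (levelInd x s t) = _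
  rw [h1]
  have hiff : s < x t ↔ ENNReal.ofReal s < ENNReal.ofReal |x t| := by
    rw [abs_of_nonneg h2, ENNReal.ofReal_lt_ofReal_iff']
    exact ⟨fun h => ⟨h, hs.trans_lt h⟩, fun h => h.1⟩
  by_cases h : s < x t
  · rw [indicator_of_mem (show t ∈ {t | s < x t} from h), indicator_of_mem
      (show t ∈ {t | ENNReal.ofReal s < ENNReal.ofReal |x t|} from hiff.1 h)]
    simp
  · rw [indicator_of_notMem (show t ∉ {t | s < x t} from h), indicator_of_notMem
      (show t ∉ {t | ENNReal.ofReal s < ENNReal.ofReal |x t|} from fun h' => h (hiff.2 h'))]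
    simp

/-- The quantile of order `v` of the functional `f ↦ ∫_A T f` with respect to `x`, truncated from
below at `c`. -/
def quantile (T : L1Linf →ₗ[ℝ] L1Linf) (A : Set ℝ) (x : L0) (c v : ℝ) : ℝ :=
  sInf {s | c ≤ s ∧ intOn T A (level x s) ≤ v}

namespace IsSubstochastic

variable {T : L1Linf →ₗ[ℝ] L1Linf}

theorem intOn_level_le (hT : IsSubstochastic T) {A : Set ℝ} (hA : leb A < ∞) (x : L0) (s : ℝ) :
    intOn T A (level x s) ≤ (leb A).toReal := by
  have := hT.intOn_le_const hA (f := level x s) zero_le_one (levelInd_le_one x s)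
  rwa [one_mul] at this

/-- For v > 0 the L₁ bound makes the functional at most `distr x s`, which is below v for s large.
The alternative covers null cells, where every quantile order used is 0. -/
theorem quantile_set_nonempty (hT : IsSubstochastic T) {A : Set ℝ} (hA : leb A < ∞) {x : L0}
    (hx0 : 0 ≤ x) (hx : x ∈ S0) {c v : ℝ} (hc : 0 ≤ c) (hv : 0 < v ∨ leb A = 0 ∧ v = 0) :
    {s | c ≤ s ∧ intOn T A (level x s) ≤ v}.Nonempty := by
  rcases hv with hv | ⟨h1, h2⟩
  · obtain ⟨s, hs, h⟩ := exists_distr_lt hx (ENNReal.ofReal_pos.2 hv)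
    refine ⟨max c s.toReal, le_max_left _ _, ?_⟩
    have h0 : 0 ≤ max c s.toReal := hc.trans (le_max_left _ _)
    rw [← ENNReal.ofReal_le_ofReal_iff hv.le, hT.ofReal_intOn hA (levelInd_nonneg _ _)]
    refine (lintegral_mono' Measure.restrict_le_self le_rfl).trans
      ((hT.lintegral_le (levelInd_nonneg _ _)).trans ?_)
    rw [lintegral_level hx0 h0]
    refine (distr_antitone x ?_).trans h.le
    exact (ENNReal.ofReal_toReal hs.ne).ge.trans (ENNReal.ofReal_le_ofReal (le_max_right _ _))
  · refine ⟨c, le_rfl, ?_⟩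
    have := hT.intOn_level_le hA x c
    rwa [h1, ENNReal.toReal_zero, ← h2] at this

theorem le_quantile (hT : IsSubstochastic T) {A : Set ℝ} (hA : leb A < ∞) {x : L0}
    (hx0 : 0 ≤ x) (hx : x ∈ S0) {c v : ℝ} (hc : 0 ≤ c) (hv : 0 < v ∨ leb A = 0 ∧ v = 0) :
    c ≤ quantile T A x c v :=
  le_csInf (hT.quantile_set_nonempty hA hx0 hx hc hv) fun _ hs => hs.1

/-- This and `lt_of_lt_quantile` say that the quantile is the generalized inverse of the decreasing
function s ↦ ∫_A Tχ_{x > s}. -/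
theorem le_quantile_of_lt (hT : IsSubstochastic T) {A : Set ℝ} (hA : leb A < ∞) {x : L0}
    (hx0 : 0 ≤ x) (hx : x ∈ S0) {c v s : ℝ} (hc : 0 ≤ c) (hv : 0 < v ∨ leb A = 0 ∧ v = 0)
    (h : v < intOn T A (level x s)) : s ≤ quantile T A x c v := by
  refine le_csInf (hT.quantile_set_nonempty hA hx0 hx hc hv) fun r hr => ?_
  by_contra hlt
  have := hT.intOn_mono hA (level_antitone x (not_le.1 hlt).le)
  linarith [hr.2]

theorem lt_of_lt_quantile {A : Set ℝ} {x : L0} {c v s : ℝ} (hcs : c ≤ s)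
    (h : s < quantile T A x c v) : v < intOn T A (level x s) := by
  by_contra hc
  have hb : BddBelow {s | c ≤ s ∧ intOn T A (level x s) ≤ v} := ⟨c, fun r hr => hr.1⟩
  exact absurd (csInf_le hb ⟨hcs, not_lt.1 hc⟩) (not_le.2 h)

/-- With δ = (s - c)/K, the function x is at most c + δ + (x - s)₊ plus δ times the sum of the
indicators of {x > c + (k + 1)δ}, k < K; the positive functional is applied to this. -/
theorem intOn_le_riemann (hT : IsSubstochastic T) {A : Set ℝ} (hA : leb A < ∞) {x : L1Linf}
    (hx0 : 0 ≤ (x : L0)) {c s : ℝ} (hc : 0 ≤ c) (hcs : c ≤ s) {K : ℕ} (hK : 0 < K) :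
    intOn T A x ≤ intOn T A ⟨posExcess x s, posExcess_mem x.2 hx0 (hc.trans hcs)⟩ +
      (c + (s - c) / K) * (leb A).toReal +
      ∑ k ∈ Finset.range K, (s - c) / K * intOn T A (level x (c + ((k : ℝ) + 1) * ((s - c) / K))) := by
  set δ := (s - c) / K with hδ
  have hK0 : (0 : ℝ) < K := by exact_mod_cast hK
  have hδ0 : 0 ≤ δ := div_nonneg (by linarith) hK0.le
  have hKδ : K * δ = s - c := by rw [hδ, mul_div_cancel₀ _ hK0.ne']
  set R : L1Linf := ⟨posExcess x s, posExcess_mem x.2 hx0 (hc.trans hcs)⟩ with hR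
  set S : L1Linf := ∑ k ∈ Finset.range K, δ • level x (c + ((k : ℝ) + 1) * δ) with hS
  have hScoe : ∀ᵐ t ∂leb, (S : L0) t =
      ∑ k ∈ Finset.range K, (if ((k : ℝ) + 1) * δ < (x : L0) t - c then δ else 0) := by
    have h1 : (S : L0) = ofFun (fun t => ∑ k ∈ Finset.range K,
        δ * {t | c + ((k : ℝ) + 1) * δ < (x : L0) t}.indicator 1 t)
        (Finset.measurable_fun_sum _ fun k _ => (measurable_one.indicator
          (measurableSet_lt measurable_const (x : L0).measurable)).const_mul _) := by
      rw [← sum_ofFun _ (fun (k : ℕ) t => δ * {t | c + ((k : ℝ) + 1) * δ < (x : L0) t}.indicator 1 t)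
        (fun k => (measurable_one.indicator
          (measurableSet_lt measurable_const (x : L0).measurable)).const_mul _), hS,
        AddSubmonoidClass.coe_finsetSum]
      rfl
    rw [h1]
    filter_upwards [coe_ofFun (fun t => ∑ k ∈ Finset.range K,
        δ * {t | c + ((k : ℝ) + 1) * δ < (x : L0) t}.indicator 1 t)
        (Finset.measurable_fun_sum _ fun k _ => (measurable_one.indicator
          (measurableSet_lt measurable_const (x : L0).measurable)).const_mul _)] with t ht
    rw [ht]
    refine Finset.sum_congr rfl fun k _ => ?_
    by_cases h : c + ((k : ℝ) + 1) * δ < (x : L0) t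
    · rw [if_pos (lt_sub_iff_add_lt'.2 h), indicator_of_mem
        (show t ∈ {t | c + ((k : ℝ) + 1) * δ < (x : L0) t} from h)]
      simp
    · rw [if_neg fun h' => h (lt_sub_iff_add_lt'.1 h'), indicator_of_notMem
        (show t ∉ {t | c + ((k : ℝ) + 1) * δ < (x : L0) t} from h), mul_zero]
  have hle : ∀ᵐ t ∂leb, ((x - (R + S) : L1Linf) : L0) t ≤ c + δ := by
    filter_upwards [hScoe, coe_posExcess x s, AEEqFun.coeFn_sub (x : L0) (R + S : L1Linf),
      AEEqFun.coeFn_add (R : L0) S] with t h1 h2 h3 h4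
    have h5 := min_le_add_sum_ite (z := (x : L0) t - c) hδ0 K
    rw [hKδ] at h5
    rw [AddSubgroupClass.coe_sub, h3, Pi.sub_apply, Submodule.coe_add, h4, Pi.add_apply, h1]
    change _ - (posExcess x s t + _) ≤ _
    rw [h2]
    rcases le_total ((x : L0) t) s with h | h
    · rw [min_eq_left (by linarith)] at h5
      linarith [le_max_right ((x : L0) t - s) 0]
    · rw [min_eq_right (by linarith)] at h5
      linarith [le_max_left ((x : L0) t - s) 0]
  have h1 := hT.intOn_le_const hA (by linarith) hle
  have h2 : intOn T A x = intOn T A (x - (R + S)) + (intOn T A R + intOn T A S) := by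
    rw [← intOn_add T hA, ← intOn_add T hA, sub_add_cancel]
  have h3 : intOn T A S =
      ∑ k ∈ Finset.range K, δ * intOn T A (level x (c + ((k : ℝ) + 1) * δ)) := by
    rw [hS, intOn_sum T hA]
    simp_rw [intOn_smul]
  rw [h2, h3]
  linarith

/-- The integral of `T x` over `A` is controlled by the quantiles. -/
theorem intOn_le_quantiles (hT : IsSubstochastic T) {A : Set ℝ} (hA : leb A < ∞) {x : L1Linf}
    (hx0 : 0 ≤ (x : L0)) (hx : (x : L0) ∈ S0) {c s : ℝ} (hc : 0 ≤ c) (hcs : c ≤ s) {M : ℕ}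
    (hM : 0 < M) :
    intOn T A x ≤ intOn T A ⟨posExcess x s, posExcess_mem x.2 hx0 (hc.trans hcs)⟩ +
      (leb A).toReal / M * ∑ l ∈ Finset.range M,
        quantile T A x c (((l : ℝ) + 1) * ((leb A).toReal / M)) +
      s * ((leb A).toReal / M) := by
  set a := (leb A).toReal with ha
  have ha0 : 0 ≤ a := ENNReal.toReal_nonneg
  have hM0 : (0 : ℝ) < M := by exact_mod_cast hM
  set η := a / M with hη
  have hη0 : 0 ≤ η := by positivity
  have hMη : M * η = a := by rw [hη, mul_div_cancel₀ _ hM0.ne']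
  set R : L1Linf := ⟨posExcess x s, posExcess_mem x.2 hx0 (hc.trans hcs)⟩ with hR
  have hv : ∀ l : ℕ, 0 < ((l : ℝ) + 1) * η ∨ leb A = 0 ∧ ((l : ℝ) + 1) * η = 0 := fun l => by
    rcases hη0.eq_or_lt with h | h
    · right
      have ha00 : a = 0 := by rw [← hMη, ← h, mul_zero]
      refine ⟨?_, by rw [← h, mul_zero]⟩
      rw [ha, ENNReal.toReal_eq_zero_iff] at ha00
      exact ha00.resolve_right hA.ne
    · left; positivity
  set V : ℕ → ℝ := fun l => quantile T A x c (((l : ℝ) + 1) * η) with hV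
  have hVc : ∀ l, c ≤ V l := fun l => hT.le_quantile hA hx0 hx hc (hv l)
  have key : ∀ K : ℕ, 0 < K → intOn T A x ≤ intOn T A R + η * ∑ l ∈ Finset.range M, V l + s * η +
      (s - c) / K * a := fun K hK => by
    have hK0 : (0 : ℝ) < K := by exact_mod_cast hK
    set δ := (s - c) / K with hδ
    have hδ0 : 0 ≤ δ := div_nonneg (by linarith) hK0.le
    have hKδ : K * δ = s - c := by rw [hδ, mul_div_cancel₀ _ hK0.ne']
    have h1 := hT.intOn_le_riemann hA hx0 hc hcs hK
    set d : ℕ → ℝ := fun k => intOn T A (level x (c + ((k : ℝ) + 1) * δ)) with hd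
    -- A discrete Fubini argument. Each d k is rounded up to the grid of step η, at total cost (s -
    -- c)η. After interchanging the sums, the number of k with d k > (l + 1)η, times δ, is at most V
    -- l - c, because the quantile inverts d.
    have h2 : ∑ k ∈ Finset.range K, δ * d k ≤
        (s - c) * η + η * ∑ l ∈ Finset.range M, (V l - c) := by
      calc ∑ k ∈ Finset.range K, δ * d k
          ≤ ∑ k ∈ Finset.range K, δ * (η + ∑ l ∈ Finset.range M,
            (if ((l : ℝ) + 1) * η < d k then η else 0)) := by
            refine Finset.sum_le_sum fun k _ => mul_le_mul_of_nonneg_left ?_ hδ0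
            have h3 := min_le_add_sum_ite (z := d k) hη0 M
            rwa [hMη, min_eq_left (hT.intOn_level_le hA _ _)] at h3
        _ = K * δ * η + η * ∑ l ∈ Finset.range M, ∑ k ∈ Finset.range K,
            (if ((l : ℝ) + 1) * η < d k then δ else 0) := by
            simp_rw [mul_add, Finset.sum_add_distrib, Finset.sum_const, Finset.card_range,
              nsmul_eq_mul, Finset.mul_sum]
            rw [Finset.sum_comm, mul_assoc]
            congr 1
            refine Finset.sum_congr rfl fun l _ => Finset.sum_congr rfl fun k _ => ?_
            split_ifs
            · exact mul_comm _ _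
            · simp
        _ ≤ _ := by
            rw [hKδ]
            gcongr with l _
            refine le_trans (Finset.sum_le_sum fun k _ => ?_)
              ((sum_ite_le_self (η := δ) (sub_nonneg.2 (hVc l)) K).trans (min_le_left _ _))
            split_ifs with h4 h5 h5
            · exact le_rfl
            · refine absurd ?_ h5
              have := hT.le_quantile_of_lt hA hx0 hx hc (hv l) h4
              change _ ≤ quantile _ _ _ _ _ - c
              linarith
            · exact hδ0
            · exact le_rfl
    have h3 : η * ∑ l ∈ Finset.range M, (V l - c) = η * ∑ l ∈ Finset.range M, V l - c * a := by
      rw [Finset.sum_sub_distrib, Finset.sum_const, Finset.card_range, nsmul_eq_mul, mul_sub,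
        ← hMη]
      ring
    have h4 : (c + δ) * a = c * a + δ * a := by ring
    have h5 : 0 ≤ c * η := mul_nonneg hc hη0
    have h1' : intOn T A x ≤ intOn T A R + (c + δ) * a + ∑ k ∈ Finset.range K, δ * d k := h1
    linarith
  -- The value grid is refined, K → ∞, while the number M of quantiles stays fixed.
  have hlim : Tendsto (fun K : ℕ => intOn T A R + η * ∑ l ∈ Finset.range M, V l + s * η +
      (s - c) / K * a) atTop (𝓝 (intOn T A R + η * ∑ l ∈ Finset.range M, V l + s * η + 0 * a)) :=
    ((tendsto_const_div_atTop_nhds_zero_nat (s - c)).mul_const a).const_add _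
  rw [zero_mul, add_zero] at hlim
  exact ge_of_tendsto hlim (eventually_atTop.2 ⟨1, fun K hK => key K hK⟩)

end IsSubstochastic

theorem quantile_nonneg {T : L1Linf →ₗ[ℝ] L1Linf} {A : Set ℝ} {x : L0} {c : ℝ} (hc : 0 ≤ c)
    (v : ℝ) : 0 ≤ quantile T A x c v :=
  Real.sInf_nonneg fun _ hs => hc.trans hs.1

namespace IsSubstochastic

variable {T : L1Linf →ₗ[ℝ] L1Linf}

/-- A quantile of order (j + 1)η above r forces (j + 1)η to lie below the value of the functional on
{x > r}, and at most that value divided by η many j satisfy this. -/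
theorem sum_lt_quantile_le (hT : IsSubstochastic T) (A : Set ℝ) {x : L0}
    {c r : ℝ} (hc : 0 ≤ c) (hcr : c ≤ r) {M : ℕ} {η : ℝ} :
    ∑ j : Fin M, (if ENNReal.ofReal r <
        ENNReal.ofReal |quantile T A x c ((((j : ℕ) : ℝ) + 1) * η)| then (1 : ℝ≥0∞) else 0) *
          ENNReal.ofReal η ≤
      ENNReal.ofReal (intOn T A (level x r)) := by
  rcases le_or_gt η 0 with hη | hη
  · simp [ENNReal.ofReal_of_nonpos hη]
  set d := intOn T A (level x r) with hd
  have hd0 : 0 ≤ d := hT.intOn_nonneg A (levelInd_nonneg x r)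
  calc _ ≤ ∑ j : Fin M, ENNReal.ofReal (if (((j : ℕ) : ℝ) + 1) * η ≤ d then η else 0) := by
        refine Finset.sum_le_sum fun j _ => ?_
        split_ifs with h1 h2 h2
        · rw [one_mul]
        · refine absurd ?_ h2
          rw [abs_of_nonneg (quantile_nonneg hc _), ENNReal.ofReal_lt_ofReal_iff'] at h1
          exact (lt_of_lt_quantile hcr h1.1).le
        · simp
        · simp
    _ = ENNReal.ofReal (∑ j ∈ Finset.range M, (if ((j : ℝ) + 1) * η ≤ d then η else 0)) := by
        rw [ENNReal.ofReal_sum_of_nonneg fun j _ => by split_ifs <;> linarith, Finset.sum_range]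
    _ ≤ _ := ENNReal.ofReal_le_ofReal ((sum_ite_le_self hd0 M).trans (min_le_left _ _))

/-- Permuting the quantiles on the cells of equipartitions gives a function whose distribution
function is dominated by that of `x`. -/
theorem leb_lt_stepFun_quantile_le (hT : IsSubstochastic T) {x : L0} (hx : x ∈ S0) (hx0 : 0 ≤ x)
    {ι : Type*} [Countable ι] {A : ι → Set ℝ} (hA : ∀ i, MeasurableSet (A i))
    (hd : Pairwise (Function.onFun Disjoint A)) (hfin : ∀ i, leb (A i) < ∞) {M : ℕ}
    {B : ι × Fin M → Set ℝ} (hB : ∀ p, MeasurableSet (B p))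
    (hBd : Pairwise (Function.onFun Disjoint B))
    (hBm : ∀ p, leb (B p) = ENNReal.ofReal ((leb (A p.1)).toReal / M)) (σ : Equiv.Perm (Fin M))
    (s : ℝ≥0∞) :
    leb {t | s < ENNReal.ofReal |stepFun B (fun p => quantile T (A p.1) (topped x)
      (rearrTop x).toReal ((((σ p.2 : ℕ) : ℝ) + 1) * ((leb (A p.1)).toReal / M))) t|} ≤
      distr x s := by
  rcases lt_or_ge s (rearrTop x) with h | h
  · rw [distr_eq_top_of_lt h]; exact le_top
  rcases eq_or_ne s ∞ with rfl | hs
  · simp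
  set c := (rearrTop x).toReal with hc
  have hc0 : 0 ≤ c := ENNReal.toReal_nonneg
  have hr : ENNReal.ofReal s.toReal = s := ENNReal.ofReal_toReal hs
  have hcr : c ≤ s.toReal := ENNReal.toReal_mono hs h
  set V : ι × Fin M → ℝ := fun p => quantile T (A p.1) (topped x) c
    ((((σ p.2 : ℕ) : ℝ) + 1) * ((leb (A p.1)).toReal / M)) with hV
  set F : ℝ → ℝ≥0∞ := fun v => if s < ENNReal.ofReal |v| then 1 else 0 with hF
  have hF0 : F 0 = 0 := by simp [hF]
  have hm : MeasurableSet {t | s < ENNReal.ofReal |stepFun B V t|} :=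
    measurableSet_lt measurable_const
      (continuous_abs.measurable.comp (measurable_stepFun hB hBd V)).ennreal_ofReal
  calc _ = ∫⁻ t, F (stepFun B V t) ∂leb := by
        rw [← lintegral_indicator_one hm]
        exact lintegral_congr fun t => by
          simp only [indicator_apply, mem_ofPred_eq, hF, Pi.one_apply]
    _ = ∑' i, ∑ l, F (V (i, l)) * ENNReal.ofReal ((leb (A i)).toReal / M) := by
        rw [lintegral_comp_stepFun hB hBd V hF0, ENNReal.tsum_prod']
        simp_rw [tsum_fintype, hBm]
    _ ≤ ∑' i, ENNReal.ofReal (intOn T (A i) (level (topped x) s.toReal)) := by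
        refine ENNReal.tsum_le_tsum fun i => ?_
        have h1 := hT.sum_lt_quantile_le (A i) (x := topped x) hc0 hcr (M := M)
          (η := (leb (A i)).toReal / M)
        -- The M parts of a cell have equal measure, so the permutation does not affect the total.
        rw [hr, ← Equiv.sum_comp σ] at h1
        exact h1
    _ ≤ distr x s := by
        refine (hT.tsum_ofReal_intOn_le hA hd hfin (levelInd_nonneg _ _)).trans_eq ?_
        rw [lintegral_level (topped_nonneg x) ENNReal.toReal_nonneg, hr, distr_topped hx hx0]

/-- The part of the averages of `T x` that is not captured by `M` quantiles is small. -/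
theorem lintegral_stepFun_sub_le (hT : IsSubstochastic T) {x : L0} (hx : x ∈ S0) (hx0 : 0 ≤ x)
    (hxm : topped x ∈ L1Linf)
    {ι : Type*} [Countable ι] {A : ι → Set ℝ} (hA : ∀ i, MeasurableSet (A i))
    (hd : Pairwise (Function.onFun Disjoint A)) (hfin : ∀ i, leb (A i) < ∞) {M : ℕ} (hM : 0 < M)
    (s : ℝ≥0∞) :
    ∫⁻ t, (ENNReal.ofReal |stepFun A (fun i => max 0 (intOn T (A i) ⟨topped x, hxm⟩ /
        (leb (A i)).toReal - 1 / M * ∑ l ∈ Finset.range M, quantile T (A i) (topped x)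
          (rearrTop x).toReal (((l : ℝ) + 1) * ((leb (A i)).toReal / M)))) t| - s) ∂leb ≤
      excess x (M * s) := by
  have hM0 : (0 : ℝ) < M := by exact_mod_cast hM
  rcases lt_or_ge (M * s) (rearrTop x) with h | h
  · rw [excess_eq_top_of_lt h]; exact le_top
  rcases eq_or_ne s ∞ with rfl | hs
  · simp
  set c := (rearrTop x).toReal with hc
  have hc0 : 0 ≤ c := ENNReal.toReal_nonneg
  have hMs : (M : ℝ≥0∞) * s ≠ ∞ := ENNReal.mul_ne_top (ENNReal.natCast_ne_top M) hs
  -- With truncation level r = Ms the error term r(a/M) of the quantile estimate equals sa, exactly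
  -- what subtracting s on a cell of measure a removes. What remains is the integral of T(X - r)₊,
  -- where X is `topped x`.
  set r := ((M : ℝ≥0∞) * s).toReal with hr
  have hrM : ENNReal.ofReal r = M * s := ENNReal.ofReal_toReal hMs
  have hr0 : 0 ≤ r := ENNReal.toReal_nonneg
  have hrs : s = ENNReal.ofReal (r / M) := by
    rw [hr, ENNReal.toReal_mul, ENNReal.toReal_natCast, mul_div_cancel_left₀ _ hM0.ne',
      ENNReal.ofReal_toReal hs]
  have hcr : c ≤ r := ENNReal.toReal_mono hMs h
  have hS0 : topped x ∈ S0 := by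
    obtain ⟨s, hs⟩ := hx
    refine ⟨max s c, ?_⟩
    refine (measure_mono_ae ?_).trans_lt hs
    filter_upwards [coe_topped x, nonneg_iff_ae.1 hx0] with t h1 h2 h3
    change s < |x t|
    have h3 : max s c < |topped x t| := h3
    rw [h1, abs_of_nonneg (h2.trans (le_max_left _ _))] at h3
    rw [abs_of_nonneg h2]
    rcases lt_max_iff.1 h3 with h4 | h4
    · exact (le_max_left _ _).trans_lt h4
    · exact absurd h4 (not_lt.2 (le_max_right _ _))
  have hF0 : (fun v : ℝ => ENNReal.ofReal |v| - s) 0 = 0 := by simp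
  rw [lintegral_comp_stepFun (F := fun v : ℝ => ENNReal.ofReal |v| - s) hA hd _ hF0]
  set R : L1Linf := ⟨posExcess (topped x) r,
    posExcess_mem hxm (topped_nonneg x) (hc0.trans hcr)⟩ with hR
  have h2 := hT.tsum_ofReal_intOn_le hA hd hfin (f := R) (posExcess_nonneg _ _)
  rw [hR, lintegral_posExcess (topped_nonneg x) hr0, hrM, excess_topped hx hx0] at h2
  refine le_trans (ENNReal.tsum_le_tsum fun i => ?_) h2
  have h3 := hT.intOn_le_quantiles (hfin i) (x := ⟨topped x, hxm⟩) (topped_nonneg x) hS0 hc0 hcr hM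
  set a := (leb (A i)).toReal with ha
  set S := ∑ l ∈ Finset.range M, quantile T (A i) (topped x) c (((l : ℝ) + 1) * (a / M)) with hS
  set I := intOn T (A i) ⟨topped x, hxm⟩ with hI
  have h3 : I ≤ intOn T (A i) R + a / M * S + r * (a / M) := h3
  have hR0 : 0 ≤ intOn T (A i) R := hT.intOn_nonneg (A i) (posExcess_nonneg _ _)
  have ha0 : 0 ≤ a := ENNReal.toReal_nonneg
  change (ENNReal.ofReal |max 0 (I / a - 1 / M * S)| - s) * leb (A i) ≤
    ENNReal.ofReal (intOn T (A i) R)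
  rw [← ENNReal.ofReal_toReal (hfin i).ne, ← ha, abs_of_nonneg (le_max_left _ _), hrs,
    ← ENNReal.ofReal_sub _ (by positivity), ← ENNReal.ofReal_mul' ha0]
  refine ENNReal.ofReal_le_ofReal ?_
  rcases ha0.eq_or_lt with h0 | h0
  · rw [← h0, mul_zero]; exact hR0
  rcases le_total 0 (I / a - 1 / M * S) with h4 | h4
  · rw [max_eq_right h4]
    have : (I / a - 1 / M * S - r / M) * a = I - a / M * S - r * (a / M) := by
      field_simp
    linarith
  · rw [max_eq_left h4]
    have : 0 ≤ r / M * a := by positivity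
    linarith

end IsSubstochastic

/-! ### The orbit lies in Q'(x). -/

namespace BanachFunctionSpace

variable {E : BanachFunctionSpace} {x : L0}

/-- A function dominated by an average of functions `p k` with `distr (p k) ≤ distr x` up to an
error of small norm is close to `Q' (x)`. -/
theorem exists_mem_Qprime_of_le_average (hE : E.IsFullySymmetric) (hx : x ∈ E.carrier)
    (hφ : E.HasDilationLimit x 0) {u : L0} (hu0 : 0 ≤ u) {M : ℕ} (hM : 0 < M) {p : ℕ → ℝ → ℝ}
    (hp : ∀ k, Measurable (p k)) (hp0 : ∀ k t, 0 ≤ p k t)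
    (hpx : ∀ k s, leb {t | s < ENNReal.ofReal |p k t|} ≤ distr x s) {e : ℝ → ℝ}
    (he : Measurable e) (he0 : ∀ t, 0 ≤ e t)
    (heE : ofFun e he ∈ E.carrier)
    (hle : ∀ᵐ t ∂leb, u t ≤ 1 / (M : ℝ) * ∑ k ∈ Finset.range M, p k t + e t) :
    ∃ w ∈ E.Qprime x, E.norm (u - w) ≤ E.norm (ofFun e he) := by
  have hM0 : (0 : ℝ) < M := by exact_mod_cast hM
  set P : ℝ → ℝ := fun t => 1 / (M : ℝ) * ∑ k ∈ Finset.range M, p k t with hP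
  have hPm : Measurable P := (Finset.measurable_fun_sum _ fun k _ => hp k).const_mul _
  have hP0 : ∀ t, 0 ≤ P t := fun t =>
    mul_nonneg (by positivity) (Finset.sum_nonneg fun k _ => hp0 k t)
  set m : ℝ → ℝ := fun t => max (min (u t) (P t)) 0 with hm
  have hmm : Measurable m := (u.measurable.min hPm).max measurable_const
  have hm0 : ∀ t, 0 ≤ m t := fun t => le_max_right _ _
  have hmP : ∀ t, m t ≤ P t := fun t => max_le (min_le_right _ _) (hP0 t)
  -- The p k are shrunk by the common ratio m/P, so that they average to m = min(u, P) and their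
  -- distribution functions stay dominated. Where P vanishes so does m, and the division by zero is
  -- harmless.
  set q : ℕ → ℝ → ℝ := fun k t => p k t * (m t / P t) with hq
  have hqm : ∀ k, Measurable (q k) := fun k => (hp k).mul (hmm.div hPm)
  have hr0 : ∀ t, 0 ≤ m t / P t := fun t => div_nonneg (hm0 t) (hP0 t)
  have hr1 : ∀ t, m t / P t ≤ 1 := fun t => div_le_one_of_le₀ (hmP t) (hP0 t)
  have hq0 : ∀ k t, 0 ≤ q k t := fun k t => mul_nonneg (hp0 k t) (hr0 t)
  have hqp : ∀ k t, q k t ≤ p k t := fun k t => mul_le_of_le_one_right (hp0 k t) (hr1 t)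
  have hqQ : ∀ k, ofFun (q k) (hqm k) ∈ E.Qprime x := fun k => by
    refine mem_Qprime_of_distr_le hE hx hφ (nonneg_iff_ae.2 ?_) fun s => ?_
    · filter_upwards [coe_ofFun (q k) (hqm k)] with t ht
      rw [ht]; exact hq0 k t
    · rw [distr_ofFun]
      refine (measure_mono fun t ht => ?_).trans (hpx k s)
      refine lt_of_lt_of_le ht (ENNReal.ofReal_le_ofReal ?_)
      rw [abs_of_nonneg (hq0 k t), abs_of_nonneg (hp0 k t)]
      exact hqp k t
  have havg := average_mem_of_convex convex_Qprime hM fun k _ => hqQ k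
  have hsum : ∀ t, 1 / (M : ℝ) * ∑ k ∈ Finset.range M, q k t = m t := fun t => by
    simp only [hq]
    rw [← Finset.sum_mul, ← mul_assoc]
    change P t * (m t / P t) = m t
    rcases eq_or_ne (P t) 0 with h | h
    · rw [h, zero_mul]
      exact le_antisymm (hm0 t) ((hmP t).trans h.le)
    · rw [mul_div_cancel₀ _ h]
  refine ⟨_, havg, (ideal_ae hE heE ?_).2⟩
  rw [sum_ofFun, smul_ofFun]
  filter_upwards [AEEqFun.coeFn_sub u (ofFun (fun t => 1 / (M : ℝ) * ∑ k ∈ Finset.range M, q k t)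
    ((Finset.measurable_fun_sum _ fun k _ => hqm k).const_mul _)),
    coe_ofFun (fun t => 1 / (M : ℝ) * ∑ k ∈ Finset.range M, q k t)
    ((Finset.measurable_fun_sum _ fun k _ => hqm k).const_mul _), hle, nonneg_iff_ae.1 hu0,
    coe_ofFun e he] with t h1 h2 h3 h4 h5
  rw [h1, Pi.sub_apply, h2, hsum, h5, abs_of_nonneg (he0 t)]
  have h3 : u t ≤ P t + e t := h3
  have h6 : m t = min (u t) (P t) := max_eq_left (le_min h4 (hP0 t))
  rw [h6, abs_of_nonneg (sub_nonneg.2 (min_le_left _ _))]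
  rcases le_total (u t) (P t) with h | h
  · rw [min_eq_left h, sub_self]; exact he0 t
  · rw [min_eq_right h]; linarith

end BanachFunctionSpace

/-- Over all cyclic shifts, each part of a cell meets every quantile exactly once. -/
theorem sum_range_add_fin {M : ℕ} [NeZero M] (l : Fin M) (F : ℕ → ℝ) :
    ∑ k ∈ Finset.range M, F ((l + Fin.ofNat M k : Fin M) : ℕ) = ∑ j ∈ Finset.range M, F j := by
  rw [Finset.sum_range, Finset.sum_range,
    ← Equiv.sum_comp (Equiv.addLeft l) fun j : Fin M => F (j : ℕ)]
  refine Finset.sum_congr rfl fun k _ => ?_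
  rw [Equiv.coe_addLeft, Fin.ofNat_val_eq_self]

namespace BanachFunctionSpace

variable {E : BanachFunctionSpace} {x : L0}

/-- Up to a factor `b > 1`, the image of `x` under a substochastic operator lies in `Q' (x)`. -/
theorem smul_mem_Qprime_of_isSubstochastic (hE : E.IsFullySymmetric) (hx : x ∈ E.carrier)
    (hx0 : 0 ≤ x) (hφ : E.HasDilationLimit x 0) {T : L1Linf →ₗ[ℝ] L1Linf}
    (hT : IsSubstochastic T) {f : L1Linf} (hf : (f : L0) = x) {b : ℝ} (hb : 1 < b) :
    b⁻¹ • (T f : L0) ∈ E.Qprime x := by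
  have hb0 : 0 < b := one_pos.trans hb
  have hxS := hE.subset_S0 x hx
  have hf0 : 0 ≤ (f : L0) := hf ▸ hx0
  have hy0 := nonneg_iff_ae.1 (hT.nonneg f hf0)
  have hyE : (T f : L0) ∈ E.carrier :=
    (mem_of_excess_le hE hx fun s => hf ▸ hT.excess_le hf0 s).1
  have hxm := topped_mem hxS hx0 (carrier_le_L1Linf hE hx)
  set X : L1Linf := ⟨topped x, hxm⟩ with hX
  have hfX : (f : L0) ≤ X := by
    rw [← AEEqFun.coeFn_le, hf]
    filter_upwards [coe_topped x] with t ht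
    exact (le_max_left _ _).trans ht.ge
  have hyX := AEEqFun.coeFn_le.2 (hT.mono hfX)
  have hX0 := nonneg_iff_ae.1 (hT.nonneg X (topped_nonneg x))
  set z : ℝ → ℝ := fun t => max ((T X : L0) t) 0 with hz
  have hzX : z =ᵐ[leb] (T X : L0) := hX0.mono fun t ht => max_eq_left ht
  have hzm : Measurable z := (T X : L0).measurable.max measurable_const
  obtain ⟨A, hA, hd, hfin, hcov, hosc⟩ := exists_cells hzm hb
  set c := (rearrTop x).toReal with hc
  have hc0 : 0 ≤ c := ENNReal.toReal_nonneg
  -- On a cell z exceeds its mean by at most the factor b.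
  have hzI : ∀ i, ∀ t ∈ A i, z t * (leb (A i)).toReal ≤ b * intOn T (A i) X := fun i t ht => by
    have hI : IntegrableOn z (A i) leb :=
      (integrableOn_of_mem_L1Linf (T X).2 (hfin i)).congr (ae_restrict_of_ae hzX.symm)
    have h1 : ∫ _ in A i, z t ∂leb ≤ ∫ t' in A i, b * z t' ∂leb :=
      setIntegral_mono_on (integrableOn_const (hfin i).ne) (hI.const_mul b) (hA i)
        fun t' ht' => (hosc i t ht t' ht').2
    rw [setIntegral_const, smul_eq_mul, integral_const_mul,
      integral_congr_ae (ae_restrict_of_ae hzX), mul_comm] at h1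
    exact h1
  refine mem_Qprime_of_approx (E.carrier.smul_mem _ hyE) fun ε hε => ?_
  obtain ⟨M, hM, hMe⟩ := exists_nat_norm_lt hE hx hφ hε
  have hM0 : (0 : ℝ) < M := by exact_mod_cast hM
  have : NeZero M := ⟨hM.ne'⟩
  choose B hB hBd hBA hBm hBcov using fun i => exists_equal_split (hA i) (hfin i) hM
  set B' : (ℕ × ℤ) × Fin M → Set ℝ := fun p => B p.1 p.2 with hB'
  have hB'm : ∀ q, MeasurableSet (B' q) := fun q => hB q.1 q.2
  have hB'd : Pairwise (Function.onFun Disjoint B') := by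
    rintro ⟨i, l⟩ ⟨j, m⟩ hne
    rcases eq_or_ne i j with rfl | hij
    · exact hBd i fun h => hne (Prod.ext rfl h)
    · exact (hd hij).mono (hBA i l) (hBA j m)
  set V : ℕ × ℤ → ℕ → ℝ := fun i l => quantile T (A i) (topped x) c
    (((l : ℝ) + 1) * ((leb (A i)).toReal / M)) with hV
  have hV0 : ∀ i l, 0 ≤ V i l := fun i l => quantile_nonneg hc0 _
  have hstep0 : ∀ {ι : Type} (C : ι → Set ℝ) (W : ι → ℝ), (∀ i, 0 ≤ W i) →
      ∀ t, 0 ≤ stepFun C W t := fun C W hW t => by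
    rw [stepFun]
    split_ifs
    exacts [hW _, le_rfl]
  -- On the part numbered l of a cell, the k-th function takes the quantile numbered l + k modulo M.
  set p : ℕ → ℝ → ℝ := fun k => stepFun B' fun q : (ℕ × ℤ) × Fin M => V q.1 (q.2 + Fin.ofNat M k : Fin M) with hp
  set W : ℕ × ℤ → ℝ := fun i => max 0 (intOn T (A i) X / (leb (A i)).toReal -
    1 / M * ∑ l ∈ Finset.range M, V i l) with hW
  have hem : Measurable (stepFun A W) := measurable_stepFun hA hd W
  have he : ∀ s, excess (ofFun (stepFun A W) hem) s ≤ excess x (M * s) := fun s => by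
    rw [excess_ofFun]
    exact hT.lintegral_stepFun_sub_le hxS hx0 hxm hA hd hfin hM s
  obtain ⟨heE, hen⟩ := hMe M le_rfl _ he
  obtain ⟨w, hw, hle⟩ := exists_mem_Qprime_of_le_average hE hx hφ (u := b⁻¹ • (T f : L0))
    (nonneg_iff_ae.2 (by
      filter_upwards [hy0, AEEqFun.coeFn_smul b⁻¹ (T f : L0)] with t h1 h2
      rw [h2]; exact mul_nonneg (inv_nonneg.2 hb0.le) h1)) hM (p := p)
    (fun k => measurable_stepFun hB'm hB'd _)
    (fun k => hstep0 _ _ fun q => hV0 _ _)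
    (fun k => hT.leb_lt_stepFun_quantile_le hxS hx0 hA hd hfin hB'm hB'd
      (fun q => hBm q.1 q.2) (Equiv.addRight (Fin.ofNat M k))) hem
    (hstep0 _ _ fun i => le_max_left _ _) heE (by
      -- Points of null cells are discarded, since means over cells divide by the measure.
      have hnull : ∀ᵐ t ∂leb, ∀ i, t ∈ A i → 0 < (leb (A i)).toReal := by
        refine ae_all_iff.2 fun i => ?_
        rcases eq_or_ne (leb (A i)) 0 with h | h
        · filter_upwards [measure_eq_zero_iff_ae_notMem.1 h] with t ht h'
          exact absurd h' ht
        · exact Eventually.of_forall fun t _ => ENNReal.toReal_pos h (hfin i).ne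
      filter_upwards [hy0, AEEqFun.coeFn_smul b⁻¹ (T f : L0), hyX, hzX, ae_leb_pos,
        ae_all_iff.2 hBcov, hnull] with t h1 h2 h3 h4 h5 h6 h7
      rw [h2, Pi.smul_apply, smul_eq_mul]
      rcases le_or_gt (z t) 0 with hzt | hzt
      · have : (T f : L0) t = 0 := le_antisymm ((h3.trans h4.ge).trans hzt) h1
        rw [this, mul_zero]
        exact add_nonneg (mul_nonneg (by positivity) (Finset.sum_nonneg fun k _ =>
          hstep0 _ _ (fun q => hV0 _ _) t)) (hstep0 _ _ (fun i => le_max_left _ _) t)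
      · obtain ⟨i, hi⟩ := hcov t h5 hzt
        obtain ⟨l, hl⟩ := h6 i hi
        have hpk : ∀ k, p k t = V i (l + Fin.ofNat M k : Fin M) := fun k =>
          stepFun_of_mem hB'd _ (i := (i, l)) hl
        simp_rw [hpk]
        rw [sum_range_add_fin l (V i), stepFun_of_mem hd W hi]
        have ha := h7 i hi
        have h8 : b⁻¹ * (T f : L0) t ≤ intOn T (A i) X / (leb (A i)).toReal := by
          rw [inv_mul_le_iff₀ hb0, ← mul_div_assoc, le_div_iff₀ ha]
          exact (mul_le_mul_of_nonneg_right (h3.trans h4.ge) ha.le).trans (hzI i t hi)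
        have h9 : intOn T (A i) X / (leb (A i)).toReal -
          1 / M * ∑ l ∈ Finset.range M, V i l ≤ W i := le_max_right _ _
        linarith)
  exact ⟨w, hw, hle.trans_lt hen⟩

/-- The factor b tends to 1, and Q'(x) is closed. -/
theorem orbitPlus_subset_Qprime (hE : E.IsFullySymmetric) (hx : x ∈ E.carrier)
    (hx0 : 0 ≤ x) (hφ : E.HasDilationLimit x 0) : orbitPlus x ⊆ E.Qprime x := by
  rintro y ⟨T, hT, f, hf, rfl⟩
  have hf0 : 0 ≤ (f : L0) := hf ▸ hx0
  have hyE : (T f : L0) ∈ E.carrier :=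
    (mem_of_excess_le hE hx fun s => hf ▸ hT.excess_le hf0 s).1
  refine mem_Qprime_of_approx hyE fun ε hε => ?_
  have hn := norm_nonneg hyE
  set δ := ε / (E.norm (T f) + 1) with hδ
  have hδ0 : 0 < δ := by positivity
  have hb : 1 < 1 + δ := by linarith
  refine ⟨_, smul_mem_Qprime_of_isSubstochastic hE hx hx0 hφ hT hf hb, ?_⟩
  have h1 : (T f : L0) - (1 + δ)⁻¹ • (T f : L0) = (1 - (1 + δ)⁻¹) • (T f : L0) := by
    rw [sub_smul, one_smul]
  have h2 : 1 - (1 + δ)⁻¹ ≤ δ := by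
    have : 1 - (1 + δ)⁻¹ = δ * (1 + δ)⁻¹ := by field_simp; ring
    rw [this]
    exact mul_le_of_le_one_right hδ0.le (inv_le_one_of_one_le₀ hb.le)
  have h3 : 0 ≤ 1 - (1 + δ)⁻¹ := sub_nonneg.2 (inv_le_one_of_one_le₀ hb.le)
  rw [h1, E.norm_smul _ _ hyE, abs_of_nonneg h3]
  calc _ ≤ δ * E.norm (T f) := mul_le_mul_of_nonneg_right h2 hn
    _ < δ * (E.norm (T f) + 1) := by gcongr; linarith
    _ = ε := div_mul_cancel₀ _ (by positivity)

end BanachFunctionSpace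

/-! ### Construction of substochastic operators. -/

/-- The absolute value of an element of `L₁ + L_∞`. -/
def absL1Linf (f : L1Linf) : L1Linf :=
  ⟨ofFun (fun t => |(f : L0) t|) (continuous_abs.measurable.comp (f : L0).measurable),
    mem_L1Linf_of_abs_le f.2 (by
      filter_upwards [coe_ofFun (fun t => |(f : L0) t|)
        (continuous_abs.measurable.comp (f : L0).measurable)] with t ht
      rw [ht, abs_abs])⟩

theorem coe_absL1Linf (f : L1Linf) : (absL1Linf f : L0) =ᵐ[leb] fun t => |(f : L0) t| :=
  coe_ofFun _ (continuous_abs.measurable.comp (f : L0).measurable)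

theorem absL1Linf_nonneg (f : L1Linf) : 0 ≤ (absL1Linf f : L0) :=
  nonneg_iff_ae.2 ((coe_absL1Linf f).mono fun t ht => by rw [ht]; exact abs_nonneg _)

/-- A positive operator that is bounded by `1` in mean and in supremum is substochastic. -/
theorem exists_isSubstochastic (T : L1Linf →ₗ[ℝ] L0)
    (hpos : ∀ f : L1Linf, 0 ≤ (f : L0) → ∀ᵐ t ∂leb, 0 ≤ T f t)
    (hint : ∀ f : L1Linf, 0 ≤ (f : L0) →
      ∫⁻ t, ENNReal.ofReal (T f t) ∂leb ≤ ∫⁻ t, ENNReal.ofReal ((f : L0) t) ∂leb)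
    (hbdd : ∀ f : L1Linf, ∀ s : ℝ, 0 ≤ s → (∀ᵐ t ∂leb, (f : L0) t ≤ s) → ∀ᵐ t ∂leb, T f t ≤ s) :
    ∃ S : L1Linf →ₗ[ℝ] L1Linf, IsSubstochastic S ∧ ∀ f, (S f : L0) = T f := by
  -- Positivity gives |Tf| ≤ T|f|, so both contraction bounds need checking only on |f|; invariance
  -- of L₁ + L_∞ follows from them.
  have habs : ∀ f : L1Linf, ∀ᵐ t ∂leb, |T f t| ≤ T (absL1Linf f) t := fun f => by
    have h1 := hpos (absL1Linf f - f) (nonneg_iff_ae.2 (by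
      rw [AddSubgroupClass.coe_sub]
      filter_upwards [AEEqFun.coeFn_sub (absL1Linf f : L0) f, coe_absL1Linf f] with t h1 h2
      rw [h1, Pi.sub_apply, h2]
      linarith [le_abs_self ((f : L0) t)]))
    have h2 := hpos (absL1Linf f + f) (nonneg_iff_ae.2 (by
      rw [Submodule.coe_add]
      filter_upwards [AEEqFun.coeFn_add (absL1Linf f : L0) f, coe_absL1Linf f] with t h1 h2
      rw [h1, Pi.add_apply, h2]
      linarith [neg_abs_le ((f : L0) t)]))
    rw [map_sub] at h1
    rw [map_add] at h2
    filter_upwards [h1, h2, AEEqFun.coeFn_sub (T (absL1Linf f)) (T f),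
      AEEqFun.coeFn_add (T (absL1Linf f)) (T f)] with t h3 h4 h5 h6
    rw [h5, Pi.sub_apply] at h3
    rw [h6, Pi.add_apply] at h4
    rw [abs_le]
    constructor <;> linarith
  have hL1 : ∀ f : L1Linf, eLpNorm (T f) 1 leb ≤ eLpNorm (f : L0) 1 leb := fun f => by
    rw [eLpNorm_one_eq, eLpNorm_one_eq]
    calc _ ≤ ∫⁻ t, ENNReal.ofReal (T (absL1Linf f) t) ∂leb :=
          lintegral_mono_ae ((habs f).mono fun t ht => ENNReal.ofReal_le_ofReal ht)
      _ ≤ _ := hint _ (absL1Linf_nonneg f)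
      _ = _ := lintegral_congr_ae ((coe_absL1Linf f).mono fun t ht => by
          change ENNReal.ofReal _ = _; rw [ht])
  have hLi : ∀ f : L1Linf, (f : L0) ∈ Linf → eLpNorm (T f) ∞ leb ≤ eLpNorm (f : L0) ∞ leb :=
    fun f hf => by
    have hf' : eLpNorm (f : L0) ∞ leb < ∞ := hf
    have h1 := hbdd (absL1Linf f) _ ENNReal.toReal_nonneg (by
      filter_upwards [coe_absL1Linf f, ae_le_of_mem_Linf hf] with t h1 h2
      rwa [h1])
    rw [eLpNorm_exponent_top, ← ENNReal.ofReal_toReal hf'.ne]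
    refine eLpNormEssSup_le_of_ae_bound ?_
    filter_upwards [h1, habs f] with t h2 h3
    exact h3.trans h2
  have hmem : ∀ f : L1Linf, T f ∈ L1Linf := by
    rintro ⟨f, hf⟩
    obtain ⟨u, hu, v, hv, rfl⟩ := Submodule.mem_sup.1 hf
    have h1 : (⟨u + v, hf⟩ : L1Linf) =
        ⟨u, Submodule.mem_sup_left hu⟩ + ⟨v, Submodule.mem_sup_right hv⟩ := rfl
    rw [h1, map_add]
    exact Submodule.add_mem_sup ((hL1 ⟨u, Submodule.mem_sup_left hu⟩).trans_lt hu)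
      ((hLi ⟨v, Submodule.mem_sup_right hv⟩ hv).trans_lt hv)
  refine ⟨T.codRestrict L1Linf hmem, ⟨fun f hf => nonneg_iff_ae.2 (hpos f hf),
    fun f hf => ⟨(hL1 f).trans_lt hf, hL1 f⟩, fun f hf => ⟨(hLi f hf).trans_lt hf, hLi f hf⟩⟩,
    fun f => rfl⟩

theorem convex_orbitPlus (x : L0) : Convex ℝ (orbitPlus x) := by
  rintro y ⟨T, hT, f, hf, rfl⟩ z ⟨S, hS, g, hg, rfl⟩ a b ha hb hab
  have hcoe : ∀ h : L1Linf, L1Linf.subtype ((a • T + b • S) h) =ᵐ[leb]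
      fun t => a * (T h : L0) t + b * (S h : L0) t := fun h => by
    have h1 : L1Linf.subtype ((a • T + b • S) h) = a • (T h : L0) + b • (S h : L0) := rfl
    rw [h1]
    filter_upwards [AEEqFun.coeFn_add (a • (T h : L0)) (b • (S h : L0)),
      AEEqFun.coeFn_smul a (T h : L0), AEEqFun.coeFn_smul b (S h : L0)] with t h2 h3 h4
    rw [h2, Pi.add_apply, h3, h4]
    rfl
  obtain ⟨R, hR, hR'⟩ := exists_isSubstochastic (L1Linf.subtype ∘ₗ (a • T + b • S))
    (fun h hh => by
      filter_upwards [hcoe h, nonneg_iff_ae.1 (hT.nonneg h hh),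
        nonneg_iff_ae.1 (hS.nonneg h hh)] with t h1 h2 h3
      exact h1.ge.trans' (by positivity))
    (fun h hh => by
      calc _ = ∫⁻ t, (ENNReal.ofReal a * ENNReal.ofReal ((T h : L0) t) +
            ENNReal.ofReal b * ENNReal.ofReal ((S h : L0) t)) ∂leb := by
            refine lintegral_congr_ae ?_
            filter_upwards [hcoe h, nonneg_iff_ae.1 (hT.nonneg h hh),
              nonneg_iff_ae.1 (hS.nonneg h hh)] with t h1 h2 h3
            rw [← ENNReal.ofReal_mul ha, ← ENNReal.ofReal_mul hb,
              ← ENNReal.ofReal_add (mul_nonneg ha h2) (mul_nonneg hb h3)]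
            exact congrArg ENNReal.ofReal h1
        _ = ENNReal.ofReal a * ∫⁻ t, ENNReal.ofReal ((T h : L0) t) ∂leb +
            ENNReal.ofReal b * ∫⁻ t, ENNReal.ofReal ((S h : L0) t) ∂leb := by
            rw [lintegral_add_left ((T h : L0).measurable.ennreal_ofReal.const_mul _),
              lintegral_const_mul _ (T h : L0).measurable.ennreal_ofReal,
              lintegral_const_mul _ (S h : L0).measurable.ennreal_ofReal]
        _ ≤ ENNReal.ofReal a * ∫⁻ t, ENNReal.ofReal ((h : L0) t) ∂leb +
            ENNReal.ofReal b * ∫⁻ t, ENNReal.ofReal ((h : L0) t) ∂leb := by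
            exact add_le_add (mul_le_mul_right (hT.lintegral_le hh) _)
              (mul_le_mul_right (hS.lintegral_le hh) _)
        _ = _ := by rw [← add_mul, ← ENNReal.ofReal_add ha hb, hab, ENNReal.ofReal_one, one_mul])
    (fun h s hs hle => by
      filter_upwards [hcoe h, hT.le_const hs hle, hS.le_const hs hle] with t h1 h2 h3
      refine h1.le.trans ?_
      calc _ ≤ a * s + b * s := by gcongr
        _ = s := by rw [← add_mul, hab, one_mul])
  have hgf : g = f := Subtype.ext (hg.trans hf.symm)
  exact ⟨R, hR, f, hf, by rw [hR', hgf]; rfl⟩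

/-- Null sets pull back to null sets, so composition with ψ is well defined on classes modulo
equality almost everywhere. -/
theorem ae_comp_of_map_le {S : Set ℝ} (hS : MeasurableSet S) {ψ : ℝ → ℝ} (hψ : Measurable ψ)
    (hmap : (leb.restrict S).map ψ ≤ leb) {P : ℝ → Prop} (h : ∀ᵐ t ∂leb, P t) :
    ∀ᵐ t ∂leb, t ∈ S → P (ψ t) :=
  (ae_restrict_iff' hS).1 (ae_of_ae_map hψ.aemeasurable (ae_mono hmap h))

/-- Composition with a map that does not increase measure is substochastic. -/
theorem exists_isSubstochastic_comp {S : Set ℝ} (hS : MeasurableSet S) {ψ : ℝ → ℝ}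
    (hψ : Measurable ψ) (hmap : (leb.restrict S).map ψ ≤ leb) :
    ∃ T : L1Linf →ₗ[ℝ] L1Linf, IsSubstochastic T ∧
      ∀ f : L1Linf, (T f : L0) =ᵐ[leb] S.indicator fun t => (f : L0) (ψ t) := by
  have hm : ∀ f : L0, Measurable (S.indicator fun t => f (ψ t)) := fun f =>
    (f.measurable.comp hψ).indicator hS
  let T0 : L1Linf →ₗ[ℝ] L0 :=
    { toFun := fun f => ofFun (S.indicator fun t => (f : L0) (ψ t)) (hm f)
      map_add' := fun f g => by
        refine ofFun_congr (g := fun t => S.indicator (fun t => (f : L0) (ψ t)) t +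
          S.indicator (fun t => (g : L0) (ψ t)) t) (hg := (hm f).add (hm g)) ?_
        filter_upwards [ae_comp_of_map_le hS hψ hmap (AEEqFun.coeFn_add (f : L0) g)] with t ht
        by_cases h : t ∈ S
        · simp only [indicator_of_mem h]
          exact ht h
        · simp only [indicator_of_notMem h, add_zero]
      map_smul' := fun a f => by
        refine ofFun_congr (g := fun t => a * S.indicator (fun t => (f : L0) (ψ t)) t)
          (hg := (hm f).const_mul a) ?_
        filter_upwards [ae_comp_of_map_le hS hψ hmap (AEEqFun.coeFn_smul a (f : L0))] with t ht
        by_cases h : t ∈ S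
        · simp only [indicator_of_mem h]
          exact ht h
        · simp only [indicator_of_notMem h, mul_zero] }
  have hcoe : ∀ f : L1Linf, T0 f =ᵐ[leb] S.indicator fun t => (f : L0) (ψ t) := fun f =>
    coe_ofFun _ (hm f)
  obtain ⟨T, hT, hT'⟩ := exists_isSubstochastic T0
    (fun f hf => by
      filter_upwards [hcoe f, ae_comp_of_map_le hS hψ hmap (nonneg_iff_ae.1 hf)] with t h1 h2
      rw [h1]
      exact indicator_apply_nonneg h2)
    (fun f hf => by
      calc _ = ∫⁻ t in S, ENNReal.ofReal ((f : L0) (ψ t)) ∂leb := by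
            rw [← lintegral_indicator hS]
            refine lintegral_congr_ae ((hcoe f).mono fun t ht => ?_)
            change ENNReal.ofReal _ = _
            rw [ht]
            by_cases h : t ∈ S
            · simp only [indicator_of_mem h]
            · simp only [indicator_of_notMem h, ENNReal.ofReal_zero]
        _ = ∫⁻ t, ENNReal.ofReal ((f : L0) t) ∂((leb.restrict S).map ψ) :=
            (lintegral_map (f : L0).measurable.ennreal_ofReal hψ).symm
        _ ≤ _ := lintegral_mono' hmap le_rfl)
    (fun f s hs hle => by
      filter_upwards [hcoe f, ae_comp_of_map_le hS hψ hmap hle] with t h1 h2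
      rw [h1]
      by_cases h : t ∈ S
      · rw [indicator_of_mem h]; exact h2 h
      · rw [indicator_of_notMem h]; exact hs)
  exact ⟨T, hT, fun f => by rw [hT']; exact hcoe f⟩

/-- Each class of κ is transported separately. The targets are disjoint for different classes, so
the countably many pushforwards together still lie below Lebesgue measure. -/
theorem exists_glued_transport {κ κ' : ℝ → ℤ} (hκ : Measurable κ) (hκ' : Measurable κ')
    {S S' : Set ℝ} (hS : MeasurableSet S) (hS' : MeasurableSet S')
    (h : ∀ k, leb (S ∩ κ ⁻¹' {k}) ≤ leb (S' ∩ κ' ⁻¹' {k})) :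
    ∃ ψ : ℝ → ℝ, Measurable ψ ∧ (leb.restrict S).map ψ ≤ leb ∧
      ∀ᵐ t ∂leb, t ∈ S → ψ t ∈ S' ∧ κ' (ψ t) = κ t := by
  choose ψ hψ hmap _ using fun k => exists_transport (h k)
  have hY : ∀ k, MeasurableSet (S ∩ κ ⁻¹' {k}) := fun k => hS.inter (hκ (measurableSet_singleton k))
  have hX : ∀ k, MeasurableSet (S' ∩ κ' ⁻¹' {k}) := fun k =>
    hS'.inter (hκ' (measurableSet_singleton k))
  have hm : Measurable fun t => ψ (κ t) t := by
    have : Measurable fun p : ℤ × ℝ => ψ p.1 p.2 :=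
      measurable_from_prod_countable_right fun k => hψ k
    exact this.comp (hκ.prodMk measurable_id)
  refine ⟨fun t => ψ (κ t) t, hm, ?_, ?_⟩
  · refine Measure.le_iff.2 fun Z hZ => ?_
    rw [Measure.map_apply hm hZ, Measure.restrict_apply (hm hZ)]
    calc leb ((fun t => ψ (κ t) t) ⁻¹' Z ∩ S)
        ≤ ∑' k, leb (ψ k ⁻¹' Z ∩ (S ∩ κ ⁻¹' {k})) := by
          refine (measure_mono fun t ht => ?_).trans (measure_iUnion_le _)
          exact mem_iUnion.2 ⟨κ t, ht.1, ht.2, rfl⟩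
      _ ≤ ∑' k, leb.restrict (S' ∩ κ' ⁻¹' {k}) Z := by
          refine ENNReal.tsum_le_tsum fun k => ?_
          rw [← Measure.restrict_apply (hψ k hZ), ← Measure.map_apply (hψ k) hZ]
          exact hmap k Z
      _ = ∑' k, leb (Z ∩ (S' ∩ κ' ⁻¹' {k})) := by
          simp_rw [Measure.restrict_apply hZ]
      _ = leb (⋃ k, Z ∩ (S' ∩ κ' ⁻¹' {k})) := by
          refine (measure_iUnion (fun i j hij => Set.disjoint_left.2 fun t h1 h2 => hij ?_)
            fun k => hZ.inter (hX k)).symm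
          exact h1.2.2.symm.trans h2.2.2
      _ ≤ leb Z := measure_mono (iUnion_subset fun k => inter_subset_left)
  · have h1 : ∀ k, ∀ᵐ t ∂leb, t ∈ S ∩ κ ⁻¹' {k} → ψ k t ∈ S' ∩ κ' ⁻¹' {k} := fun k => by
      refine (ae_restrict_iff' (hY k)).1 (ae_of_ae_map (hψ k).aemeasurable ?_)
      exact ae_mono (hmap k) (ae_restrict_mem (hX k))
    filter_upwards [ae_all_iff.2 h1] with t ht htS
    exact ht (κ t) ⟨htS, rfl⟩

/-! ### Generators lie in the closure of the orbit. -/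

theorem ceil_logb_eq_iff {b : ℝ} (hb : 1 < b) (r : ℝ) {v : ℝ} (hv : 0 < v) (k : ℤ) :
    ⌈Real.logb b v - r⌉ = k ↔ b ^ ((k : ℝ) - 1 + r) < v ∧ v ≤ b ^ ((k : ℝ) + r) := by
  rw [Int.ceil_eq_iff, ← Real.lt_logb_iff_rpow_lt hb hv, ← Real.logb_le_iff_le_rpow hb hv,
    lt_sub_iff_add_lt, sub_le_iff_le_add]

/-- Finiteness is required only at the upper endpoint, so the level containing a positive x*(∞), of
infinite measure, is included. -/
theorem leb_Ioc_level {x : L0} (hx0 : 0 ≤ x) {l u : ℝ} (hl : 0 ≤ l) (hlu : l ≤ u)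
    (hu : distr x (ENNReal.ofReal u) < ∞) :
    leb {t | l < x t ∧ x t ≤ u} = distr x (ENNReal.ofReal l) - distr x (ENNReal.ofReal u) := by
  have hm : ∀ s : ℝ≥0∞, MeasurableSet {t | s < ENNReal.ofReal |x t|} := fun s =>
    measurableSet_lt measurable_const (measurable_ofReal_abs x)
  have hsub : {t | ENNReal.ofReal u < ENNReal.ofReal |x t|} ⊆
      {t | ENNReal.ofReal l < ENNReal.ofReal |x t|} := fun t ht =>
    lt_of_le_of_lt (ENNReal.ofReal_le_ofReal hlu) ht
  rw [distr, distr, ← measure_sdiff hsub (hm _).nullMeasurableSet hu.ne]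
  refine measure_congr ?_
  have h0u := hl.trans hlu
  filter_upwards [nonneg_iff_ae.1 hx0] with t ht
  refine propext ?_
  change (l < x t ∧ x t ≤ u) ↔
    (ENNReal.ofReal l < ENNReal.ofReal |x t| ∧ ¬ ENNReal.ofReal u < ENNReal.ofReal |x t|)
  rw [abs_of_nonneg ht, not_lt, ENNReal.ofReal_le_ofReal_iff h0u, ENNReal.ofReal_lt_ofReal_iff']
  exact and_congr_left fun _ => ⟨fun h => ⟨h, hl.trans_lt h⟩, fun h => h.1⟩

theorem nonneg_of_mem_gens {x y : L0} (hy : y ∈ gens x) : 0 ≤ y := by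
  refine nonneg_iff_ae.2 ?_
  filter_upwards [hy.2] with t ht
  by_contra h
  exact h (ht ((not_le.1 h).trans_le ENNReal.toReal_nonneg)).ge

/-- The generators of `Q' (x)` are approximated, with small relative error, by images of `x`
under substochastic operators. -/
theorem exists_isSubstochastic_of_mem_gens {x y : L0} (hxS : x ∈ S0) (hx0 : 0 ≤ x)
    (hy : y ∈ gens x) {f : L1Linf} (hf : (f : L0) = x) {b : ℝ} (hb : 1 < b) :
    ∃ T : L1Linf →ₗ[ℝ] L1Linf, IsSubstochastic T ∧
      ∀ᵐ t ∂leb, |(T f : L0) t - y t| ≤ (b - 1) * y t := by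
  have hb0 : 0 < b := one_pos.trans hb
  have hy0 := nonneg_of_mem_gens hy
  have hdis : ∀ s, distr y s = distr x s := equimeasurable_iff.1 hy.1
  have hyx := rearrTop_eq_of_distr_eq hdis
  set c := (rearrTop x).toReal with hc
  have hc0 : 0 ≤ c := ENNReal.toReal_nonneg
  have hcx : ENNReal.ofReal c = rearrTop x := ENNReal.ofReal_toReal (rearrTop_lt_top hxS).ne
  have hyc : ∀ᵐ t ∂leb, y t < c → y t = 0 := by
    have := hy.2
    rwa [hyx] at this
  -- The shift by one half keeps x*(∞) off the endpoints b^(k + r) of the levels. If x*(∞) = 0 the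
  -- logarithm has the default value 0, and the endpoints are positive anyway.
  set r := Real.logb b c - 1 / 2 with hr
  set lev : ℝ → ℤ := fun v => ⌈Real.logb b v - r⌉ with hlev
  have hlevm : Measurable lev :=
    Int.measurable_ceil.comp ((Real.measurable_log.div_const _).sub_const r)
  have hpow : ∀ s : ℝ, 0 < b ^ s := fun s => Real.rpow_pos_of_pos hb0 s
  have hmono : ∀ k : ℤ, b ^ ((k : ℝ) - 1 + r) ≤ b ^ ((k : ℝ) + r) := fun k =>
    Real.rpow_le_rpow_of_exponent_le hb.le (by linarith)
  have hset : ∀ z : L0, ∀ k : ℤ, {t | 0 < z t} ∩ (fun t => lev (z t)) ⁻¹' {k} =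
      {t | b ^ ((k : ℝ) - 1 + r) < z t ∧ z t ≤ b ^ ((k : ℝ) + r)} := fun z k => by
    ext t
    constructor
    · rintro ⟨h1, h2⟩
      exact (ceil_logb_eq_iff hb r h1 k).1 h2
    · rintro h
      have h1 : 0 < z t := (hpow _).trans h.1
      exact ⟨h1, (ceil_logb_eq_iff hb r h1 k).2 h⟩
  have hpos : ∀ z : L0, MeasurableSet {t | 0 < z t} := fun z =>
    measurableSet_lt measurable_const z.measurable
  obtain ⟨ψ, hψ, hmap, hae⟩ := exists_glued_transport (hlevm.comp y.measurable)
    (hlevm.comp x.measurable) (hpos y) (hpos x) (fun k => by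
      change leb ({t | 0 < y t} ∩ (fun t => lev (y t)) ⁻¹' {k}) ≤
        leb ({t | 0 < x t} ∩ (fun t => lev (x t)) ⁻¹' {k})
      rw [hset, hset]
      rcases lt_or_ge (b ^ ((k : ℝ) + r)) c with h | h
      · have h0 : leb {t | b ^ ((k : ℝ) - 1 + r) < y t ∧ y t ≤ b ^ ((k : ℝ) + r)} = 0 := by
          rw [measure_eq_zero_iff_ae_notMem]
          filter_upwards [hyc] with t ht h1
          have h1 : b ^ ((k : ℝ) - 1 + r) < y t ∧ y t ≤ b ^ ((k : ℝ) + r) := h1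
          have := hpow ((k : ℝ) - 1 + r)
          linarith [ht (h1.2.trans_lt h), h1.1]
        rw [h0]; exact zero_le
      · have hlt : c < b ^ ((k : ℝ) + r) := by
          refine lt_of_le_of_ne h fun heq => ?_
          have h1 : Real.logb b c = k + r := by
            rw [heq, Real.logb_rpow hb0 hb.ne']
          have h2 : (2 : ℝ) * k = 1 := by linarith
          have h3 : (2 : ℤ) * k = 1 := by exact_mod_cast h2
          omega
        have hfin : distr x (ENNReal.ofReal (b ^ ((k : ℝ) + r))) < ∞ := by
          refine distr_lt_top_of_lt ?_
          rw [← hcx]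
          exact (ENNReal.ofReal_lt_ofReal_iff (hpow _)).2 hlt
        rw [leb_Ioc_level hx0 (hpow _).le (hmono k) hfin,
          leb_Ioc_level hy0 (hpow _).le (hmono k) (by rwa [hdis]), hdis, hdis])
  obtain ⟨T, hT, hTf⟩ := exists_isSubstochastic_comp (hpos y) hψ hmap
  refine ⟨T, hT, ?_⟩
  filter_upwards [hTf f, hae, nonneg_iff_ae.1 hy0] with t h1 h2 h3
  rw [h1, hf]
  rcases h3.eq_or_lt with h0 | h0
  · rw [indicator_of_notMem (show t ∉ {t | 0 < y t} from fun h => h.ne h0), ← h0]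
    simp
  · rw [indicator_of_mem (show t ∈ {t | 0 < y t} from h0)]
    obtain ⟨h4, h5⟩ := h2 h0
    have h4 : 0 < x (ψ t) := h4
    have h6 := (ceil_logb_eq_iff hb r h0 (lev (y t))).1 rfl
    have h7 := (ceil_logb_eq_iff hb r h4 (lev (y t))).1 h5
    set l := b ^ ((lev (y t) : ℝ) - 1 + r) with hl
    have h8 : b ^ ((lev (y t) : ℝ) + r) = b * l := by
      rw [hl, show (lev (y t) : ℝ) + r = 1 + ((lev (y t) : ℝ) - 1 + r) by ring,
        Real.rpow_add hb0, Real.rpow_one]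
    rw [h8] at h6 h7
    have h9 : (b - 1) * l ≤ (b - 1) * y t := by
      have : 0 ≤ b - 1 := by linarith
      gcongr
      exact h6.1.le
    rw [abs_le]
    constructor <;> linarith [h6.1, h6.2, h7.1, h7.2]

namespace BanachFunctionSpace

variable {E : BanachFunctionSpace} {x : L0}

theorem orbitPlus_subset (hE : E.IsFullySymmetric) (hx : x ∈ E.carrier) (hx0 : 0 ≤ x) :
    orbitPlus x ⊆ E.carrier := by
  rintro y ⟨T, hT, f, hf, rfl⟩
  exact (mem_of_excess_le hE hx fun s => hf ▸ hT.excess_le (hf ▸ hx0) s).1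

theorem normClosure_subset {A B : Set L0} (h : A ⊆ E.normClosure B) :
    E.normClosure A ⊆ E.normClosure B := by
  rintro y ⟨hy, hy'⟩
  refine ⟨hy, fun ε hε => ?_⟩
  obtain ⟨z, hz, hzE, hyz⟩ := hy' (ε / 2) (by linarith)
  obtain ⟨w, hw, hwE, hzw⟩ := (h hz).2 (ε / 2) (by linarith)
  exact ⟨w, hw, hwE, (norm_sub_le hy hzE hwE).trans_lt (by linarith)⟩

/-- An error of at most δy pointwise is an error of at most δ times the norm of y. -/
theorem gens_subset_normClosure_orbitPlus (hE : E.IsFullySymmetric) (hx : x ∈ E.carrier)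
    (hx0 : 0 ≤ x) : gens x ⊆ E.normClosure (orbitPlus x) := by
  intro y hy
  have hyE := gens_subset hE hx hy
  refine ⟨hyE, fun ε hε => ?_⟩
  have hn := norm_nonneg hyE
  set δ := ε / (E.norm y + 1) with hδ
  have hδ0 : 0 < δ := by positivity
  obtain ⟨T, hT, hle⟩ := exists_isSubstochastic_of_mem_gens (hE.subset_S0 x hx) hx0 hy
    (f := ⟨x, carrier_le_L1Linf hE hx⟩) rfl (b := 1 + δ) (by linarith)
  have hmem : (T ⟨x, carrier_le_L1Linf hE hx⟩ : L0) ∈ orbitPlus x := ⟨T, hT, _, rfl, rfl⟩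
  refine ⟨_, hmem, orbitPlus_subset hE hx hx0 hmem, ?_⟩
  have h1 := (ideal_ae hE (E.carrier.smul_mem δ hyE)
    (y := y - (T ⟨x, carrier_le_L1Linf hE hx⟩ : L0)) (by
      filter_upwards [hle, AEEqFun.coeFn_sub y (T ⟨x, carrier_le_L1Linf hE hx⟩ : L0),
        AEEqFun.coeFn_smul δ y] with t h1 h2 h3
      rw [h2, h3, Pi.sub_apply, abs_sub_comm]
      refine h1.trans ?_
      rw [add_sub_cancel_left]
      exact le_abs_self _)).2
  rw [E.norm_smul _ _ hyE, abs_of_pos hδ0] at h1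
  calc _ ≤ δ * E.norm y := h1
    _ < δ * (E.norm y + 1) := by gcongr; linarith
    _ = ε := div_mul_cancel₀ _ (by positivity)

theorem Qprime_subset_normClosure_orbitPlus (hE : E.IsFullySymmetric) (hx : x ∈ E.carrier)
    (hx0 : 0 ≤ x) : E.Qprime x ⊆ E.normClosure (orbitPlus x) :=
  normClosure_subset (convexHull_min (gens_subset_normClosure_orbitPlus hE hx hx0)
    (convex_normClosure (convex_orbitPlus x)))

end BanachFunctionSpace

/-! ### Weighted integrals and ultralimits of substochastic operators. -/

namespace IsSubstochastic

variable {T : L1Linf →ₗ[ℝ] L1Linf}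

theorem abs_apply_le (hT : IsSubstochastic T) (f : L1Linf) :
    ∀ᵐ t ∂leb, |(T f : L0) t| ≤ |(T (absL1Linf f) : L0) t| := by
  have h1 : (f : L0) ≤ absL1Linf f := AEEqFun.coeFn_le.1 (by
    filter_upwards [coe_absL1Linf f] with t ht
    rw [ht]; exact le_abs_self _)
  have h2 : ((-f : L1Linf) : L0) ≤ absL1Linf f := AEEqFun.coeFn_le.1 (by
    rw [NegMemClass.coe_neg]
    filter_upwards [coe_absL1Linf f, AEEqFun.coeFn_neg (f : L0)] with t ht h
    rw [ht, h]; exact neg_le_abs _)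
  have h3 := hT.mono h2
  rw [map_neg, NegMemClass.coe_neg] at h3
  filter_upwards [AEEqFun.coeFn_le.2 (hT.mono h1), AEEqFun.coeFn_le.2 h3,
    AEEqFun.coeFn_neg (T f : L0)] with t h4 h5 h6
  rw [h6, Pi.neg_apply] at h5
  exact (abs_le.2 ⟨by linarith, h4⟩).trans (le_abs_self _)

theorem excess_apply_le (hT : IsSubstochastic T) (f : L1Linf) (s : ℝ≥0∞) :
    excess (T f) s ≤ excess f s :=
  (excess_mono (hT.abs_apply_le f) s).trans ((hT.excess_le (absL1Linf_nonneg f) s).trans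
    (excess_mono ((coe_absL1Linf f).mono fun t ht => by rw [ht, abs_abs]) s))

end IsSubstochastic

/-- Dominated convergence as s → ∞. Since substochastic operators do not increase the excess, one
level s serves all T f at once: this is the source of uniform absolute continuity. -/
theorem exists_excess_lt {u : L0} (hu : u ∈ L1Linf) {ε : ℝ≥0∞} (hε : 0 < ε) :
    ∃ s : ℝ≥0∞, s < ∞ ∧ excess u s < ε := by
  obtain ⟨s, hs, hs'⟩ := exists_excess_lt_top hu
  have h : Tendsto (fun n : ℕ => excess u (s + n)) atTop (𝓝 (∫⁻ _, 0 ∂leb)) := by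
    refine tendsto_lintegral_of_dominated_convergence (fun t => ENNReal.ofReal |u t| - s)
      (fun n => (measurable_ofReal_abs u).sub_const _)
      (fun n => Eventually.of_forall fun t => tsub_le_tsub_left le_self_add _) hs'.ne
      (Eventually.of_forall fun t => ?_)
    obtain ⟨N, hN⟩ := exists_nat_ge |u t|
    refine tendsto_const_nhds.congr' ?_
    filter_upwards [eventually_ge_atTop N] with n hn
    refine (tsub_eq_zero_of_le ?_).symm
    calc ENNReal.ofReal |u t| ≤ ENNReal.ofReal n := ENNReal.ofReal_le_ofReal
          (hN.trans (by exact_mod_cast hn))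
      _ = n := ENNReal.ofReal_natCast n
      _ ≤ _ := le_add_self
  rw [lintegral_zero] at h
  obtain ⟨n, hn⟩ := (h.eventually (gt_mem_nhds hε)).exists
  exact ⟨s + n, ENNReal.add_lt_top.2 ⟨hs, ENNReal.natCast_lt_top n⟩, hn⟩

/-- An integrable weight, constant on the intervals `[k, k + 1)`. -/
def weight (t : ℝ) : ℝ := (1 / 2) ^ ⌊t⌋₊

theorem weight_pos (t : ℝ) : 0 < weight t := by unfold weight; positivity

theorem weight_le_one (t : ℝ) : weight t ≤ 1 := pow_le_one₀ (by norm_num) (by norm_num)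

theorem measurable_weight : Measurable weight :=
  (Measurable.of_discrete (f := fun n : ℕ => (1 / 2 : ℝ) ^ n)).comp Nat.measurable_floor

/-- The interval `[k, k + 1)`. -/
def unitCell (k : ℕ) : Set ℝ := {t | ⌊t⌋₊ = k}

theorem measurableSet_unitCell (k : ℕ) : MeasurableSet (unitCell k) :=
  Nat.measurable_floor (measurableSet_singleton k)

theorem pairwise_disjoint_unitCell : Pairwise (Function.onFun Disjoint unitCell) :=
  fun _ _ hij => Set.disjoint_left.2 fun _ h1 h2 => hij (h1.symm.trans h2)

theorem iUnion_unitCell : ⋃ k, unitCell k = univ := eq_univ_of_forall fun t =>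
  mem_iUnion.2 ⟨⌊t⌋₊, rfl⟩

theorem leb_unitCell_le (k : ℕ) : leb (unitCell k) ≤ 1 := by
  -- The natural floor sends negative numbers to 0, so the cell numbered 0 contains the negative
  -- half-line, which is null for `leb`.
  have h : unitCell k ⊆ Iio (0 : ℝ) ∪ Icc (k : ℝ) (k + 1) := fun t ht => by
    rcases lt_or_ge t 0 with h | h
    · exact Or.inl h
    · have ht : ⌊t⌋₊ = k := ht
      exact Or.inr ⟨ht ▸ Nat.floor_le h, ht ▸ (Nat.lt_floor_add_one t).le⟩
  calc leb (unitCell k) ≤ leb (Iio 0) + leb (Icc (k : ℝ) (k + 1)) :=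
        (measure_mono h).trans (measure_union_le _ _)
    _ ≤ 0 + volume (Icc (k : ℝ) (k + 1)) := by
        gcongr
        · rw [leb, Measure.restrict_apply measurableSet_Iio]
          have : Iio (0 : ℝ) ∩ Ioi 0 = ∅ := by
            ext t; simp only [mem_inter_iff, mem_Iio, mem_Ioi, mem_empty_iff_false]
            constructor
            · rintro ⟨h1, h2⟩; exact lt_asymm h1 h2
            · exact False.elim
          rw [this, measure_empty]
        · exact Measure.restrict_le_self
    _ = 1 := by simp

theorem lintegral_weight_lt_top : ∫⁻ t, ENNReal.ofReal (weight t) ∂leb < ∞ := by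
  rw [← setLIntegral_univ, ← iUnion_unitCell,
    lintegral_iUnion measurableSet_unitCell pairwise_disjoint_unitCell]
  calc _ ≤ ∑' k : ℕ, ENNReal.ofReal ((1 / 2) ^ k) := by
        refine ENNReal.tsum_le_tsum fun k => ?_
        rw [setLIntegral_congr_fun (g := fun _ => ENNReal.ofReal ((1 / 2) ^ k))
          (measurableSet_unitCell k) fun t (ht : ⌊t⌋₊ = k) => by simp only [weight, ht],
          lintegral_const, Measure.restrict_apply_univ]
        exact mul_le_of_le_one_right' (leb_unitCell_le k)
    _ = ENNReal.ofReal (∑' k : ℕ, (1 / 2) ^ k) :=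
        (ENNReal.ofReal_tsum_of_nonneg (fun k => by positivity) summable_geometric_two).symm
    _ < ∞ := ENNReal.ofReal_lt_top

theorem integrable_weight : Integrable weight leb :=
  ⟨measurable_weight.aestronglyMeasurable, by
    rw [hasFiniteIntegral_iff_ofReal (Eventually.of_forall fun t => (weight_pos t).le)]
    exact lintegral_weight_lt_top⟩

/-- As the weight w is at most 1, |u|w is at most (|u| - s)₊ + sw. Hence weighted integrals of
elements of L₁ + L_∞ are finite, and small on sets of small weight once the excess is small. -/
theorem lintegral_abs_mul_weight_le (u : L0) (A : Set ℝ) (s : ℝ≥0∞) :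
    ∫⁻ t in A, ENNReal.ofReal |u t * weight t| ∂leb ≤
      excess u s + s * ∫⁻ t in A, ENNReal.ofReal (weight t) ∂leb := by
  calc _ ≤ ∫⁻ t in A, ((ENNReal.ofReal |u t| - s) + s * ENNReal.ofReal (weight t)) ∂leb := by
        refine lintegral_mono fun t => ?_
        rw [abs_mul, abs_of_pos (weight_pos t), ENNReal.ofReal_mul (abs_nonneg _)]
        calc _ ≤ ((ENNReal.ofReal |u t| - s) + s) * ENNReal.ofReal (weight t) := by
              gcongr; exact le_tsub_add
          _ ≤ _ := by
              rw [add_mul]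
              gcongr
              exact mul_le_of_le_one_right' (ENNReal.ofReal_le_one.2 (weight_le_one t))
    _ = (∫⁻ t in A, (ENNReal.ofReal |u t| - s) ∂leb) +
        s * ∫⁻ t in A, ENNReal.ofReal (weight t) ∂leb := by
        rw [lintegral_add_left ((measurable_ofReal_abs u).sub_const s),
          lintegral_const_mul _ measurable_weight.ennreal_ofReal]
    _ ≤ _ := by
        gcongr
        exact lintegral_mono' Measure.restrict_le_self le_rfl

theorem integrable_mul_weight {u : L0} (hu : u ∈ L1Linf) :
    Integrable (fun t => u t * weight t) leb := by
  obtain ⟨s, hs, hs'⟩ := exists_excess_lt_top hu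
  refine ⟨(u.measurable.mul measurable_weight).aestronglyMeasurable, ?_⟩
  rw [hasFiniteIntegral_iff_norm]
  have := lintegral_abs_mul_weight_le u univ s
  rw [setLIntegral_univ, setLIntegral_univ] at this
  exact this.trans_lt (ENNReal.add_lt_top.2 ⟨hs', ENNReal.mul_lt_top hs lintegral_weight_lt_top⟩)

/-- The weighted integral of `u` over `A`. -/
def wInt (A : Set ℝ) (u : L0) : ℝ := ∫ t in A, u t * weight t ∂leb

theorem ofReal_abs_wInt_le (A : Set ℝ) (u : L0) (s : ℝ≥0∞) :
    ENNReal.ofReal |wInt A u| ≤ excess u s + s * ∫⁻ t in A, ENNReal.ofReal (weight t) ∂leb := by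
  refine le_trans ?_ (lintegral_abs_mul_weight_le u A s)
  have := enorm_integral_le_lintegral_enorm (μ := leb.restrict A) fun t => u t * weight t
  simp_rw [Real.enorm_eq_ofReal_abs] at this
  exact this

theorem wInt_add (A : Set ℝ) {u v : L0} (hu : u ∈ L1Linf) (hv : v ∈ L1Linf) :
    wInt A (u + v) = wInt A u + wInt A v := by
  rw [wInt, wInt, wInt, ← integral_add (integrable_mul_weight hu).integrableOn
    (integrable_mul_weight hv).integrableOn]
  refine integral_congr_ae (ae_restrict_of_ae ((AEEqFun.coeFn_add u v).mono fun t ht => ?_))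
  simp only [ht, Pi.add_apply, add_mul]

theorem wInt_smul (A : Set ℝ) (a : ℝ) (u : L0) : wInt A (a • u) = a * wInt A u := by
  rw [wInt, wInt, ← integral_const_mul]
  refine integral_congr_ae (ae_restrict_of_ae ((AEEqFun.coeFn_smul a u).mono fun t ht => ?_))
  simp only [ht, Pi.smul_apply, smul_eq_mul, mul_assoc]

theorem wInt_union {A B : Set ℝ} (hAB : Disjoint A B) (hB : MeasurableSet B) {u : L0}
    (hu : u ∈ L1Linf) : wInt (A ∪ B) u = wInt A u + wInt B u :=
  setIntegral_union hAB hB (integrable_mul_weight hu).integrableOn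
    (integrable_mul_weight hu).integrableOn

theorem wInt_unitCell (k : ℕ) (T : L1Linf →ₗ[ℝ] L1Linf) (f : L1Linf) :
    intOn T (unitCell k) f = 2 ^ k * wInt (unitCell k) (T f) := by
  rw [wInt, intOn, ← integral_const_mul]
  refine setIntegral_congr_fun (measurableSet_unitCell k) fun t (ht : ⌊t⌋₊ = k) => ?_
  simp only [weight, ht]
  rw [mul_comm, mul_assoc, ← mul_pow]
  norm_num

/-- A finitely additive set function that is uniformly absolutely continuous with respect to a
finite measure `ν ≪ leb` has a density. -/
theorem exists_density {m : Set ℝ → ℝ} (ν : Measure ℝ) [IsFiniteMeasure ν] (hν : ν ≪ leb)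
    (hadd : ∀ A B, MeasurableSet A → MeasurableSet B → Disjoint A B → m (A ∪ B) = m A + m B)
    (hbdd : ∀ ε : ℝ≥0∞, 0 < ε → ∃ s : ℝ≥0∞, s < ∞ ∧
      ∀ A, MeasurableSet A → ENNReal.ofReal |m A| ≤ ε + s * ν A) :
    ∃ g : ℝ → ℝ, Measurable g ∧ Integrable g leb ∧
      ∀ A, MeasurableSet A → ∫ t in A, g t ∂leb = m A := by
  classical
  have hempty : m ∅ = 0 := by
    have := hadd ∅ ∅ .empty .empty (disjoint_bot_left)
    rw [union_empty] at this
    linarith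
  have hnull : ∀ A, MeasurableSet A → ν A = 0 → m A = 0 := fun A hA h => by
    have h1 : ENNReal.ofReal |m A| ≤ 0 := le_of_forall_pos_le_add fun ε hε => by
      obtain ⟨s, _, hs⟩ := hbdd ε hε
      have := hs A hA
      rw [h, mul_zero, add_zero] at this
      rwa [zero_add]
    rw [nonpos_iff_eq_zero, ENNReal.ofReal_eq_zero] at h1
    exact abs_nonpos_iff.1 h1
  have hsum : ∀ f : ℕ → Set ℝ, (∀ i, MeasurableSet (f i)) → Pairwise (Function.onFun Disjoint f) →
      ∀ s : Finset ℕ, m (⋃ i ∈ s, f i) = ∑ i ∈ s, m (f i) := fun f hf hd s => by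
    induction s using Finset.induction_on with
    | empty => simpa using hempty
    | insert a s ha ih =>
      rw [Finset.set_biUnion_insert, hadd _ _ (hf a) (Finset.measurableSet_biUnion _ fun i _ => hf i),
        ih, Finset.sum_insert ha]
      refine Set.disjoint_iUnion₂_right.2 fun i hi => hd fun h => ha (h ▸ hi)
  have hsigma : ∀ f : ℕ → Set ℝ, (∀ i, MeasurableSet (f i)) →
      Pairwise (Function.onFun Disjoint f) → HasSum (fun i => m (f i)) (m (⋃ i, f i)) :=
    fun f hf hd => by
    have hne : ∑' i, ν (f i) ≠ ∞ := by
      rw [← measure_iUnion hd hf]; exact measure_ne_top _ _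
    -- Finite additivity becomes σ-additivity because the tails are small: s is fixed first for ε/2,
    -- and then the ν-measure of the tail is made small compared with s.
    have hlim := ENNReal.tendsto_tsum_compl_atTop_zero hne
    rw [HasSum, SummationFilter.unconditional_filter, Metric.tendsto_nhds]
    intro ε hε
    obtain ⟨s, hs, hsm⟩ := hbdd (ENNReal.ofReal (ε / 2)) (ENNReal.ofReal_pos.2 (by linarith))
    have hlim' := ENNReal.Tendsto.const_mul hlim (Or.inr hs.ne)
    rw [mul_zero] at hlim'
    filter_upwards [hlim'.eventually (gt_mem_nhds (ENNReal.ofReal_pos.2 (half_pos hε)))] with F hF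
    have hU : ⋃ i, f i = (⋃ i ∈ F, f i) ∪ ⋃ i : {i // i ∉ F}, f i := by
      ext t
      simp only [mem_iUnion, mem_union, exists_prop, Subtype.exists]
      constructor
      · rintro ⟨i, hi⟩
        by_cases h : i ∈ F
        exacts [Or.inl ⟨i, h, hi⟩, Or.inr ⟨i, h, hi⟩]
      · rintro (⟨i, _, hi⟩ | ⟨i, _, hi⟩) <;> exact ⟨i, hi⟩
    have hdis : Disjoint (⋃ i ∈ F, f i) (⋃ i : {i // i ∉ F}, f i) :=
      Set.disjoint_iUnion₂_left.2 fun i hi => Set.disjoint_iUnion_right.2 fun j =>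
        hd fun h => j.2 (h ▸ hi)
    have hmU := MeasurableSet.iUnion fun i : {i // i ∉ F} => hf i
    have hνU : ν (⋃ i : {i // i ∉ F}, f i) = ∑' i : {i // i ∉ F}, ν (f i) :=
      measure_iUnion (fun i j hij => hd fun h => hij (Subtype.ext h)) fun i => hf i
    rw [hU, hadd _ _ (Finset.measurableSet_biUnion _ fun i _ => hf i) hmU hdis, hsum f hf hd,
      dist_comm, Real.dist_eq, add_sub_cancel_left]
    have h1 := hsm _ hmU
    rw [hνU] at h1
    have h2 : ENNReal.ofReal |m (⋃ i : {i // i ∉ F}, f i)| < ENNReal.ofReal ε := by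
      refine h1.trans_lt ?_
      calc _ < ENNReal.ofReal (ε / 2) + ENNReal.ofReal (ε / 2) :=
            ENNReal.add_lt_add_left ENNReal.ofReal_ne_top hF
        _ = ENNReal.ofReal ε := by
            rw [← ENNReal.ofReal_add (by linarith) (by linarith), add_halves]
    exact (ENNReal.ofReal_lt_ofReal_iff hε).1 h2
  let V : SignedMeasure ℝ :=
    { measureOf' := fun A => if MeasurableSet A then m A else 0
      empty' := by rw [if_pos MeasurableSet.empty, hempty]
      not_measurable' := fun A hA => if_neg hA
      m_iUnion' := fun f hf hd => by
        simp only [hf, MeasurableSet.iUnion hf, if_true]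
        exact hsigma f hf hd }
  have hV : ∀ A, MeasurableSet A → V A = m A := fun A hA => if_pos hA
  have hac : V ≪ᵥ leb.toENNRealVectorMeasure := by
    refine VectorMeasure.AbsolutelyContinuous.mk fun A hA h => ?_
    rw [Measure.toENNRealVectorMeasure_apply_measurable hA] at h
    rw [hV A hA]
    exact hnull A hA (hν h)
  refine ⟨V.rnDeriv leb, SignedMeasure.measurable_rnDeriv _ _, SignedMeasure.integrable_rnDeriv _ _,
    fun A hA => ?_⟩
  rw [← withDensityᵥ_apply (SignedMeasure.integrable_rnDeriv _ _) hA,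
    SignedMeasure.withDensityᵥ_rnDeriv_eq V leb hac, hV A hA]

/-- Along an ultrafilter, a sequence of substochastic operators converges, in the sense of
weighted integrals over measurable sets, to a substochastic operator. -/
theorem exists_ultralimit {T : ℕ → L1Linf →ₗ[ℝ] L1Linf} (hT : ∀ n, IsSubstochastic (T n))
    (U : Ultrafilter ℕ) :
    ∃ S : L1Linf →ₗ[ℝ] L1Linf, IsSubstochastic S ∧ ∀ f A, MeasurableSet A →
      Tendsto (fun n => wInt A (T n f)) U (𝓝 (wInt A (S f))) := by
  set ν : Measure ℝ := leb.withDensity fun t => ENNReal.ofReal (weight t) with hν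
  have : IsFiniteMeasure ν := isFiniteMeasure_withDensity lintegral_weight_lt_top.ne
  have hνapp : ∀ A, MeasurableSet A → ν A = ∫⁻ t in A, ENNReal.ofReal (weight t) ∂leb :=
    fun A hA => withDensity_apply _ hA
  -- For fixed f and A the weighted integrals of T n f stay in one compact interval, so an
  -- ultrafilter limit exists.
  have hexists : ∀ (f : L1Linf) (A : Set ℝ),
      ∃ L, Tendsto (fun n => wInt A (T n f)) U (𝓝 L) := fun f A => by
    obtain ⟨s, hs, hs'⟩ := exists_excess_lt_top f.2
    set C := excess f s + s * ∫⁻ t in A, ENNReal.ofReal (weight t) ∂leb with hC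
    have hCfin : C < ∞ := ENNReal.add_lt_top.2 ⟨hs', ENNReal.mul_lt_top hs
      ((lintegral_mono' Measure.restrict_le_self le_rfl).trans_lt lintegral_weight_lt_top)⟩
    have hmem : ∀ n, wInt A (T n f) ∈ Icc (-C.toReal) C.toReal := fun n => by
      rw [mem_Icc, ← abs_le]
      refine (ENNReal.ofReal_le_iff_le_toReal hCfin.ne).1 ?_
      exact (ofReal_abs_wInt_le A _ s).trans (add_le_add ((hT n).excess_apply_le f s) le_rfl)
    obtain ⟨L, _, hL⟩ := isCompact_Icc.ultrafilter_le_nhds' (U.map fun n => wInt A (T n f))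
      (Ultrafilter.mem_map.2 (Filter.univ_mem' hmem))
    exact ⟨L, hL⟩
  choose m hm using hexists
  have hdens : ∀ f, ∃ g : ℝ → ℝ, Measurable g ∧ Integrable g leb ∧
      ∀ A, MeasurableSet A → ∫ t in A, g t ∂leb = m f A := fun f => by
    refine exists_density ν (withDensity_absolutelyContinuous _ _) (fun A B hA hB hAB => ?_)
      fun ε hε => ?_
    · refine tendsto_nhds_unique (hm f (A ∪ B)) (((hm f A).add (hm f B)).congr fun n => ?_)
      exact (wInt_union hAB hB (T n f).2).symm
    · obtain ⟨s, hs, hs'⟩ := exists_excess_lt f.2 hε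
      refine ⟨s, hs, fun A hA => ?_⟩
      have h1 : Tendsto (fun n => ENNReal.ofReal |wInt A (T n f)|) U
          (𝓝 (ENNReal.ofReal |m f A|)) := ENNReal.tendsto_ofReal (hm f A).abs
      refine le_of_tendsto' h1 fun n => ?_
      refine (ofReal_abs_wInt_le A _ s).trans ?_
      rw [hνapp A hA]
      exact add_le_add (((hT n).excess_apply_le f s).trans hs'.le) le_rfl
  choose g hgm hgi hg using hdens
  have hkm : ∀ f, Measurable fun t => g f t / weight t := fun f => (hgm f).div measurable_weight
  have hw : ∀ t, weight t ≠ 0 := fun t => (weight_pos t).ne'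
  have huniq : ∀ {g₁ g₂ : ℝ → ℝ}, Integrable g₁ leb → Integrable g₂ leb →
      (∀ A, MeasurableSet A → ∫ t in A, g₁ t ∂leb = ∫ t in A, g₂ t ∂leb) → g₁ =ᵐ[leb] g₂ :=
    fun h1 h2 h => Integrable.ae_eq_of_forall_setIntegral_eq _ _ h1 h2 fun A hA _ => h A hA
  let T0 : L1Linf →ₗ[ℝ] L0 :=
    { toFun := fun f => ofFun (fun t => g f t / weight t) (hkm f)
      map_add' := fun f h => by
        have hae := huniq (hgi (f + h)) ((hgi f).add (hgi h)) fun A hA => by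
          simp only [Pi.add_apply]
          rw [integral_add (hgi f).integrableOn (hgi h).integrableOn, hg _ A hA, hg _ A hA,
            hg _ A hA]
          refine tendsto_nhds_unique (hm (f + h) A) (((hm f A).add (hm h A)).congr fun n => ?_)
          rw [map_add, Submodule.coe_add, wInt_add A (T n f).2 (T n h).2]
        refine ofFun_congr (g := fun t => g f t / weight t + g h t / weight t)
          (hg := (hkm f).add (hkm h)) (hae.mono fun t ht => ?_)
        simp only [ht, Pi.add_apply, add_div]
      map_smul' := fun a f => by
        have hae := huniq (hgi (a • f)) ((hgi f).const_mul a) fun A hA => by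
          rw [integral_const_mul, hg _ A hA, hg _ A hA]
          refine tendsto_nhds_unique (hm (a • f) A) (((hm f A).const_mul a).congr fun n => ?_)
          rw [map_smul, Submodule.coe_smul, wInt_smul]
        refine ofFun_congr (g := fun t => a * (g f t / weight t)) (hg := (hkm f).const_mul a)
          (hae.mono fun t ht => ?_)
        simp only [ht, mul_div_assoc] }
  have hcoe : ∀ f, T0 f =ᵐ[leb] fun t => g f t / weight t := fun f => coe_ofFun _ (hkm f)
  have hnonneg : ∀ f : L1Linf, 0 ≤ (f : L0) → ∀ᵐ t ∂leb, 0 ≤ g f t := fun f hf => by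
    refine ae_nonneg_of_forall_setIntegral_nonneg (hgi f) fun A hA _ => ?_
    rw [hg f A hA]
    refine ge_of_tendsto' (hm f A) fun n => ?_
    refine integral_nonneg_of_ae (ae_restrict_of_ae ?_)
    filter_upwards [nonneg_iff_ae.1 ((hT n).nonneg f hf)] with t ht
    exact mul_nonneg ht (weight_pos t).le
  obtain ⟨S, hS, hS'⟩ := exists_isSubstochastic T0
    (fun f hf => by
      filter_upwards [hcoe f, hnonneg f hf] with t h1 h2
      rw [h1]
      exact div_nonneg h2 (weight_pos t).le)
    (fun f hf => by
      -- On a unit cell the weight is constant, so its integrals there determine the unweighted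
      -- ones. The L₁ bound passes to the limit in finite sums of cells.
      have h1 : ∫⁻ t, ENNReal.ofReal (T0 f t) ∂leb =
          ∑' k, ENNReal.ofReal (2 ^ k * m f (unitCell k)) := by
        rw [← setLIntegral_univ, ← iUnion_unitCell,
          lintegral_iUnion measurableSet_unitCell pairwise_disjoint_unitCell]
        refine tsum_congr fun k => ?_
        rw [← hg f _ (measurableSet_unitCell k), ← integral_const_mul,
          ofReal_integral_eq_lintegral_ofReal ((hgi f).const_mul _).integrableOn
          (ae_restrict_of_ae ((hnonneg f hf).mono fun t ht => mul_nonneg (by positivity) ht))]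
        refine setLIntegral_congr_fun_ae (measurableSet_unitCell k) ?_
        filter_upwards [hcoe f] with t ht htk
        have htk : ⌊t⌋₊ = k := htk
        rw [ht, weight, htk]
        congr 1
        rw [one_div, inv_pow, div_inv_eq_mul, mul_comm]
      rw [h1]
      refine ENNReal.tsum_le_of_sum_range_le fun K => ?_
      have h2 : Tendsto (fun n => ∑ k ∈ Finset.range K,
          ENNReal.ofReal (intOn (T n) (unitCell k) f)) U
          (𝓝 (∑ k ∈ Finset.range K, ENNReal.ofReal (2 ^ k * m f (unitCell k)))) := by
        refine tendsto_finsetSum _ fun k _ => ENNReal.tendsto_ofReal ?_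
        simp_rw [wInt_unitCell]
        exact (hm f (unitCell k)).const_mul _
      refine le_of_tendsto' h2 fun n => ?_
      exact (ENNReal.sum_le_tsum _).trans ((hT n).tsum_ofReal_intOn_le measurableSet_unitCell
        pairwise_disjoint_unitCell (fun k => (leb_unitCell_le k).trans_lt ENNReal.one_lt_top) hf))
    (fun f s hs hle => by
      -- The bound T n f ≤ s is tested on sets, where it survives the limit, and then returns to a
      -- pointwise bound for the density.
      have h1 : ∀ᵐ t ∂leb, 0 ≤ s * weight t - g f t := by
        refine ae_nonneg_of_forall_setIntegral_nonneg
          ((integrable_weight.const_mul s).sub (hgi f)) fun A hA _ => ?_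
        rw [integral_sub (integrable_weight.const_mul s).integrableOn (hgi f).integrableOn,
          hg f A hA, sub_nonneg]
        refine le_of_tendsto' (hm f A) fun n => ?_
        refine integral_mono_ae (integrable_mul_weight (T n f).2).integrableOn
          (integrable_weight.const_mul s).integrableOn (ae_restrict_of_ae ?_)
        filter_upwards [(hT n).le_const hs hle] with t ht
        exact mul_le_mul_of_nonneg_right ht (weight_pos t).le
      filter_upwards [hcoe f, h1] with t h2 h3
      rw [h2, div_le_iff₀ (weight_pos t)]
      linarith)
  refine ⟨S, hS, fun f A hA => ?_⟩
  have h1 : wInt A (S f) = m f A := by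
    rw [hS', ← hg f A hA]
    refine integral_congr_ae (ae_restrict_of_ae ((hcoe f).mono fun t ht => ?_))
    simp only [ht]
    exact div_mul_cancel₀ _ (hw t)
  rw [h1]
  exact hm f A

/-! ### The orbit is closed; conclusion. -/

namespace BanachFunctionSpace

variable {E : BanachFunctionSpace} {x : L0}

/-- With s = v*(1), both s and the excess at s are at most the integral of v* over (0, 1), which the
norm of E controls. -/
theorem ofReal_abs_wInt_le_norm (hE : E.IsFullySymmetric) (hu : unitInd ∈ E.carrier) (A : Set ℝ)
    {v : L0} (hv : v ∈ E.carrier) :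
    ENNReal.ofReal |wInt A v| ≤ (1 + ∫⁻ t, ENNReal.ofReal (weight t) ∂leb) *
      ENNReal.ofReal (E.norm v / E.norm unitInd) := by
  have h1 := (le_lintegral_Ioc_rearr v one_pos).trans (lintegral_rearr_le hE hu hv)
  rw [ENNReal.ofReal_one, mul_one] at h1
  refine (ofReal_abs_wInt_le A v (rearr v 1)).trans ?_
  rw [add_mul, one_mul, mul_comm (∫⁻ t, _ ∂leb)]
  refine add_le_add (le_self_add.trans h1) ?_
  exact mul_le_mul' (le_add_self.trans h1) (lintegral_mono' Measure.restrict_le_self le_rfl)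

theorem tendsto_wInt (hE : E.IsFullySymmetric) (hu : unitInd ∈ E.carrier) (A : Set ℝ)
    {y : L0} (hy : y ∈ E.carrier) {z : ℕ → L0} (hz : ∀ n, z n ∈ E.carrier)
    (h : Tendsto (fun n => E.norm (y - z n)) atTop (𝓝 0)) :
    Tendsto (fun n => wInt A (z n)) atTop (𝓝 (wInt A y)) := by
  have h1 : Tendsto (fun n => (1 + ∫⁻ t, ENNReal.ofReal (weight t) ∂leb) *
      ENNReal.ofReal (E.norm (y - z n) / E.norm unitInd)) atTop (𝓝 0) := by
    have h2 := ENNReal.tendsto_ofReal (h.div_const (E.norm unitInd))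
    rw [zero_div, ENNReal.ofReal_zero] at h2
    have h3 := ENNReal.Tendsto.const_mul h2 (Or.inr
      (ENNReal.add_lt_top.2 ⟨ENNReal.one_lt_top, lintegral_weight_lt_top⟩).ne)
    rwa [mul_zero] at h3
  have h4 : ∀ n, wInt A y = wInt A (y - z n) + wInt A (z n) := fun n => by
    rw [← wInt_add A (carrier_le_L1Linf hE (E.carrier.sub_mem hy (hz n)))
      (carrier_le_L1Linf hE (hz n)), sub_add_cancel]
  have h5 := tendsto_of_tendsto_of_tendsto_of_le_of_le tendsto_const_nhds h1
    (fun _ => zero_le) fun n =>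
      ofReal_abs_wInt_le_norm hE hu A (E.carrier.sub_mem hy (hz n))
  have h6 := (ENNReal.tendsto_toReal ENNReal.zero_ne_top).comp h5
  rw [tendsto_iff_dist_tendsto_zero]
  refine h6.congr fun n => ?_
  rw [Function.comp_apply, ENNReal.toReal_ofReal (abs_nonneg _), dist_comm, Real.dist_eq, h4 n,
    add_sub_cancel_right]

/-- If T_n x tends to y in norm, the weighted integrals over sets converge to those of y. The
ultralimit S of the T_n has the same limits, so Sx = y. -/
theorem normClosure_orbitPlus_subset (hE : E.IsFullySymmetric) (hx : x ∈ E.carrier) : E.normClosure (orbitPlus x) ⊆ orbitPlus x := by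
  rintro y ⟨hy, hyx⟩
  set f : L1Linf := ⟨x, carrier_le_L1Linf hE hx⟩ with hf
  have hseq : ∀ n : ℕ, ∃ T : L1Linf →ₗ[ℝ] L1Linf, IsSubstochastic T ∧
      (T f : L0) ∈ E.carrier ∧ E.norm (y - T f) < 1 / ((n : ℝ) + 1) := fun n => by
    obtain ⟨z, ⟨T, hT, f', hf', rfl⟩, hz, hzn⟩ := hyx (1 / ((n : ℝ) + 1)) (by positivity)
    have : f' = f := Subtype.ext hf'
    subst this
    exact ⟨T, hT, hz, hzn⟩
  choose T hT hTE hTn using hseq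
  have hlim : Tendsto (fun n => E.norm (y - T n f)) atTop (𝓝 0) :=
    squeeze_zero (fun n => norm_nonneg (E.carrier.sub_mem hy (hTE n))) (fun n => (hTn n).le)
      tendsto_one_div_add_atTop_nhds_zero_nat
  rcases unitInd_mem_or_eq_zero hE hx with hu | h0
  · obtain ⟨S, hS, hSlim⟩ := exists_ultralimit hT (hyperfilter ℕ)
    refine ⟨S, hS, f, rfl, ?_⟩
    have hU : (hyperfilter ℕ : Filter ℕ) ≤ atTop := Nat.hyperfilter_le_atTop
    have h1 : (fun t => (S f : L0) t * weight t) =ᵐ[leb] fun t => y t * weight t :=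
      Integrable.ae_eq_of_forall_setIntegral_eq _ _ (integrable_mul_weight (S f).2)
        (integrable_mul_weight (carrier_le_L1Linf hE hy)) fun A hA _ =>
          tendsto_nhds_unique (hSlim f A hA) ((tendsto_wInt hE hu A hy hTE hlim).mono_left hU)
    refine AEEqFun.ext (h1.mono fun t ht => ?_)
    exact mul_right_cancel₀ (weight_pos t).ne' ht
  -- When x = 0 the orbit is {0}, and any operator of the sequence serves.
  · have hf0 : f = 0 := Subtype.ext h0
    refine ⟨T 0, hT 0, f, rfl, ?_⟩
    have h1 : ∀ n, (T n f : L0) = 0 := fun n => by rw [hf0, map_zero]; rfl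
    simp_rw [h1, sub_zero] at hlim
    rw [h1, E.eq_zero_of_norm y hy (tendsto_nhds_unique tendsto_const_nhds hlim)]

theorem orbitPlus_eq_Qprime (hE : E.IsFullySymmetric) (hx : x ∈ E.carrier) (hx0 : 0 ≤ x)
    (hφ : E.HasDilationLimit x 0) : orbitPlus x = E.Qprime x :=
  (orbitPlus_subset_Qprime hE hx hx0 hφ).antisymm
    ((Qprime_subset_normClosure_orbitPlus hE hx hx0).trans (normClosure_orbitPlus_subset hE hx))

end BanachFunctionSpace

end

end SymmOrbit

theorem mainTheorem3 (E : SymmOrbit.BanachFunctionSpace) (hE : E.IsFullySymmetric)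
    (x : SymmOrbit.L0) (hx : x ∈ E.carrier) (hx0 : 0 ≤ x) (hφ : E.HasDilationLimit x 0) :
    SymmOrbit.orbitPlus x = E.Qprime x := by
  exact SymmOrbit.BanachFunctionSpace.orbitPlus_eq_Qprime hE hx hx0 hφ
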